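/- Let $q\ge 2$ be a prime power, let $\chi$ be an $\mathbb F_q^*$-valued random variable, and let $\mathbf d\ge 1$, $\mathbf k\ge 3$ be bounded integer-valued random variables. Put $d=\mathbb E[\mathbf d]$, $k=\mathbb E[\mathbf k]$, let $D(x)=\mathbb E[x^{\mathbf d}]$, $K(x)=\mathbb E[x^{\mathbf k}]$, and for $\alpha\in[0,1]$ let $$\Phi(\alpha)=D\left(1-\frac{K'(\alpha)}{k}\right)+\frac dk\bigl(K(\alpha)+(1-\alpha)K'(\alpha)-1\bigr).$$ For an integer $n\ge 1$ let $\mathbf m$ be a Poisson variable with mean $dn/k$, and let $\mathbf d_i,\mathbf k_i,\chi_{i,j}$ $(i,j\ge 1)$ be copies of $\mathbf d,\mathbf k,\chi$, mutually independent and independent of $\mathbf m$. Given that $\sum_{i=1}^n\mathbf d_i=\sum_{i=1}^{\mathbf m}\mathbf k_i$ and that there is a simple bipartite graph with check nodes $a_1,\dots,a_{\mathbf m}$ of degrees $\mathbf k_1,\dots,\mathbf k_{\mathbf m}$ and variable nodes $x_1,\dots,x_n$ of degrees $\mathbf d_1,\dots,\mathbf d_n$, draw such a graph $\mathbf G$ uniformly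 at random, independently of the $\chi_{i,j}$, and let $\mathbf A$ be the $\mathbf m\times n$ matrix over $\mathbb F_q$ with entries $\mathbf A_{ij}=\mathbf 1\{a_ix_j\in E(\mathbf G)\}\,\chi_{i,j}$. Call $n$ admissible if $n\,\mathbb P[\mathbf d=j]$ is an integer for every $j$, $m=dn/k$ is an integer, and $m\,\mathbb P[\mathbf k=j]$ is an integer for every $j$. For admissible $n$ let $\mathfrak D$ be the event that $\mathbf m=m$ and that, for every integer $\ell$, exactly $n\,\mathbb P[\mathbf d=\ell]$ of $\mathbf d_1,\dots,\mathbf d_n$ and exactly $m\,\mathbb P[\mathbf k=\ell]$ of $\mathbf k_1,\dots,\mathbf k_m$ are equal to $\ell$. The rate of the $(\mathbf d,\mathbf k)$-LDPC code of block length $n$ is $$\mathrm{rate}_n(\mathbf d,\mathbf k)=\frac1n\,\mathbb E\bigl[\dim\ker\mathbf A\mid\mathfrak D\bigr].$$ Then, for all sufficiently large admissible $n$, the event $\mathfrak D$ has positive probability in this model (so that the rate is well defined), the maximum of $\Phi$ on $[0,1]$ is attained, and, as $n\to\infty$ along the admissible integers, $$\lim_{n\to\infty}\mathrm{rate}_n(\mathbf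 d,\mathbf k)=\max_{\alpha\in[0,1]}\Phi(\alpha).$$ -/

import Mathlib

open MeasureTheory ProbabilityTheory Filter Topology
open scoped ENNReal NNReal

namespace LDPC

noncomputable section

theorem hasSum_prod_pmf {ι α : Type*} [Fintype ι] [Countable α] (p : PMF α) :
    HasSum (fun x : ι → α => ∏ i, p (x i)) 1 := by
  classical
  let _ : MeasurableSpace α := ⊤
  have : MeasurableSingletonClass α := ⟨fun _ => trivial⟩
  have h := (Measure.pi (fun _ : ι => p.toMeasure)).toPMF.2
  convert h using 2 with x
  change _ = (Measure.pi (fun _ : ι => p.toMeasure)) {x}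
  rw [Measure.pi_singleton]
  exact Finset.prod_congr rfl fun i _ =>
    (p.toMeasure_apply_singleton (x i) (measurableSet_singleton _)).symm

/-- The law of a family `(X i)`, `i : ι`, of independent copies of a random variable with law `p`. -/
def iidPMF (ι : Type*) {α : Type*} [Fintype ι] [Countable α] (p : PMF α) : PMF (ι → α) :=
  ⟨fun x => ∏ i, p (x i), hasSum_prod_pmf p⟩

/-- The expectation of an `ℕ`-valued random variable with law `p`. -/
def mean (p : PMF ℕ) : ℝ := ∑' j : ℕ, (p j).toReal * (j : ℝ)

/-- The probability generating function of an `ℕ`-valued random variable with law `p`. -/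
def pgf (p : PMF ℕ) (x : ℝ) : ℝ := ∑' j : ℕ, (p j).toReal * x ^ j

/-- `Φ(α) = D(1 - K'(α)/k) + (d/k) (K(α) + (1 - α) K'(α) - 1)`, where `D`, `K` are the probability
generating functions of the variable and check degree distributions and `d`, `k` their means. -/
def Phi (pd pk : PMF ℕ) (α : ℝ) : ℝ :=
  pgf pd (1 - deriv (pgf pk) α / mean pk) +
    mean pd / mean pk * (pgf pk α + (1 - α) * deriv (pgf pk) α - 1)

/-- The simple bipartite graphs with check nodes `Fin m` and variable nodes `Fin n`, given by their
edge sets, in which check node `i` has degree `κ i` and variable node `j` has degree `δ j`. -/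
def tannerGraphs {m n : ℕ} (δ : Fin n → ℕ) (κ : Fin m → ℕ) : Finset (Finset (Fin m × Fin n)) :=
  {E | (∀ i, (E.filter fun e => e.1 = i).card = κ i) ∧
    ∀ j, (E.filter fun e => e.2 = j).card = δ j}

open Classical in
/-- The uniform distribution on the simple bipartite graphs with the given degrees. (If there is
none, the value is irrelevant: see `wellDefined`.) -/
def graphPMF {m n : ℕ} (δ : Fin n → ℕ) (κ : Fin m → ℕ) : PMF (Finset (Fin m × Fin n)) :=
  if h : (tannerGraphs δ κ).Nonempty then PMF.uniformOfFinset _ h else PMF.pure ∅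

/-- The outcomes of the random experiment with `n` variable nodes: the number of check nodes, the
variable degrees, the check degrees, the nonzero coefficients and the edges of the Tanner graph. -/
@[ext]
structure Sample (F : Type*) [Field F] (n : ℕ) where
  m : ℕ
  varDeg : Fin n → ℕ
  chkDeg : Fin m → ℕ
  chi : Fin m × Fin n → Fˣ
  edges : Finset (Fin m × Fin n)

instance (F : Type*) [Field F] (n : ℕ) : MeasurableSpace (Sample F n) := ⊤

variable {F : Type*} [Field F]

open Classical in
/-- The random matrix: entry `(i, j)` is `chi (i, j)` if `i` and `j` are adjacent, else `0`. -/
def Sample.matrix {n : ℕ} (ω : Sample F n) : Matrix (Fin ω.m) (Fin n) F :=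
  Matrix.of fun i j => if (i, j) ∈ ω.edges then (ω.chi (i, j) : F) else 0

/-- The nullity of the random matrix, the dimension of its kernel. -/
def Sample.nul {n : ℕ} (ω : Sample F n) : ℕ :=
  Module.finrank F (LinearMap.ker ω.matrix.mulVecLin)

/-- The joint law of all the ingredients: the number `m` of checks is Poisson with mean `d n / k`,
the degrees and the coefficients are independent copies of `pd`, `pk`, `pχ`, and the Tanner graph is
uniformly random given the degrees. -/
def sampleLaw [Finite F] (pd pk : PMF ℕ) (pχ : PMF Fˣ) (n : ℕ) : PMF (Sample F n) :=
  (poissonMeasure (Real.toNNReal (mean pd * n / mean pk))).toPMF.bind fun m =>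
    (iidPMF (Fin n) pd).bind fun δ =>
      (iidPMF (Fin m) pk).bind fun κ =>
        (iidPMF (Fin m × Fin n) pχ).bind fun χ =>
          (graphPMF δ κ).map fun E => ⟨m, δ, κ, χ, E⟩

/-- The event that the degree sums agree and that there is a simple Tanner graph with the drawn
degrees. -/
def wellDefined (F : Type*) [Field F] (n : ℕ) : Set (Sample F n) :=
  {ω | ∑ j, ω.varDeg j = ∑ i, ω.chkDeg i ∧ (tannerGraphs ω.varDeg ω.chkDeg).Nonempty}

/-- The law of the random matrix model: the ingredients conditioned on `wellDefined`. -/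
def modelLaw [Finite F] (pd pk : PMF ℕ) (pχ : PMF Fˣ) (n : ℕ) : Measure (Sample F n) :=
  (sampleLaw pd pk pχ n).toMeasure[|wellDefined F n]

/-- The event that `m = d n / k` and that all degree counts are exactly as prescribed. -/
def exactDegrees (F : Type*) [Field F] (pd pk : PMF ℕ) (n : ℕ) : Set (Sample F n) :=
  {ω | (ω.m : ℝ) = mean pd * n / mean pk ∧
    (∀ l : ℕ, ((Finset.univ.filter fun j => ω.varDeg j = l).card : ℝ) = n * (pd l).toReal) ∧
    ∀ l : ℕ, ((Finset.univ.filter fun i => ω.chkDeg i = l).card : ℝ) = ω.m * (pk l).toReal}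

/-- The block lengths `n` for which the prescribed degree counts are integers: `n P[d = j]`,
`m = d n / k` and `m P[k = j]` are integers for all `j`. -/
def admissible (pd pk : PMF ℕ) : Set ℕ :=
  {n | 0 < n ∧ (∀ j : ℕ, ∃ a : ℕ, (n : ℝ) * (pd j).toReal = a) ∧
    ∃ m : ℕ, (m : ℝ) = mean pd * n / mean pk ∧ ∀ j : ℕ, ∃ b : ℕ, (m : ℝ) * (pk j).toReal = b}

/-- The rate of the LDPC code of block length `n`: `n⁻¹ E[nul(A) | exact degrees]`. -/
def rate [Finite F] (pd pk : PMF ℕ) (pχ : PMF Fˣ) (n : ℕ) : ℝ :=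
  (n : ℝ)⁻¹ * ∫ ω, (ω.nul : ℝ) ∂((modelLaw pd pk pχ n)[|exactDegrees F pd pk n])

end

end LDPC

section

open Finset Equiv
open scoped BigOperators

set_option linter.unusedSectionVars false

namespace LDPC

/-! Work in the configuration model: a uniform permutation matches check sockets with variable
sockets. Let f(A, Q) = `mean A Q` be the expected nullity with only the rows of the checks in A
present and Q unused sockets pinned. Unused sockets are exchangeable, so x = 1 + f(A, Q+1) - f(A, Q)
is the probability that a fresh socket is frozen, i.e. that the unit vector of its variable lies in
the row space. A new row of degree k lowers the nullity unless it lies in that space; up to small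
errors this means that its k sockets are all frozen, with probability about x^k. So f solves a
discrete Hamilton–Jacobi equation f(A + a, Q) - f(A, Q) ≈ -1 + x^k, where x - 1 is the slope in Q,
with the convex initial value f(∅, Q) ≈ Σ_j (1 - Q/N)^(d_j), N being the number of sockets. The
maximum of the potential is the Hopf formula for the solution at Q = 0.

One direction of the equation is Jensen's inequality (`mean_sub_mean_insert_le`). For the other, a
dependent row with an unfrozen socket freezes it once its other sockets are pinned; averaging over W
numbers of pins makes this rare, and concentration of the nullity replaces the frozen fraction by a
mean slope over T pins (`le_mean_sub_mean_insert`).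

Lower bound: replacing x^k by its tangent at α gives a linear transport equation, which propagates
affine minorants (`affine_le_window`); starting from a tangent of the initial value yields
`potential_le_mean`. Upper bound: a sup-convolution with a parabola gives an explicit bound for the
slope at the maximizer (`supConv_insert_le`). Each check then contributes its own parameter, and
convexity makes all parameters equal (`exists_le_potential`).

Finally, configurations are simple with polynomially small probability, while the nullity is
subgaussian on scale √N, so conditioning on simplicity is harmless
(`abs_expect_simple_sub_mean_le`). All Tanner graphs have equally many simple configurations
(`expect_tannerGraphs_eq`). The bounds are uniform in degrees and coefficients, so they survive
averaging over the model. -/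

/-! ### Elementary inequalities -/

/-- The tangent line inequality for `x ↦ x ^ k`. -/
theorem tangent_le_pow {x y : ℝ} (hx : 0 ≤ x) (hy : 0 ≤ y) (k : ℕ) :
    k * y ^ (k - 1) * x - (k - 1) * y ^ k ≤ x ^ k := by
  induction k with
  | zero => simp
  | succ k ih =>
    rcases k with _ | k
    · simp
    · have h1 : 0 ≤ (x - y) * (x ^ (k + 1) - y ^ (k + 1)) := by
        rcases le_total x y with h | h
        · exact mul_nonneg_of_nonpos_of_nonpos (sub_nonpos.2 h)
            (sub_nonpos.2 (pow_le_pow_left₀ hx h _))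
        · exact mul_nonneg (sub_nonneg.2 h) (sub_nonneg.2 (pow_le_pow_left₀ hy h _))
      have h2 := mul_le_mul_of_nonneg_left ih hy
      simp only [Nat.add_sub_cancel] at h2 ⊢
      push_cast at h2 ⊢
      have e1 : x ^ (k + 1 + 1) = x * x ^ (k + 1) := by ring
      have e2 : y ^ (k + 1 + 1) = y * y ^ (k + 1) := by ring
      have e3 : y ^ (k + 1) = y * y ^ k := by ring
      rw [e1, e2]
      rw [e3] at h1 h2 ⊢
      nlinarith

/-- This is the tangent inequality taken at `x`: on [0, 1] the slope of the `k`th power is at most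
`k`. -/
theorem pow_le_pow_add_mul {x y e : ℝ} (hx : 0 ≤ x) (hx1 : x ≤ 1) (hy : 0 ≤ y)
    (he : 0 ≤ e) (h : x ≤ y + e) (k : ℕ) : x ^ k ≤ y ^ k + k * e := by
  have h1 := tangent_le_pow hy hx k
  have h2 : x ^ (k - 1) ≤ 1 := pow_le_one₀ hx hx1
  have h3 : 0 ≤ x ^ (k - 1) := pow_nonneg hx _
  rcases k with _ | k
  · simp
  · simp only [Nat.add_sub_cancel] at *
    push_cast at *
    have h4 : x ^ (k + 1) = x ^ k * x := by ring
    have : (k + 1) * x ^ k * (x - y) ≤ (k + 1) * e := by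
      have : (k + 1 : ℝ) * (x ^ k * (x - y)) ≤ (k + 1) * e := by
        apply mul_le_mul_of_nonneg_left _ (by positivity)
        nlinarith
      linarith
    rw [h4] at h1 ⊢
    nlinarith

/-! ### Averages -/

variable {Ω : Type*} [Fintype Ω]

theorem pow_expect_le [Nonempty Ω] (f : Ω → ℝ) (hf : ∀ ω, 0 ≤ f ω) (k : ℕ) :
    (𝔼 ω, f ω) ^ k ≤ 𝔼 ω, f ω ^ k := by
  set y := 𝔼 ω, f ω with hy
  have hy0 : 0 ≤ y := expect_nonneg fun i _ => hf i
  have h : 𝔼 ω, (k * y ^ (k - 1) * f ω - (k - 1) * y ^ k) ≤ 𝔼 ω, f ω ^ k :=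
    expect_le_expect fun i _ => tangent_le_pow (hf i) hy0 k
  rw [expect_sub_distrib, ← mul_expect, ← hy, Fintype.expect_const] at h
  rcases k with _ | k
  · simp
  · simp only [Nat.add_sub_cancel] at h
    push_cast at h
    have e : y ^ (k + 1) = y ^ k * y := by ring
    rw [e] at h ⊢
    linarith

theorem exp_expect_le [Nonempty Ω] (f : Ω → ℝ) : Real.exp (𝔼 ω, f ω) ≤ 𝔼 ω, Real.exp (f ω) := by
  set y := 𝔼 ω, f ω with hy
  have h : 𝔼 ω, (Real.exp y * (f ω - y + 1)) ≤ 𝔼 ω, Real.exp (f ω) :=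
    expect_le_expect fun i _ => by
      have := Real.add_one_le_exp (f i - y)
      calc Real.exp y * (f i - y + 1) ≤ Real.exp y * Real.exp (f i - y) := by gcongr
        _ = _ := by rw [← Real.exp_add]; ring_nf
  rw [← mul_expect, expect_add_distrib, expect_sub_distrib, ← hy, Fintype.expect_const,
    Fintype.expect_const] at h
  linarith

/-- The expected exponential of a centred variable with values in `[-b, b]`. -/
theorem expect_exp_le [Nonempty Ω] (f : Ω → ℝ) {b : ℝ} (hb : ∀ ω, |f ω| ≤ b)
    (h0 : 𝔼 ω, f ω = 0) : 𝔼 ω, Real.exp (f ω) ≤ Real.exp (b ^ 2 / 2) := by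
  have hb0 : 0 ≤ b := (abs_nonneg _).trans (hb (Classical.arbitrary Ω))
  rcases hb0.eq_or_lt with rfl | hb0
  · have : ∀ ω, f ω = 0 := fun ω => abs_nonpos_iff.1 (hb ω)
    simp [this]
  refine le_trans ?_ (Real.cosh_le_exp_half_sq b)
  have key : ∀ ω, Real.exp (f ω) ≤ Real.cosh b + f ω * (Real.sinh b / b) := by
    intro ω
    have h1 := (abs_le.1 (hb ω)).1
    have h2 := (abs_le.1 (hb ω)).2
    have hs : (b - f ω) / (2 * b) + (b + f ω) / (2 * b) = 1 := by field_simp; ring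
    have hc := convexOn_exp.2 (Set.mem_univ (-b)) (Set.mem_univ b)
      (div_nonneg (by linarith) (by linarith)) (div_nonneg (by linarith) (by linarith)) hs
    simp only [smul_eq_mul] at hc
    have e : (b - f ω) / (2 * b) * -b + (b + f ω) / (2 * b) * b = f ω := by field_simp; ring
    rw [e] at hc
    refine hc.trans (le_of_eq ?_)
    rw [Real.cosh_eq, Real.sinh_eq]
    field_simp
    ring
  refine (expect_le_expect fun ω _ => key ω).trans ?_
  rw [expect_add_distrib, ← expect_mul, h0, Fintype.expect_const]
  simp

/-! ### Concentration on the symmetric group -/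

/-- `decomposeFin` records the image of 0 and a permutation of the rest. Changing the image costs
two transpositions from the left, and by the next lemma a transposition of the rest is one of the
whole. -/
theorem decomposeFin_symm_swap_left {N : ℕ} (p p' : Fin (N + 1)) (τ : Perm (Fin N)) :
    Perm.decomposeFin.symm (p', τ) =
      swap 0 p' * (swap 0 p * Perm.decomposeFin.symm (p, τ)) := by
  ext x
  refine Fin.cases ?_ (fun x => ?_) x <;> simp

theorem decomposeFin_symm_swap_right {N : ℕ} (p : Fin (N + 1)) (i j : Fin N) (τ : Perm (Fin N)) :
    Perm.decomposeFin.symm (p, swap i j * τ) =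
      swap (swap 0 p i.succ) (swap 0 p j.succ) * Perm.decomposeFin.symm (p, τ) := by
  ext x
  refine Fin.cases ?_ (fun x => ?_) x
  · simp only [Perm.decomposeFin_symm_apply_zero, Perm.mul_apply]
    rw [swap_apply_of_ne_of_ne]
    · intro h
      have := congrArg (swap 0 p) h
      simp [(Fin.succ_ne_zero i).symm] at this
    · intro h
      have := congrArg (swap 0 p) h
      simp [(Fin.succ_ne_zero j).symm] at this
  · simp only [Perm.decomposeFin_symm_apply_succ, Perm.mul_apply]
    exact congrArg _ (((swap 0 p).injective.comp (Fin.succ_injective N)).swap_apply i j (τ x)).symm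


/-- An Azuma–Hoeffding argument by induction: expose the image of 0. The conditional mean `g p`
varies by at most `2 * b`, since changing `p` takes two transpositions, and the remaining
fluctuation is covered by the induction hypothesis. -/
theorem expect_exp_perm_fin_le {N : ℕ} {b : ℝ} (f : Perm (Fin N) → ℝ)
    (hf : ∀ σ i j, |f (swap i j * σ) - f σ| ≤ b) :
    𝔼 σ, Real.exp (f σ - 𝔼 τ, f τ) ≤ Real.exp (N * ((2 * b) ^ 2 / 2)) := by
  induction N with
  | zero =>
    simp
  | succ N ih =>
    set g : Fin (N + 1) → ℝ := fun p => 𝔼 τ, f (Perm.decomposeFin.symm (p, τ)) with hg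
    have hsplit : ∀ h : Perm (Fin (N + 1)) → ℝ,
        𝔼 σ, h σ = 𝔼 p, 𝔼 τ, h (Perm.decomposeFin.symm (p, τ)) := by
      intro h
      rw [← Finset.expect_product' univ univ
        (fun p τ => h (Perm.decomposeFin.symm (p, τ)))]
      exact Fintype.expect_equiv Perm.decomposeFin _ _ (fun σ => by simp)
    have hmean : 𝔼 τ, f τ = 𝔼 p, g p := hsplit f
    set M := 𝔼 τ, f τ
    have hgd : ∀ p p', |g p' - g p| ≤ 2 * b := by
      intro p p'
      rw [hg]
      simp only
      rw [← expect_sub_distrib]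
      refine (abs_expect_le _ _).trans (expect_le univ_nonempty fun τ _ => ?_)
      rw [decomposeFin_symm_swap_left p p' τ]
      have h1 := hf (swap 0 p * Perm.decomposeFin.symm (p, τ)) 0 p'
      have h2 := hf (Perm.decomposeFin.symm (p, τ)) 0 p
      rw [abs_le] at *
      constructor <;> linarith [h1.1, h1.2, h2.1, h2.2]
    have hgM : ∀ p, |g p - M| ≤ 2 * b := by
      intro p
      have : g p - M = 𝔼 p', (g p - g p') := by
        rw [expect_sub_distrib, Fintype.expect_const, hmean]
      rw [this]
      exact (abs_expect_le _ _).trans (expect_le univ_nonempty fun p' _ => hgd p' p)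
    have hg0 : 𝔼 p, (g p - M) = 0 := by
      rw [expect_sub_distrib, Fintype.expect_const, hmean, sub_self]
    have hin : ∀ p, 𝔼 τ, Real.exp (f (Perm.decomposeFin.symm (p, τ)) - M) ≤
        Real.exp (N * ((2 * b) ^ 2 / 2)) * Real.exp (g p - M) := by
      intro p
      have h := ih (fun τ => f (Perm.decomposeFin.symm (p, τ))) (fun τ i j => by
        rw [decomposeFin_symm_swap_right]
        exact hf _ _ _)
      refine le_trans (le_of_eq ?_) (mul_le_mul_of_nonneg_right h (Real.exp_pos _).le)
      rw [expect_mul]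
      refine expect_congr rfl fun τ _ => ?_
      rw [← Real.exp_add]
      congr 1
      simp only [hg]
      ring
    rw [hsplit]
    refine (expect_le_expect fun p _ => hin p).trans ?_
    rw [← mul_expect]
    refine (mul_le_mul_of_nonneg_left (expect_exp_le _ hgM hg0) (Real.exp_pos _).le).trans ?_
    rw [← Real.exp_add]
    refine le_of_eq (congrArg _ ?_)
    push_cast
    ring

variable {ι : Type*} [Fintype ι] [DecidableEq ι]

/-- A function on the symmetric group that changes by at most `b` under transpositions has
subgaussian fluctuations. -/
theorem expect_exp_perm_le {b : ℝ} (f : Perm ι → ℝ)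
    (hf : ∀ σ i j, |f (swap i j * σ) - f σ| ≤ b) :
    𝔼 σ, Real.exp (f σ - 𝔼 τ, f τ) ≤ Real.exp (Fintype.card ι * (2 * b ^ 2)) := by
  set e := Fintype.equivFin ι
  have h := expect_exp_perm_fin_le (b := b) (fun σ => f (e.permCongr.symm σ)) (by
    intro σ i j
    have : e.permCongr.symm (swap i j * σ) = swap (e.symm i) (e.symm j) * e.permCongr.symm σ := by
      ext x
      simp [Equiv.permCongr_apply, ← e.symm.injective.swap_apply]
    rw [this]
    exact hf _ _ _)
  have hm : ∀ g : Perm ι → ℝ, 𝔼 σ, g σ = 𝔼 σ, g (e.permCongr.symm σ) := fun g =>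
    Fintype.expect_equiv e.permCongr _ _ (fun σ => by rw [Equiv.symm_apply_apply])
  rw [hm f, hm]
  refine h.trans (le_of_eq (congrArg _ ?_))
  ring

/-- At the scale `l = 1 / √N` the subgaussian bound is the constant `exp (2 * b ^ 2)`; combine it
for `l` and `-l` with |x| ≤ exp x + exp (-x). -/
theorem expect_abs_sub_perm_le [Nonempty ι] {b : ℝ} (f : Perm ι → ℝ)
    (hf : ∀ σ i j, |f (swap i j * σ) - f σ| ≤ b) :
    𝔼 σ, |f σ - 𝔼 τ, f τ| ≤ 2 * Real.exp (2 * b ^ 2) * √(Fintype.card ι) := by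
  set N : ℝ := (Fintype.card ι : ℝ)
  have hN : 0 < N := by simp [N, Fintype.card_pos]
  set l := 1 / √N with hl
  have hl0 : 0 < l := by positivity
  have hb : ∀ s : ℝ, |s| = l → 𝔼 σ, Real.exp (s * (f σ - 𝔼 τ, f τ)) ≤ Real.exp (2 * b ^ 2) := by
    intro s hs
    have h := expect_exp_perm_le (b := l * b) (fun σ => s * f σ) (by
      intro σ i j
      rw [← mul_sub, abs_mul, hs]
      exact mul_le_mul_of_nonneg_left (hf _ _ _) hl0.le)
    rw [← mul_expect] at h
    simp only [← mul_sub] at h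
    refine h.trans (le_of_eq (congrArg _ ?_))
    rw [hl, mul_pow, div_pow, Real.sq_sqrt hN.le]
    change N * _ = _
    field_simp
  have h1 : 𝔼 σ, l * |f σ - 𝔼 τ, f τ| ≤
      𝔼 σ, (Real.exp (l * (f σ - 𝔼 τ, f τ)) + Real.exp (-l * (f σ - 𝔼 τ, f τ))) := by
    refine expect_le_expect fun σ _ => ?_
    set x := f σ - 𝔼 τ, f τ
    have e1 := Real.add_one_le_exp (l * x)
    have e2 := Real.add_one_le_exp (-l * x)
    have p1 := Real.exp_pos (l * x)
    have p2 := Real.exp_pos (-l * x)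
    rcases abs_cases x with ⟨h, _⟩ | ⟨h, _⟩ <;> rw [h] <;> linarith
  rw [← mul_expect, expect_add_distrib] at h1
  have h2 := hb l (abs_of_pos hl0)
  have h3 := hb (-l) (by rw [abs_neg, abs_of_pos hl0])
  have h4 : l * 𝔼 σ, |f σ - 𝔼 τ, f τ| ≤ 2 * Real.exp (2 * b ^ 2) := by linarith
  have h5 : l * √N = 1 := by rw [hl]; field_simp
  calc 𝔼 σ, |f σ - 𝔼 τ, f τ| = (l * 𝔼 σ, |f σ - 𝔼 τ, f τ|) * √N := by
        rw [mul_right_comm, h5, one_mul]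
    _ ≤ _ := by gcongr

/-- The average over a large set of permutations is close to the average over all of them. -/
theorem expect_mem_sub_expect_perm_le [Nonempty ι] {b p : ℝ} (f : Perm ι → ℝ)
    (hf : ∀ σ i j, |f (swap i j * σ) - f σ| ≤ b) (s : Finset (Perm ι)) (hp : 0 < p)
    (hs : p * Fintype.card (Perm ι) ≤ s.card) :
    𝔼 σ ∈ s, f σ - 𝔼 σ, f σ ≤ (2 * b ^ 2 - Real.log p) * √(Fintype.card ι) := by
  set N : ℝ := (Fintype.card ι : ℝ)
  have hN : 0 < N := by simp [N, Fintype.card_pos]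
  set l := 1 / √N with hl
  have hl0 : 0 < l := by positivity
  have hG : (0 : ℝ) < Fintype.card (Perm ι) := by simp [Fintype.card_pos]
  have hs0 : (0 : ℝ) < s.card := lt_of_lt_of_le (by positivity) hs
  have hne : s.Nonempty := card_pos.1 (by exact_mod_cast hs0)
  have h := expect_exp_perm_le (b := l * b) (fun σ => l * f σ) (by
    intro σ i j
    rw [← mul_sub, abs_mul, abs_of_pos hl0]
    exact mul_le_mul_of_nonneg_left (hf _ _ _) hl0.le)
  rw [← mul_expect] at h
  simp only [← mul_sub] at h
  have e : (Fintype.card ι : ℝ) * (2 * (l * b) ^ 2) = 2 * b ^ 2 := by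
    rw [hl, mul_pow, div_pow, Real.sq_sqrt hN.le]
    change N * _ = _
    field_simp
  rw [e] at h
  set M := 𝔼 σ, f σ
  -- Jensen on `s`, followed by enlarging `s` to the whole group at the price of its density; taking
  -- logarithms turns this price into `- log p`.
  have h1 : Real.exp (l * (𝔼 σ ∈ s, f σ - M)) ≤ 𝔼 σ ∈ s, Real.exp (l * (f σ - M)) := by
    have : Nonempty s := hne.to_subtype
    have hj := exp_expect_le (fun σ : s => l * (f σ - M))
    rw [← mul_expect, expect_sub_distrib, Fintype.expect_const] at hj
    have hc : ∀ g : Perm ι → ℝ, 𝔼 σ : s, g σ = 𝔼 σ ∈ s, g σ := by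
      intro g
      rw [Fintype.expect_eq_sum_div_card, expect_eq_sum_div_card]
      simp [Finset.sum_attach s g]
    rw [hc f, hc (fun σ => Real.exp (l * (f σ - M)))] at hj
    exact hj
  have h2 : p * 𝔼 σ ∈ s, Real.exp (l * (f σ - M)) ≤ 𝔼 σ, Real.exp (l * (f σ - M)) := by
    rw [Fintype.expect_eq_sum_div_card, expect_eq_sum_div_card, le_div_iff₀ hG]
    have h3 : ∑ σ ∈ s, Real.exp (l * (f σ - M)) ≤ ∑ σ, Real.exp (l * (f σ - M)) :=
      sum_le_sum_of_subset_of_nonneg (subset_univ _) fun _ _ _ => (Real.exp_pos _).le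
    have h4 : 0 ≤ ∑ σ ∈ s, Real.exp (l * (f σ - M)) := sum_nonneg fun _ _ => (Real.exp_pos _).le
    calc _ = (p * Fintype.card (Perm ι)) / s.card * ∑ σ ∈ s, Real.exp (l * (f σ - M)) := by ring
      _ ≤ 1 * ∑ σ ∈ s, Real.exp (l * (f σ - M)) := by
        gcongr
        exact (div_le_one hs0).2 hs
      _ ≤ _ := by rw [one_mul]; exact h3
  have h5 : p * Real.exp (l * (𝔼 σ ∈ s, f σ - M)) ≤ Real.exp (2 * b ^ 2) :=
    (mul_le_mul_of_nonneg_left h1 hp.le).trans (h2.trans h)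
  have h6 : Real.log p + l * (𝔼 σ ∈ s, f σ - M) ≤ 2 * b ^ 2 := by
    have := Real.log_le_log (by positivity) h5
    rwa [Real.log_mul hp.ne' (Real.exp_pos _).ne', Real.log_exp, Real.log_exp] at this
  have h7 : l * √N = 1 := by rw [hl]; field_simp
  calc 𝔼 σ ∈ s, f σ - M = (l * (𝔼 σ ∈ s, f σ - M)) * √N := by
        rw [mul_right_comm, h7, one_mul]
    _ ≤ (2 * b ^ 2 - Real.log p) * √N := by gcongr; linarith

/-! ### Exchangeable variables -/

/-- The right side is the probability that `k` independent uniform choices among `T` points are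
distinct. -/
theorem one_sub_le_descFactorial_div (T k : ℕ) (hT : 0 < T) :
    1 - (k : ℝ) ^ 2 / T ≤ T.descFactorial k / (T : ℝ) ^ k := by
  have hT' : (0 : ℝ) < T := by exact_mod_cast hT
  induction k with
  | zero => simp
  | succ k ih =>
    rcases le_or_gt T k with h | h
    · refine le_trans ?_ (by positivity : (0 : ℝ) ≤ _)
      rw [sub_nonpos, le_div_iff₀ hT']
      have : (T : ℝ) ≤ k := by exact_mod_cast h
      push_cast
      nlinarith
    · have h' : (k : ℝ) < T := by exact_mod_cast h
      rw [Nat.descFactorial_succ]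
      push_cast [h.le]
      have e : ((T : ℝ) - k) * T.descFactorial k / (T : ℝ) ^ (k + 1) =
          (1 - k / T) * (T.descFactorial k / (T : ℝ) ^ k) := by
        field_simp
        try ring
      rw [e]
      have h1 : 0 ≤ 1 - (k : ℝ) / T := by
        rw [sub_nonneg]
        exact (div_le_one hT').2 h'.le
      refine le_trans ?_ (mul_le_mul_of_nonneg_left ih h1)
      have h2 : (0 : ℝ) ≤ k / T * (k ^ 2 / T) := by positivity
      have h3 : ((k : ℝ) + 1) ^ 2 / T = k ^ 2 / T + k / T + (k + 1) / T := by ring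
      have h4 : (0 : ℝ) ≤ (k + 1) / T := by positivity
      rw [h3]
      linarith

/-- If all products of `k` distinct variables among `T` variables with values in `[0, 1]` have
expectation `p`, then the `k`th moment of their average is `p` up to an error `k ^ 2 / T`. -/
theorem abs_expect_pow_expect_sub_le [Nonempty Ω] {J : Type*} [Fintype J] [Nonempty J] (g : Ω → J → ℝ)
    (h0 : ∀ ω j, 0 ≤ g ω j) (h1 : ∀ ω j, g ω j ≤ 1) (k : ℕ) (p : ℝ) (hp0 : 0 ≤ p) (hp1 : p ≤ 1)
    (hp : ∀ t : Fin k → J, Function.Injective t → 𝔼 ω, ∏ l, g ω (t l) = p) :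
    |𝔼 ω, (𝔼 j, g ω j) ^ k - p| ≤ (k : ℝ) ^ 2 / Fintype.card J := by
  classical
  -- The power of an average is an average over all `k`-tuples; only tuples with a repetition can
  -- deviate from `p`.
  have e1 : 𝔼 ω, (𝔼 j, g ω j) ^ k = 𝔼 t : Fin k → J, 𝔼 ω, ∏ l, g ω (t l) := by
    rw [expect_comm]
    refine expect_congr rfl fun ω _ => ?_
    rw [expect_pow]
    simp
  have e2 : 𝔼 ω, (𝔼 j, g ω j) ^ k - p = 𝔼 t : Fin k → J, (𝔼 ω, ∏ l, g ω (t l) - p) := by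
    rw [e1, expect_sub_distrib, Fintype.expect_const]
  have e3 : ∀ t : Fin k → J, |𝔼 ω, ∏ l, g ω (t l) - p| ≤
      1 - if Function.Injective t then 1 else 0 := by
    intro t
    split_ifs with ht
    · simp [hp t ht]
    · have a1 : 0 ≤ 𝔼 ω, ∏ l, g ω (t l) := expect_nonneg fun ω _ => prod_nonneg fun l _ => h0 _ _
      have a2 : 𝔼 ω, ∏ l, g ω (t l) ≤ 1 := expect_le univ_nonempty fun ω _ =>
        prod_le_one (fun l _ => h0 _ _) fun l _ => h1 _ _
      rw [abs_le]
      constructor <;> linarith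
  rw [e2]
  refine (abs_expect_le _ _).trans ((expect_le_expect fun t _ => e3 t).trans ?_)
  rw [expect_sub_distrib, Fintype.expect_const, Fintype.expect_eq_sum_div_card, sum_boole]
  have hc : ((univ.filter fun t : Fin k → J => Function.Injective t).card : ℝ) =
      (Fintype.card J).descFactorial k := by
    have := Fintype.card_embedding_eq (α := Fin k) (β := J)
    rw [Fintype.card_fin] at this
    rw [← this, ← Fintype.card_subtype]
    exact_mod_cast Fintype.card_congr (Equiv.subtypeInjectiveEquivEmbedding (Fin k) J)
  rw [hc]
  have := one_sub_le_descFactorial_div (Fintype.card J) k Fintype.card_pos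
  simp only [Fintype.card_fun, Fintype.card_fin]
  push_cast
  linarith

end LDPC

namespace LDPC

/-! ### Indicators -/

open Classical in
/-- The indicator of a proposition. -/
noncomputable def ind (p : Prop) : ℝ := if p then 1 else 0

theorem ind_of {p : Prop} (h : p) : ind p = 1 := if_pos h

theorem ind_of_not {p : Prop} (h : ¬p) : ind p = 0 := if_neg h

theorem ind_nonneg (p : Prop) : 0 ≤ ind p := by
  unfold ind; split_ifs <;> norm_num

theorem ind_le_one (p : Prop) : ind p ≤ 1 := by
  unfold ind; split_ifs <;> norm_num

theorem ind_mono {p q : Prop} (h : p → q) : ind p ≤ ind q := by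
  by_cases hp : p
  · rw [ind_of hp, ind_of (h hp)]
  · rw [ind_of_not hp]; exact ind_nonneg q

theorem prod_ind {α : Type*} (s : Finset α) (p : α → Prop) :
    ∏ i ∈ s, ind (p i) = ind (∀ i ∈ s, p i) := by
  by_cases h : ∀ i ∈ s, p i
  · rw [ind_of h]; exact prod_eq_one fun i hi => ind_of (h i hi)
  · rw [ind_of_not h]
    push Not at h
    obtain ⟨i, hi, hp⟩ := h
    exact prod_eq_zero hi (ind_of_not hp)

/-! ### The configuration model -/

/-- The data of a configuration model: the sockets `ι` of `n` variable nodes are matched by a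
permutation with the sockets of `m` check nodes; `coef` are the matrix coefficients. -/
structure Ensemble (ι F : Type*) [Field F] (m n : ℕ) where
  /-- the variable node of a socket -/
  var : ι → Fin n
  /-- the check node of a socket -/
  chk : ι → Fin m
  /-- the nonzero coefficients -/
  coef : Fin m × Fin n → Fˣ

namespace Ensemble

variable {ι F : Type*} [Fintype ι] [DecidableEq ι] [Field F] {m n : ℕ} (X : Ensemble ι F m n)

/-- The unit vector of the variable matched with the check socket `i`. -/
def unit (σ : Perm ι) (i : ι) : Fin n → F := Pi.single (X.var (σ i)) 1

/-- The sockets of the check `a`. -/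
def block (a : Fin m) : Finset ι := univ.filter fun i => X.chk i = a

/-- The sockets of the checks in `A`. -/
def used (A : Finset (Fin m)) : Finset ι := univ.filter fun i => X.chk i ∈ A

/-- The row of the matrix that belongs to the check `a`. -/
def row (σ : Perm ι) (a : Fin m) : Fin n → F :=
  ∑ i ∈ X.block a, (X.coef (a, X.var (σ i)) : F) • X.unit σ i

/-- The space generated by the rows of the checks in `A` and by unit vectors that pin the variables
matched with the sockets in `I`. -/
def space (σ : Perm ι) (A : Finset (Fin m)) (I : Finset ι) : Submodule F (Fin n → F) :=
  Submodule.span F (X.row σ '' A ∪ X.unit σ '' I)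

/-- The nullity of the matrix with rows `A` and pinned sockets `I`. -/
noncomputable def nullity (σ : Perm ι) (A : Finset (Fin m)) (I : Finset ι) : ℝ :=
  n - Module.finrank F (X.space σ A I)

theorem mem_block {a : Fin m} {i : ι} : i ∈ X.block a ↔ X.chk i = a := by simp [block]

theorem mem_used {A : Finset (Fin m)} {i : ι} : i ∈ X.used A ↔ X.chk i ∈ A := by simp [used]

theorem used_insert (A : Finset (Fin m)) (a : Fin m) :
    X.used (insert a A) = X.block a ∪ X.used A := by
  ext i; simp [mem_used, mem_block]

theorem used_empty : X.used ∅ = ∅ := by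
  ext i; simp [mem_used]

theorem disjoint_block_used {A : Finset (Fin m)} {a : Fin m} (ha : a ∉ A) :
    Disjoint (X.block a) (X.used A) := by
  rw [Finset.disjoint_left]
  intro i hi hi'
  rw [mem_block] at hi
  rw [mem_used, hi] at hi'
  exact ha hi'

theorem card_used_insert {A : Finset (Fin m)} {a : Fin m} (ha : a ∉ A) :
    (X.used (insert a A)).card = (X.block a).card + (X.used A).card := by
  rw [used_insert, card_union_of_disjoint (X.disjoint_block_used ha)]

theorem card_used (A : Finset (Fin m)) : (X.used A).card = ∑ a ∈ A, (X.block a).card := by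
  induction A using Finset.induction_on with
  | empty => simp [used_empty]
  | insert a A ha ih => rw [X.card_used_insert ha, sum_insert ha, ih]

theorem space_mono {σ : Perm ι} {A A' : Finset (Fin m)} {I I' : Finset ι} (hA : A ⊆ A')
    (hI : I ⊆ I') : X.space σ A I ≤ X.space σ A' I' :=
  Submodule.span_mono (Set.union_subset_union (Set.image_mono (by exact_mod_cast hA))
    (Set.image_mono (by exact_mod_cast hI)))

theorem unit_mem_space {σ : Perm ι} {A : Finset (Fin m)} {I : Finset ι} {i : ι} (hi : i ∈ I) :
    X.unit σ i ∈ X.space σ A I :=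
  Submodule.subset_span (Or.inr ⟨i, by exact_mod_cast hi, rfl⟩)

theorem row_mem_space {σ : Perm ι} {A : Finset (Fin m)} {I : Finset ι} {a : Fin m} (ha : a ∈ A) :
    X.row σ a ∈ X.space σ A I :=
  Submodule.subset_span (Or.inl ⟨a, by exact_mod_cast ha, rfl⟩)

theorem space_union (σ : Perm ι) (A : Finset (Fin m)) (I J : Finset ι) :
    X.space σ A (I ∪ J) = X.space σ A I ⊔ Submodule.span F (X.unit σ '' J) := by
  rw [space, space, ← Submodule.span_union, coe_union, Set.image_union, Set.union_assoc]

theorem space_insert_unit (σ : Perm ι) (A : Finset (Fin m)) (I : Finset ι) (i : ι) :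
    X.space σ A (insert i I) = X.space σ A I ⊔ Submodule.span F {X.unit σ i} := by
  rw [insert_eq, union_comm, space_union]; simp

theorem space_insert_row (σ : Perm ι) (A : Finset (Fin m)) (I : Finset ι) (a : Fin m) :
    X.space σ (insert a A) I = X.space σ A I ⊔ Submodule.span F {X.row σ a} := by
  rw [space, space, ← Submodule.span_union, coe_insert, Set.image_insert_eq, Set.insert_union,
    ← Set.union_singleton]

theorem finrank_sup_span_singleton_eq {E : Type*} [AddCommGroup E] [Module F E] [Module.Finite F E]
    (S : Submodule F E) (x : E) :
    (Module.finrank F ↥(S ⊔ Submodule.span F {x}) : ℝ) = Module.finrank F S + (1 - ind (x ∈ S)) := by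
  by_cases h : x ∈ S
  · rw [ind_of h, sup_eq_left.2 ((Submodule.span_singleton_le_iff_mem _ _).2 h)]; simp
  · rw [ind_of_not h, Submodule.finrank_sup_span_singleton h]; simp

theorem nullity_insert_unit (σ : Perm ι) (A : Finset (Fin m)) (I : Finset ι) (i : ι) :
    X.nullity σ A I - X.nullity σ A (insert i I) = 1 - ind (X.unit σ i ∈ X.space σ A I) := by
  rw [nullity, nullity, space_insert_unit, finrank_sup_span_singleton_eq]; ring

theorem nullity_insert_row (σ : Perm ι) (A : Finset (Fin m)) (I : Finset ι) (a : Fin m) :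
    X.nullity σ A I - X.nullity σ (insert a A) I = 1 - ind (X.row σ a ∈ X.space σ A I) := by
  rw [nullity, nullity, space_insert_row, finrank_sup_span_singleton_eq]; ring

theorem nullity_nonneg (σ : Perm ι) (A : Finset (Fin m)) (I : Finset ι) : 0 ≤ X.nullity σ A I := by
  have := Submodule.finrank_le (X.space σ A I)
  rw [Module.finrank_fin_fun] at this
  rw [nullity, sub_nonneg]
  exact_mod_cast this

theorem nullity_le (σ : Perm ι) (A : Finset (Fin m)) (I : Finset ι) : X.nullity σ A I ≤ n := by
  rw [nullity]; linarith [Nat.cast_nonneg (α := ℝ) (Module.finrank F (X.space σ A I))]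

theorem nullity_anti {σ : Perm ι} {A A' : Finset (Fin m)} {I I' : Finset ι} (hA : A ⊆ A')
    (hI : I ⊆ I') : X.nullity σ A' I' ≤ X.nullity σ A I := by
  have := Submodule.finrank_mono (X.space_mono (σ := σ) hA hI)
  rw [nullity, nullity]
  have h : (Module.finrank F (X.space σ A I) : ℝ) ≤ Module.finrank F (X.space σ A' I') := by
    exact_mod_cast this
  linarith

/-- The number of unfrozen sockets in `J` bounds the effect of pinning `J`. -/
theorem nullity_sub_union_le (σ : Perm ι) (A : Finset (Fin m)) (I J : Finset ι) :
    X.nullity σ A I - X.nullity σ A (I ∪ J) ≤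
      J.card - ∑ j ∈ J, ind (X.unit σ j ∈ X.space σ A I) := by
  induction J using Finset.induction_on with
  | empty => simp
  | insert j J hj ih =>
    have h := X.nullity_insert_unit σ A (I ∪ J) j
    rw [← union_insert] at h
    rw [sum_insert hj, card_insert_of_notMem hj]
    have h2 : ind (X.unit σ j ∈ X.space σ A I) ≤ ind (X.unit σ j ∈ X.space σ A (I ∪ J)) :=
      ind_mono fun h => X.space_mono (subset_refl A) subset_union_left h
    push_cast
    linarith

theorem row_mem_of_forall {σ : Perm ι} {a : Fin m} {S : Submodule F (Fin n → F)}
    (h : ∀ i ∈ X.block a, X.unit σ i ∈ S) : X.row σ a ∈ S :=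
  Submodule.sum_mem _ fun i hi => Submodule.smul_mem _ _ (h i hi)

/-- The row is a sum over sockets with invertible coefficients, so it can be solved for one socket
modulo the others, even if a variable occurs twice in the check. -/
theorem unit_mem_of_row_mem {σ : Perm ι} {a : Fin m} {A : Finset (Fin m)} {I : Finset ι}
    (h : X.row σ a ∈ X.space σ A I) {i : ι} (hi : i ∈ X.block a) :
    X.unit σ i ∈ X.space σ A (I ∪ (X.block a).erase i) := by
  set S := X.space σ A (I ∪ (X.block a).erase i)
  have h1 : X.row σ a ∈ S := X.space_mono (subset_refl A) subset_union_left h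
  rw [row, ← add_sum_erase _ _ hi] at h1
  have h2 : ∑ j ∈ (X.block a).erase i, (X.coef (a, X.var (σ j)) : F) • X.unit σ j ∈ S :=
    Submodule.sum_mem _ fun j hj => Submodule.smul_mem _ _
      (X.unit_mem_space (mem_union_right _ hj))
  have h3 := (Submodule.add_mem_iff_left _ h2).1 h1
  exact (Submodule.smul_mem_iff _ (Units.ne_zero _)).1 h3

/-! ### Dependence on the permutation -/

theorem unit_mul (σ τ : Perm ι) (i : ι) : X.unit (σ * τ) i = X.unit σ (τ i) := rfl

theorem row_mul {σ τ : Perm ι} {a : Fin m} (h : ∀ i ∈ X.block a, τ i = i) :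
    X.row (σ * τ) a = X.row σ a :=
  sum_congr rfl fun i hi => by rw [unit_mul, Perm.mul_apply, h i hi]

/-- A permutation that fixes the sockets of `A` leaves the rows alone and merely relocates the pins.
All exchangeability of unused sockets comes from this. -/
theorem space_mul {σ τ : Perm ι} {A : Finset (Fin m)} {I : Finset ι}
    (h : ∀ i ∈ X.used A, τ i = i) : X.space (σ * τ) A I = X.space σ A (I.image τ) := by
  rw [space, space]
  congr 2
  · refine Set.image_congr fun a ha => X.row_mul fun i hi => h i ?_
    rw [mem_block] at hi
    rw [mem_used, hi]
    exact_mod_cast ha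
  · rw [coe_image, Set.image_image]
    rfl

theorem nullity_mul {σ τ : Perm ι} {A : Finset (Fin m)} {I : Finset ι}
    (h : ∀ i ∈ X.used A, τ i = i) : X.nullity (σ * τ) A I = X.nullity σ A (I.image τ) := by
  rw [nullity, nullity, X.space_mul h]

-- A transposition affects at most two rows and two pins, so four generators make up for it.
open Classical in
theorem space_mul_swap_le (σ : Perm ι) (A : Finset (Fin m)) (I : Finset ι) (i j : ι) :
    X.space (σ * swap i j) A I ≤ X.space σ A I ⊔ Submodule.span F
      (({X.row (σ * swap i j) (X.chk i), X.row (σ * swap i j) (X.chk j), X.unit (σ * swap i j) i,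
        X.unit (σ * swap i j) j} : Finset (Fin n → F)) : Set (Fin n → F)) := by
  rw [space, Submodule.span_le]
  rintro x (⟨a, ha, rfl⟩ | ⟨l, hl, rfl⟩)
  · by_cases h1 : X.chk i = a
    · exact Submodule.mem_sup_right (Submodule.subset_span (by simp [h1]))
    by_cases h2 : X.chk j = a
    · exact Submodule.mem_sup_right (Submodule.subset_span (by simp [h2]))
    refine Submodule.mem_sup_left ?_
    rw [X.row_mul fun l hl => ?_]
    · exact X.row_mem_space (by exact_mod_cast ha)
    · rw [mem_block] at hl
      exact swap_apply_of_ne_of_ne (fun h => h1 (h ▸ hl)) (fun h => h2 (h ▸ hl))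
  · by_cases h1 : l = i
    · exact Submodule.mem_sup_right (Submodule.subset_span (by simp [h1]))
    by_cases h2 : l = j
    · exact Submodule.mem_sup_right (Submodule.subset_span (by simp [h2]))
    refine Submodule.mem_sup_left ?_
    rw [unit_mul, swap_apply_of_ne_of_ne h1 h2]
    exact X.unit_mem_space (by exact_mod_cast hl)

theorem nullity_le_mul_swap (σ : Perm ι) (A : Finset (Fin m)) (I : Finset ι) (i j : ι) :
    X.nullity σ A I ≤ X.nullity (σ * swap i j) A I + 4 := by
  classical
  have h1 := Submodule.finrank_mono (X.space_mul_swap_le σ A I i j)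
  have h2 := h1.trans (Submodule.finrank_add_le_finrank_add_finrank _ _)
  have h3 := h2.trans (Nat.add_le_add_left ((finrank_span_finset_le_card _).trans card_le_four) _)
  have h4 : (Module.finrank F (X.space (σ * swap i j) A I) : ℝ) ≤
      Module.finrank F (X.space σ A I) + 4 := by exact_mod_cast h3
  rw [nullity, nullity]
  linarith

/-- Concentration needs transpositions on the left; conjugation by `σ` moves them to the right, and
a second swap undoes the first, which gives the other sign. -/
theorem abs_nullity_swap_mul_sub_le (A : Finset (Fin m)) (I : Finset ι) (σ : Perm ι) (i j : ι) :
    |X.nullity (swap i j * σ) A I - X.nullity σ A I| ≤ 4 := by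
  rw [swap_mul_eq_mul_swap]
  have h1 := X.nullity_le_mul_swap σ A I (σ⁻¹ i) (σ⁻¹ j)
  have h2 := X.nullity_le_mul_swap (σ * swap (σ⁻¹ i) (σ⁻¹ j)) A I (σ⁻¹ i) (σ⁻¹ j)
  rw [mul_swap_mul_self] at h2
  rw [abs_le]
  constructor <;> linarith

/-! ### Exchangeability -/

theorem expect_mul_right (g : Perm ι → ℝ) (τ : Perm ι) : 𝔼 σ, g (σ * τ) = 𝔼 σ, g σ :=
  Fintype.expect_equiv (Equiv.mulRight τ) _ _ fun _ => rfl

theorem expect_mul_left (g : Perm ι → ℝ) (τ : Perm ι) : 𝔼 σ, g (τ * σ) = 𝔼 σ, g σ :=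
  Fintype.expect_equiv (Equiv.mulLeft τ) _ _ fun _ => rfl

/-- Two injective families that avoid `K` are related by a permutation that fixes `K`. -/
theorem exists_perm_fixing {α : Type*} [Finite α] (K : Finset ι) {t t' : α → ι}
    (ht : Function.Injective t) (ht' : Function.Injective t') (hK : ∀ a, t a ∉ K)
    (hK' : ∀ a, t' a ∉ K) : ∃ τ : Perm ι, (∀ i ∈ K, τ i = i) ∧ ∀ a, τ (t a) = t' a := by
  obtain ⟨τ, hτ⟩ := Perm.exists_extending_pair (Sum.elim t (fun i : K => (i : ι)))
    (Sum.elim t' (fun i : K => (i : ι)))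
    (ht.sumElim Subtype.val_injective fun a b h => hK a (h ▸ b.2))
    (ht'.sumElim Subtype.val_injective fun a b h => hK' a (h ▸ b.2))
  exact ⟨τ, fun i hi => hτ (Sum.inr ⟨i, hi⟩), fun a => hτ (Sum.inl a)⟩

theorem exists_perm_image_eq (K : Finset ι) {I J : Finset ι} (hI : Disjoint I K)
    (hJ : Disjoint J K) (h : I.card = J.card) :
    ∃ τ : Perm ι, (∀ i ∈ K, τ i = i) ∧ I.image τ = J := by
  obtain ⟨τ, h1, h2⟩ := exists_perm_fixing K (t := fun i : I => (i : ι))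
    (t' := fun i : I => ((Finset.equivOfCardEq h i : J) : ι)) Subtype.val_injective
    (Subtype.val_injective.comp (Equiv.injective _))
    (fun i => Finset.disjoint_left.1 hI i.2) (fun i => Finset.disjoint_left.1 hJ (Subtype.prop _))
  refine ⟨τ, h1, eq_of_subset_of_card_le ?_ ?_⟩
  · intro x hx
    obtain ⟨i, hi, rfl⟩ := mem_image.1 hx
    rw [h2 ⟨i, hi⟩]
    exact Subtype.prop _
  · rw [card_image_of_injective _ τ.injective, h]

/-! ### Random pins, the expected nullity and the frozen probability -/

/-- A set of `Q` sockets that do not belong to the checks in `A`. -/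
noncomputable def pins (A : Finset (Fin m)) (Q : ℕ) : Finset ι :=
  -- Without enough unused sockets the set is empty and `mean A Q` loses its meaning; hence the room
  -- hypotheses in the estimates.
  open Classical in if h : Q ≤ (X.used A)ᶜ.card then (exists_subset_card_eq h).choose else ∅

theorem pins_spec {A : Finset (Fin m)} {Q : ℕ} (h : (X.used A).card + Q ≤ Fintype.card ι) :
    Disjoint (X.pins A Q) (X.used A) ∧ (X.pins A Q).card = Q := by
  have h' : Q ≤ (X.used A)ᶜ.card := by rw [card_compl]; omega
  rw [pins, dif_pos h']
  have := (exists_subset_card_eq h').choose_spec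
  refine ⟨?_, this.2⟩
  rw [Finset.disjoint_left]
  intro i hi
  simpa using this.1 hi

/-- The expected nullity of the matrix with rows `A` and `Q` random pins. -/
noncomputable def mean (A : Finset (Fin m)) (Q : ℕ) : ℝ := 𝔼 σ, X.nullity σ A (X.pins A Q)

/-- The choice of the pins does not matter: two equally large sets of unused sockets are exchanged
by a permutation that fixes the used ones, and the uniform distribution is invariant. -/
theorem expect_nullity {A : Finset (Fin m)} {I : Finset ι} (hI : Disjoint I (X.used A)) :
    𝔼 σ, X.nullity σ A I = X.mean A I.card := by
  have h : (X.used A).card + I.card ≤ Fintype.card ι := by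
    rw [add_comm, ← card_union_of_disjoint hI]; exact card_le_univ _
  obtain ⟨h1, h2⟩ := X.pins_spec h
  obtain ⟨τ, h3, h4⟩ := exists_perm_image_eq (X.used A) hI h1 h2.symm
  rw [mean, ← expect_mul_right _ τ]
  rw [← h4]
  exact expect_congr rfl fun σ _ => X.nullity_mul h3

/-- The probability that a random socket is frozen. -/
noncomputable def frozen (A : Finset (Fin m)) (Q : ℕ) : ℝ := 1 - (X.mean A Q - X.mean A (Q + 1))

/-- Pinning a socket lowers the nullity by one unless the socket is already frozen, so the frozen
probability is a discrete derivative of `mean`. -/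
theorem expect_ind_unit {A : Finset (Fin m)} {I : Finset ι} (hI : Disjoint I (X.used A)) {i : ι}
    (hi : i ∉ I) (hi' : i ∉ X.used A) :
    𝔼 σ, ind (X.unit σ i ∈ X.space σ A I) = X.frozen A I.card := by
  have h1 := X.expect_nullity (A := A) (I := insert i I)
    (by rw [disjoint_insert_left]; exact ⟨hi', hI⟩)
  rw [card_insert_of_notMem hi] at h1
  rw [frozen, ← h1, ← X.expect_nullity hI, ← expect_sub_distrib]
  have : ∀ σ, ind (X.unit σ i ∈ X.space σ A I) =
      1 - (X.nullity σ A I - X.nullity σ A (insert i I)) := fun σ => by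
    rw [nullity_insert_unit]; ring
  simp_rw [this]
  rw [expect_sub_distrib, Fintype.expect_const]

theorem exists_disjoint_card {K : Finset ι} {Q : ℕ} (h : K.card + Q ≤ Fintype.card ι) :
    ∃ I : Finset ι, Disjoint I K ∧ I.card = Q := by
  have h' : Q ≤ Kᶜ.card := by rw [card_compl]; omega
  obtain ⟨I, h1, h2⟩ := exists_subset_card_eq h'
  refine ⟨I, ?_, h2⟩
  rw [Finset.disjoint_left]
  intro i hi
  simpa using h1 hi

theorem frozen_nonneg {A : Finset (Fin m)} {Q : ℕ}
    (h : (X.used A).card + (Q + 1) ≤ Fintype.card ι) : 0 ≤ X.frozen A Q := by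
  obtain ⟨I, h1, h2⟩ := exists_disjoint_card h
  obtain ⟨i, hi⟩ := card_pos.1 (by omega : 0 < I.card)
  have h3 : Disjoint (I.erase i) (X.used A) := h1.mono_left (erase_subset _ _)
  have h4 := X.expect_ind_unit h3 (notMem_erase i I) (Finset.disjoint_left.1 h1 hi)
  rw [card_erase_of_mem hi, h2, Nat.add_sub_cancel] at h4
  rw [← h4]
  exact expect_nonneg fun _ _ => ind_nonneg _

theorem frozen_le_one {A : Finset (Fin m)} {Q : ℕ}
    (h : (X.used A).card + (Q + 1) ≤ Fintype.card ι) : X.frozen A Q ≤ 1 := by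
  obtain ⟨I, h1, h2⟩ := exists_disjoint_card h
  obtain ⟨i, hi⟩ := card_pos.1 (by omega : 0 < I.card)
  have h3 : Disjoint (I.erase i) (X.used A) := h1.mono_left (erase_subset _ _)
  have h4 := X.expect_ind_unit h3 (notMem_erase i I) (Finset.disjoint_left.1 h1 hi)
  rw [card_erase_of_mem hi, h2, Nat.add_sub_cancel] at h4
  rw [← h4]
  exact expect_le univ_nonempty fun _ _ => ind_le_one _

theorem mean_nonneg (A : Finset (Fin m)) (Q : ℕ) : 0 ≤ X.mean A Q :=
  expect_nonneg fun _ _ => X.nullity_nonneg _ _ _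

theorem mean_le (A : Finset (Fin m)) (Q : ℕ) : X.mean A Q ≤ n :=
  expect_le univ_nonempty fun _ _ => X.nullity_le _ _ _

theorem mean_sub_mean_add {A : Finset (Fin m)} (Q w : ℕ) :
    X.mean A Q - X.mean A (Q + w) = ∑ i ∈ range w, (1 - X.frozen A (Q + i)) := by
  induction w with
  | zero => simp
  | succ w ih =>
    rw [sum_range_succ, ← ih, frozen]
    ring_nf

theorem mean_sub_mean_add_le {A : Finset (Fin m)} {Q w : ℕ}
    (h : (X.used A).card + (Q + w) ≤ Fintype.card ι) : X.mean A Q - X.mean A (Q + w) ≤ w := by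
  rw [mean_sub_mean_add]
  refine (sum_le_card_nsmul _ _ 1 fun i hi => ?_).trans (by simp)
  have := X.frozen_nonneg (A := A) (Q := Q + i) (by rw [mem_range] at hi; omega)
  linarith

theorem mean_anti {A : Finset (Fin m)} {Q w : ℕ}
    (h : (X.used A).card + (Q + w) ≤ Fintype.card ι) : X.mean A (Q + w) ≤ X.mean A Q := by
  rw [← sub_nonneg, mean_sub_mean_add]
  refine sum_nonneg fun i hi => ?_
  have := X.frozen_le_one (A := A) (Q := Q + i) (by rw [mem_range] at hi; omega)
  linarith

theorem mean_sub_mean_insert {A : Finset (Fin m)} {a : Fin m} {I : Finset ι}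
    (hI : Disjoint I (X.used (insert a A))) :
    X.mean A I.card - X.mean (insert a A) I.card =
      1 - 𝔼 σ, ind (X.row σ a ∈ X.space σ A I) := by
  have hI' : Disjoint I (X.used A) := hI.mono_right (by rw [used_insert]; exact subset_union_right)
  rw [← X.expect_nullity hI, ← X.expect_nullity hI', ← expect_sub_distrib]
  simp_rw [nullity_insert_row]
  rw [expect_sub_distrib, Fintype.expect_const]

theorem mean_insert_le {A : Finset (Fin m)} {a : Fin m} {Q : ℕ}
    (h : (X.used (insert a A)).card + Q ≤ Fintype.card ι) :
    X.mean (insert a A) Q ≤ X.mean A Q ∧ X.mean A Q ≤ X.mean (insert a A) Q + 1 := by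
  obtain ⟨I, h1, rfl⟩ := exists_disjoint_card h
  have h2 := X.mean_sub_mean_insert h1
  have h3 : 0 ≤ 𝔼 σ, ind (X.row σ a ∈ X.space σ A I) := expect_nonneg fun _ _ => ind_nonneg _
  have h4 : 𝔼 σ, ind (X.row σ a ∈ X.space σ A I) ≤ 1 :=
    expect_le univ_nonempty fun _ _ => ind_le_one _
  constructor <;> linarith

/-! ### The effect of adding one check -/

/-- The probability that all sockets of a check are frozen, and the moments of the frozen fraction
of a set of sockets. -/
theorem abs_expect_pow_sub_le {A : Finset (Fin m)} {I B J : Finset ι}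
    (hB : Disjoint B (X.used A ∪ I)) (hJ : Disjoint J (X.used A ∪ I)) (hJ0 : J.Nonempty) :
    |𝔼 σ, ((∑ j ∈ J, ind (X.unit σ j ∈ X.space σ A I)) / J.card) ^ B.card -
      𝔼 σ, ind (∀ i ∈ B, X.unit σ i ∈ X.space σ A I)| ≤ (B.card : ℝ) ^ 2 / J.card := by
  have : Nonempty J := hJ0.to_subtype
  have key := abs_expect_pow_expect_sub_le (Ω := Perm ι) (J := J)
    (fun σ j => ind (X.unit σ j ∈ X.space σ A I)) (fun _ _ => ind_nonneg _)
    (fun _ _ => ind_le_one _) B.card (𝔼 σ, ind (∀ i ∈ B, X.unit σ i ∈ X.space σ A I))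
    (expect_nonneg fun _ _ => ind_nonneg _) (expect_le univ_nonempty fun _ _ => ind_le_one _) (by
      -- A permutation fixing the used sockets and the pins carries `B` to the `k` distinct sockets
      -- chosen by `t`.
      intro t ht
      obtain ⟨τ, h1, h2⟩ := exists_perm_fixing (X.used A ∪ I)
        (t := fun l => ((B.equivFin.symm l : B) : ι)) (t' := fun l => (t l : ι))
        (Subtype.val_injective.comp (Equiv.injective _)) (Subtype.val_injective.comp ht)
        (fun l => Finset.disjoint_left.1 hB (Subtype.prop _))
        (fun l => Finset.disjoint_left.1 hJ (Subtype.prop _))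
      rw [← expect_mul_right (fun σ => ind (∀ i ∈ B, X.unit σ i ∈ X.space σ A I)) τ]
      refine expect_congr rfl fun σ _ => ?_
      rw [X.space_mul fun i hi => h1 i (mem_union_left _ hi)]
      have e : I.image τ = I := by
        rw [image_congr (g := id) fun i hi => h1 i (mem_union_right _ hi), image_id]
      rw [e, ← prod_ind,
        ← Finset.prod_coe_sort B fun i => ind (X.unit (σ * τ) i ∈ X.space σ A I)]
      refine Fintype.prod_equiv B.equivFin.symm _ _ fun l => ?_
      rw [unit_mul, h2])
  have e : ∀ σ, 𝔼 j : J, ind (X.unit σ j ∈ X.space σ A I) =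
      (∑ j ∈ J, ind (X.unit σ j ∈ X.space σ A I)) / J.card := by
    intro σ
    rw [Fintype.expect_eq_sum_div_card, Fintype.card_coe,
      Finset.sum_coe_sort J fun j => ind (X.unit σ j ∈ X.space σ A I)]
  simp only [e, Fintype.card_coe] at key
  exact key

/-- Adding a check decreases the expected nullity by at most `1 - x ^ k`, where `x` is the
probability of being frozen. -/
theorem mean_sub_mean_insert_le {A : Finset (Fin m)} {a : Fin m} (ha : a ∉ A) {Q T : ℕ}
    (hT : 0 < T) (h : (X.used (insert a A)).card + Q + T ≤ Fintype.card ι) :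
    X.mean A Q - X.mean (insert a A) Q ≤
      1 - X.frozen A Q ^ (X.block a).card + ((X.block a).card : ℝ) ^ 2 / T := by
  obtain ⟨I, hI, rfl⟩ := exists_disjoint_card (K := X.used (insert a A)) (Q := Q) (by omega)
  obtain ⟨J, hJ, rfl⟩ := exists_disjoint_card (K := X.used (insert a A) ∪ I) (Q := T) (by
    rw [card_union_of_disjoint hI.symm]; omega)
  have hs : X.used A ⊆ X.used (insert a A) := by rw [used_insert]; exact subset_union_right
  have hI' := hI.mono_right hs
  have hJ' : Disjoint J (X.used A ∪ I) := hJ.mono_right (union_subset_union hs (subset_refl _))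
  have hB : Disjoint (X.block a) (X.used A ∪ I) := by
    rw [disjoint_union_right]
    refine ⟨X.disjoint_block_used ha, (hI.mono_right ?_).symm⟩
    rw [used_insert]; exact subset_union_left
  have h1 := abs_le.1 (X.abs_expect_pow_sub_le hB hJ' (card_pos.1 hT))
  -- Jensen: the frozen fraction of `J` has expectation `X.frozen A I.card`.
  have h2 : X.frozen A I.card ^ (X.block a).card ≤
      𝔼 σ, ((∑ j ∈ J, ind (X.unit σ j ∈ X.space σ A I)) / J.card) ^ (X.block a).card := by
    refine le_trans (le_of_eq ?_) (pow_expect_le _ (fun σ => ?_) _)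
    · congr 1
      rw [← expect_div, expect_sum_comm]
      rw [sum_congr rfl fun j hj => X.expect_ind_unit hI' (i := j)
        (fun h => Finset.disjoint_left.1 hJ' hj (mem_union_right _ h))
        (fun h => Finset.disjoint_left.1 hJ' hj (mem_union_left _ h))]
      rw [sum_const, nsmul_eq_mul]
      have : (J.card : ℝ) ≠ 0 := by exact_mod_cast hT.ne'
      field_simp
    · exact div_nonneg (sum_nonneg fun _ _ => ind_nonneg _) (Nat.cast_nonneg _)
  have h3 : 𝔼 σ, ind (∀ i ∈ X.block a, X.unit σ i ∈ X.space σ A I) ≤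
      𝔼 σ, ind (X.row σ a ∈ X.space σ A I) :=
    expect_le_expect fun σ _ => ind_mono fun h => X.row_mem_of_forall h
  rw [X.mean_sub_mean_insert hI]
  linarith [h1.2]

/-- By telescoping, a shift by `d` changes a window sum only through `d` terms at each end, all in
[0, 1]. Thus, averaged over a long window, a few extra pins hardly change the frozen probability. -/
theorem sum_sub_shift_le (x : ℕ → ℝ) (Q W d : ℕ) (h0 : ∀ i < Q + W + d, 0 ≤ x i)
    (h1 : ∀ i < Q + W + d, x i ≤ 1) :
    ∑ i ∈ range W, (x (Q + i + d) - x (Q + i)) ≤ d := by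
  induction d with
  | zero => simp
  | succ d ih =>
    have e : ∑ i ∈ range W, (x (Q + i + (d + 1)) - x (Q + i)) =
        ∑ i ∈ range W, (x (Q + i + d) - x (Q + i)) + (x (Q + d + W) - x (Q + d + 0)) := by
      rw [← sum_range_sub (fun i => x (Q + d + i)), ← sum_add_distrib]
      refine sum_congr rfl fun i _ => ?_
      rw [show Q + d + (i + 1) = Q + i + (d + 1) by ring, show Q + d + i = Q + i + d by ring]
      ring
    rw [e]
    have a := ih (fun i hi => h0 i (by omega)) (fun i hi => h1 i (by omega))
    have b := h1 (Q + d + W) (by omega)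
    have c := h0 (Q + d + 0) (by omega)
    push_cast
    linarith

/-- A check that is implied by the other checks has only frozen sockets, unless pinning some of its
sockets freezes another one. -/
theorem expect_ind_row_le {A : Finset (Fin m)} {a : Fin m} (ha : a ∉ A) {I : Finset ι}
    (hI : Disjoint I (X.used (insert a A))) :
    𝔼 σ, ind (X.row σ a ∈ X.space σ A I) ≤
      𝔼 σ, ind (∀ i ∈ X.block a, X.unit σ i ∈ X.space σ A I) +
        (X.block a).card * (X.frozen A (I.card + ((X.block a).card - 1)) - X.frozen A I.card) := by
  have hIA : Disjoint I (X.used A) := hI.mono_right (by rw [used_insert]; exact subset_union_right)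
  have hIB : Disjoint I (X.block a) := hI.mono_right (by rw [used_insert]; exact subset_union_left)
  have hBA := X.disjoint_block_used ha
  have h1 : ∀ σ, ind (X.row σ a ∈ X.space σ A I) ≤
      ind (∀ i ∈ X.block a, X.unit σ i ∈ X.space σ A I) + ∑ i ∈ X.block a,
        (ind (X.unit σ i ∈ X.space σ A (I ∪ (X.block a).erase i)) -
          ind (X.unit σ i ∈ X.space σ A I)) := by
    intro σ
    have hmono : ∀ i, 0 ≤ ind (X.unit σ i ∈ X.space σ A (I ∪ (X.block a).erase i)) -
        ind (X.unit σ i ∈ X.space σ A I) := fun i => sub_nonneg.2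
      (ind_mono fun h => X.space_mono (subset_refl _) subset_union_left h)
    have hs := sum_nonneg fun i (_ : i ∈ X.block a) => hmono i
    by_cases hr : X.row σ a ∈ X.space σ A I
    · by_cases hall : ∀ i ∈ X.block a, X.unit σ i ∈ X.space σ A I
      · rw [ind_of hall, ind_of hr]; linarith
      -- An unfrozen socket of a dependent row is frozen by pinning the rest of the check, so its
      -- summand equals 1 and pays for the left side.
      · push Not at hall
        obtain ⟨i, hi, hni⟩ := hall
        have := single_le_sum (fun i _ => hmono i) hi
        rw [ind_of (X.unit_mem_of_row_mem hr hi), ind_of_not hni] at this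
        rw [ind_of hr]
        linarith [ind_nonneg (∀ i ∈ X.block a, X.unit σ i ∈ X.space σ A I)]
    · rw [ind_of_not hr]
      linarith [ind_nonneg (∀ i ∈ X.block a, X.unit σ i ∈ X.space σ A I)]
  refine (expect_le_expect fun σ _ => h1 σ).trans (le_of_eq ?_)
  rw [expect_add_distrib, expect_sum_comm]
  congr 1
  rw [← nsmul_eq_mul, ← sum_const]
  refine sum_congr rfl fun i hi => ?_
  have hiA := Finset.disjoint_left.1 hBA hi
  have hiI := Finset.disjoint_right.1 hIB hi
  rw [expect_sub_distrib, X.expect_ind_unit hIA hiI hiA, X.expect_ind_unit _ _ hiA,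
    card_union_of_disjoint (hIB.mono_right (erase_subset _ _)), card_erase_of_mem hi]
  · rw [disjoint_union_left]
    exact ⟨hIA, hBA.mono_left (erase_subset _ _)⟩
  · simp [hiI]

/-- The constant in the concentration inequality for the nullity. -/
noncomputable def conc : ℝ := 2 * Real.exp 32

/-- Transpositions change the nullity by at most `b = 4`, whence the exponent 32 = 2 · 4² in `conc`.
-/
theorem expect_abs_nullity_sub_le [Nonempty ι] (A : Finset (Fin m)) (I : Finset ι) :
    𝔼 σ, |X.nullity σ A I - 𝔼 τ, X.nullity τ A I| ≤ conc * √(Fintype.card ι) := by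
  have := expect_abs_sub_perm_le (fun σ => X.nullity σ A I)
    (fun σ i j => X.abs_nullity_swap_mul_sub_le A I σ i j)
  rw [conc]
  norm_num at this ⊢
  exact this

/-- Adding a check decreases the expected nullity by at least `1 - x ^ k`, where `x` is the
frozen fraction after adding a few pins. -/
theorem le_mean_sub_mean_insert {A : Finset (Fin m)} {a : Fin m} (ha : a ∉ A) {Q W T : ℕ}
    (hW : 0 < W) (hT : 0 < T)
    (h : (X.used (insert a A)).card + (Q + W + T) ≤ Fintype.card ι) :
    1 - (1 - (X.mean A (Q + W) - X.mean A (Q + W + T)) / T) ^ (X.block a).card -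
      (((X.block a).card : ℝ) ^ 2 / W + ((X.block a).card : ℝ) ^ 2 / T +
        (X.block a).card * (2 * (conc * √(Fintype.card ι)) / T)) ≤
      X.mean A Q - X.mean (insert a A) Q := by
  set k := (X.block a).card with hk
  have hN : Nonempty ι := Fintype.card_pos_iff.1 (by omega)
  have hs : X.used A ⊆ X.used (insert a A) := by rw [used_insert]; exact subset_union_right
  have hbs : X.block a ⊆ X.used (insert a A) := by rw [used_insert]; exact subset_union_left
  have hcu := X.card_used_insert ha
  rw [← hk] at hcu
  -- `I ⊆ I'` have `Q` and `Q + W` pins, and sets in between realize the window; the `T` sockets in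
  -- `J` serve to sample the frozen fraction.
  obtain ⟨I', hI', hI'c⟩ := exists_disjoint_card (K := X.used (insert a A)) (Q := Q + W) (by omega)
  obtain ⟨I, hII', hIc⟩ := exists_subset_card_eq (s := I') (n := Q) (by omega)
  obtain ⟨J, hJ, hJc⟩ := exists_disjoint_card (K := X.used (insert a A) ∪ I') (Q := T) (by
    rw [card_union_of_disjoint hI'.symm]; omega)
  have hI := hI'.mono_left hII'
  have hI'A := hI'.mono_right hs
  have hJ' : Disjoint J (X.used A ∪ I') := hJ.mono_right (union_subset_union hs (subset_refl _))
  have hB : Disjoint (X.block a) (X.used A ∪ I') := by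
    rw [disjoint_union_right]
    exact ⟨X.disjoint_block_used ha, (hI'.mono_right hbs).symm⟩
  have hW' : (0 : ℝ) < W := by exact_mod_cast hW
  have hT' : (0 : ℝ) < T := by exact_mod_cast hT
  set p := 𝔼 σ, ind (∀ i ∈ X.block a, X.unit σ i ∈ X.space σ A I') with hp
  set ρ := 𝔼 σ, ind (X.row σ a ∈ X.space σ A I) with hρ
  -- comparison with the event that all sockets of the check are frozen
  have h1 : ∀ i ∈ range W, ρ ≤ p + k * (X.frozen A (Q + i + (k - 1)) - X.frozen A (Q + i)) := by
    intro i hi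
    rw [mem_range] at hi
    obtain ⟨L, hIL, hLI', hLc⟩ := exists_subsuperset_card_eq hII' (n := Q + i) (by omega) (by omega)
    have h2 := X.expect_ind_row_le ha (hI'.mono_left hLI')
    rw [hLc, ← hk] at h2
    have h3 : ρ ≤ 𝔼 σ, ind (X.row σ a ∈ X.space σ A L) :=
      expect_le_expect fun σ _ => ind_mono fun h => X.space_mono (subset_refl _) hIL h
    have h4 : 𝔼 σ, ind (∀ i ∈ X.block a, X.unit σ i ∈ X.space σ A L) ≤ p :=
      expect_le_expect fun σ _ => ind_mono fun h i hi => X.space_mono (subset_refl _) hLI' (h i hi)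
    linarith
  -- Sum over the window: `ρ` and `p` do not depend on `i`, and the differences of frozen
  -- probabilities telescope.
  have h2 : ρ ≤ p + (k : ℝ) ^ 2 / W := by
    have h3 := sum_le_sum h1
    rw [sum_const, sum_add_distrib, sum_const, card_range, ← mul_sum, nsmul_eq_mul,
      nsmul_eq_mul] at h3
    have h4 : ∑ i ∈ range W, (X.frozen A (Q + i + (k - 1)) - X.frozen A (Q + i)) ≤ k := by
      rcases Nat.eq_zero_or_pos k with h0 | h0
      · simp [h0]
      have h5 := sum_sub_shift_le (X.frozen A) Q W (k - 1)
        (fun i hi => X.frozen_nonneg (by omega)) (fun i hi => X.frozen_le_one (by omega))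
      refine h5.trans ?_
      exact_mod_cast Nat.sub_le k 1
    have h6 : W * ρ ≤ W * p + (k : ℝ) ^ 2 := by nlinarith [Nat.cast_nonneg (α := ℝ) k]
    have e : p + (k : ℝ) ^ 2 / W = (W * p + (k : ℝ) ^ 2) / W := by field_simp
    rw [e, le_div_iff₀ hW']
    linarith
  -- moments of the frozen fraction
  have h3 := (abs_le.1 (X.abs_expect_pow_sub_le hB hJ' (card_pos.1 (by omega)))).1
  rw [← hp, ← hk, hJc] at h3
  -- `ζ` overestimates the frozen fraction of `J` by counting the nullity lost when `J` is pinned.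
  -- Unlike the fraction itself, it is a difference of nullities, which concentrate.
  set ζ : Perm ι → ℝ := fun σ => 1 - (X.nullity σ A I' - X.nullity σ A (I' ∪ J)) / T with hζ
  set ξ := 1 - (X.mean A (Q + W) - X.mean A (Q + W + T)) / T with hξ
  have hdis : Disjoint (I' ∪ J) (X.used A) := by
    rw [disjoint_union_left]
    exact ⟨hI'A, hJ'.mono_right subset_union_left⟩
  have hcard : (I' ∪ J).card = Q + W + T := by
    rw [card_union_of_disjoint (hJ'.mono_right subset_union_right).symm]; omega
  have hmI' : 𝔼 τ, X.nullity τ A I' = X.mean A (Q + W) := by rw [X.expect_nullity hI'A, hI'c]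
  have hmJ : 𝔼 τ, X.nullity τ A (I' ∪ J) = X.mean A (Q + W + T) := by
    rw [X.expect_nullity hdis, hcard]
  have hZζ : ∀ σ, (∑ j ∈ J, ind (X.unit σ j ∈ X.space σ A I')) / T ≤ ζ σ := by
    intro σ
    have := X.nullity_sub_union_le σ A I' J
    rw [hJc] at this
    rw [hζ, div_le_iff₀ hT']
    simp only
    rw [sub_mul, div_mul_cancel₀ _ hT'.ne']
    linarith
  have hZ0 : ∀ σ, 0 ≤ (∑ j ∈ J, ind (X.unit σ j ∈ X.space σ A I')) / T := fun σ =>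
    div_nonneg (sum_nonneg fun _ _ => ind_nonneg _) hT'.le
  have hζ0 : ∀ σ, 0 ≤ ζ σ := fun σ => (hZ0 σ).trans (hZζ σ)
  have hζ1 : ∀ σ, ζ σ ≤ 1 := by
    intro σ
    have := X.nullity_anti (σ := σ) (subset_refl A) (subset_union_left (s₁ := I') (s₂ := J))
    have : 0 ≤ (X.nullity σ A I' - X.nullity σ A (I' ∪ J)) / T :=
      div_nonneg (by linarith) hT'.le
    simp only [hζ]
    linarith
  have hξ0 : 0 ≤ ξ := by
    have := X.mean_sub_mean_add_le (A := A) (Q := Q + W) (w := T) (by omega)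
    rw [hξ, sub_nonneg, div_le_one hT']
    exact this
  have hζk : ∀ σ, ζ σ ^ k ≤ ξ ^ k + k * ((|X.nullity σ A I' - 𝔼 τ, X.nullity τ A I'| +
      |X.nullity σ A (I' ∪ J) - 𝔼 τ, X.nullity τ A (I' ∪ J)|) / T) := by
    intro σ
    refine pow_le_pow_add_mul (hζ0 σ) (hζ1 σ) hξ0 (by positivity) ?_ k
    rw [hmI', hmJ]
    have h4 := neg_abs_le (X.nullity σ A I' - X.mean A (Q + W))
    have h5 := le_abs_self (X.nullity σ A (I' ∪ J) - X.mean A (Q + W + T))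
    have h6 : ζ σ - ξ ≤ (|X.nullity σ A I' - X.mean A (Q + W)| +
      |X.nullity σ A (I' ∪ J) - X.mean A (Q + W + T)|) / T := by
      rw [le_div_iff₀ hT']
      have : (ζ σ - ξ) * T = -(X.nullity σ A I' - X.mean A (Q + W)) +
          (X.nullity σ A (I' ∪ J) - X.mean A (Q + W + T)) := by
        simp only [hζ, hξ]
        field_simp
        ring
      rw [this]
      linarith
    linarith
  have h4 : 𝔼 σ, ((∑ j ∈ J, ind (X.unit σ j ∈ X.space σ A I')) / T) ^ k ≤
      ξ ^ k + k * (2 * (conc * √(Fintype.card ι)) / T) := by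
    refine (expect_le_expect fun σ _ =>
      (pow_le_pow_left₀ (hZ0 σ) (hZζ σ) k).trans (hζk σ)).trans ?_
    rw [expect_add_distrib, Fintype.expect_const, ← mul_expect, ← expect_div, expect_add_distrib]
    have a1 := X.expect_abs_nullity_sub_le A I'
    have a2 := X.expect_abs_nullity_sub_le A (I' ∪ J)
    have : (0 : ℝ) ≤ k := Nat.cast_nonneg k
    gcongr
    linarith
  have h5 := X.mean_sub_mean_insert hI
  rw [hIc, ← hρ] at h5
  rw [h5]
  linarith

/-! ### The matrix without checks -/

/-- Without rows the space is spanned by unit vectors, so the nullity counts the variables that have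
no pinned socket. -/
theorem nullity_empty (σ : Perm ι) (I : Finset ι) :
    X.nullity σ ∅ I = ∑ j : Fin n, ind (∀ t ∈ univ.filter (fun t => X.var t = j), σ⁻¹ t ∉ I) := by
  classical
  set S : Finset (Fin n) := I.image fun i => X.var (σ i) with hS
  have e1 : X.space σ ∅ I = Submodule.span F
      (Set.range fun j : S => (Pi.single (j : Fin n) 1 : Fin n → F)) := by
    rw [space]
    congr 1
    ext x
    simp [unit, hS]
  have e2 : LinearIndependent F fun j : S => (Pi.single (j : Fin n) 1 : Fin n → F) := by
    have := (Pi.basisFun F (Fin n)).linearIndependent.comp (fun j : S => (j : Fin n))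
      Subtype.val_injective
    convert this using 1
    ext j
    simp
  rw [nullity, e1, finrank_span_eq_card e2, Fintype.card_coe]
  have e3 : ∀ j : Fin n, ind (∀ t ∈ univ.filter (fun t => X.var t = j), σ⁻¹ t ∉ I) =
      1 - if j ∈ S then 1 else 0 := by
    intro j
    split_ifs with hj
    · rw [ind_of_not, sub_self]
      obtain ⟨i, hi, rfl⟩ := mem_image.1 hj
      push Not
      exact ⟨σ i, by simp, by simpa using hi⟩
    · rw [ind_of, sub_zero]
      intro t ht hI
      refine hj (mem_image.2 ⟨σ⁻¹ t, hI, ?_⟩)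
      simpa using ht
  simp_rw [e3]
  rw [sum_sub_distrib, sum_boole]
  simp

/-- The number of sockets of a variable. -/
def varDeg (j : Fin n) : ℕ := (univ.filter fun t => X.var t = j).card

/-- A variable of degree d avoids `Q` random pins with probability about (1 - Q/N)^d. The error d²/N
is the difference between sampling with and without replacement. -/
theorem abs_mean_empty_sub_le [Nonempty ι] {Q : ℕ} (hQ : Q ≤ Fintype.card ι) :
    |X.mean ∅ Q - ∑ j, (1 - (Q : ℝ) / Fintype.card ι) ^ X.varDeg j| ≤
      ∑ j, (X.varDeg j : ℝ) ^ 2 / Fintype.card ι := by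
  obtain ⟨I, hI, rfl⟩ := exists_disjoint_card (K := X.used ∅) (Q := Q) (by simpa [used_empty])
  rw [← X.expect_nullity hI]
  simp_rw [nullity_empty]
  rw [expect_sum_comm, ← sum_sub_distrib]
  refine (abs_sum_le_sum_abs _ _).trans (sum_le_sum fun j _ => ?_)
  set B := univ.filter fun t => X.var t = j
  have key := abs_expect_pow_expect_sub_le (Ω := Perm ι) (J := ι)
    (fun σ t => ind (σ⁻¹ t ∉ I)) (fun _ _ => ind_nonneg _)
    (fun _ _ => ind_le_one _) B.card (𝔼 σ : Perm ι, ind (∀ t ∈ B, σ⁻¹ t ∉ I))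
    (expect_nonneg fun _ _ => ind_nonneg _) (expect_le univ_nonempty fun _ _ => ind_le_one _) (by
      intro t ht
      obtain ⟨τ, -, h2⟩ := exists_perm_fixing ∅
        (t' := fun l => ((B.equivFin.symm l : B) : ι)) (t := t)
        ht (Subtype.val_injective.comp (Equiv.injective _)) (by simp) (by simp)
      rw [← expect_mul_left (fun σ => ind (∀ t ∈ B, σ⁻¹ t ∉ I)) τ]
      refine expect_congr rfl fun σ _ => ?_
      rw [← prod_ind, ← Finset.prod_coe_sort B fun t => ind ((τ * σ)⁻¹ t ∉ I)]
      refine Fintype.prod_equiv B.equivFin.symm _ _ fun l => ?_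
      rw [← h2, mul_inv_rev, Perm.mul_apply]
      simp)
  have e : ∀ σ : Perm ι, 𝔼 t, ind (σ⁻¹ t ∉ I) = 1 - (I.card : ℝ) / Fintype.card ι := by
    intro σ
    have h1 : 𝔼 t, ind (σ⁻¹ t ∉ I) = 𝔼 t, ind (t ∉ I) :=
      Fintype.expect_equiv σ⁻¹ _ _ fun _ => rfl
    have h2 : ∀ t, ind (t ∉ I) = 1 - if t ∈ I then 1 else 0 := fun t => by
      split_ifs with h
      · rw [ind_of_not (by simpa using h), sub_self]
      · rw [ind_of h, sub_zero]
    rw [h1]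
    simp_rw [h2]
    rw [expect_sub_distrib, Fintype.expect_const, Fintype.expect_eq_sum_div_card, sum_boole]
    simp
  simp_rw [e] at key
  rw [Fintype.expect_const, abs_sub_comm] at key
  exact key

end Ensemble

/-! ### The potential, and leaving out a few checks -/

/-- The contribution of a check of degree `k` to the potential. -/
noncomputable def gain (k : ℕ) (y : ℝ) : ℝ := -1 + k * y ^ (k - 1) - (k - 1) * y ^ k

namespace Ensemble

variable {ι F : Type*} [Fintype ι] [DecidableEq ι] [Field F] {m n : ℕ} (X : Ensemble ι F m n)

/-- The potential of the configuration model. -/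
noncomputable def potential (α : ℝ) : ℝ :=
  ∑ j, (1 - (∑ a, (X.block a).card * α ^ ((X.block a).card - 1)) / Fintype.card ι) ^ X.varDeg j +
    ∑ a, gain (X.block a).card α

theorem sum_card_block : ∑ a, (X.block a).card = Fintype.card ι := by
  rw [← card_used]
  simp [used]

theorem sum_varDeg : ∑ j, X.varDeg j = Fintype.card ι := by
  rw [← card_univ, card_eq_sum_card_fiberwise (f := X.var) (t := univ) (by simp)]
  rfl

/-- The estimates need unused sockets. Leaving out `h` checks frees at least `h` of them and, by
`mean_univ_bounds`, changes the expected nullity by at most `h`. -/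
theorem exists_card_add_card_used_le {h : ℕ} (hm : h ≤ m) (hk : ∀ a, 1 ≤ (X.block a).card) :
    ∃ A : Finset (Fin m), A.card + h = m ∧ (X.used A).card + h ≤ Fintype.card ι := by
  obtain ⟨A, -, hA⟩ := exists_subset_card_eq (s := (univ : Finset (Fin m))) (n := m - h) (by simp)
  refine ⟨A, by omega, ?_⟩
  have h1 : Aᶜ.card ≤ ∑ a ∈ Aᶜ, (X.block a).card := by
    rw [card_eq_sum_ones]
    exact sum_le_sum fun a _ => hk a
  rw [card_compl, Fintype.card_fin] at h1
  rw [card_used, ← X.sum_card_block, ← sum_add_sum_compl A]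
  omega

theorem mean_univ_bounds {h : ℕ} {A : Finset (Fin m)} (hA : A.card + h = m) :
    X.mean univ 0 ≤ X.mean A 0 ∧ X.mean A 0 ≤ X.mean univ 0 + h := by
  have key : ∀ B : Finset (Fin m), X.mean (A ∪ B) 0 ≤ X.mean A 0 ∧
      X.mean A 0 ≤ X.mean (A ∪ B) 0 + B.card := by
    intro B
    induction B using Finset.induction_on with
    | empty => simp
    | insert b B hb ih =>
      have h1 := X.mean_insert_le (A := A ∪ B) (a := b) (Q := 0) (by simpa using card_le_univ _)
      rw [← union_insert] at h1
      rw [card_insert_of_notMem hb]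
      push_cast
      constructor <;> linarith [ih.1, ih.2, h1.1, h1.2]
  have h2 := key Aᶜ
  rw [union_compl, card_compl, Fintype.card_fin, show m - A.card = h by omega] at h2
  exact h2

theorem sum_varDeg_sq_div_le [Nonempty ι] {Δ : ℕ} (hd : ∀ j, X.varDeg j ≤ Δ) :
    ∑ j, (X.varDeg j : ℝ) ^ 2 / Fintype.card ι ≤ Δ := by
  have hN : (0 : ℝ) < Fintype.card ι := by exact_mod_cast Fintype.card_pos
  rw [← sum_div, div_le_iff₀ hN, ← X.sum_varDeg]
  push_cast
  rw [mul_sum]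
  refine sum_le_sum fun j _ => ?_
  have : (X.varDeg j : ℝ) ≤ Δ := by exact_mod_cast hd j
  nlinarith [Nat.cast_nonneg (α := ℝ) (X.varDeg j)]

/-! ### The lower bound -/

/-- The expected nullity averaged over a window of pins. -/
noncomputable def window (W : ℕ) (A : Finset (Fin m)) (P : ℕ) : ℝ :=
  (∑ w ∈ range W, X.mean A (P + w)) / W

/-- Bounding `x ^ k` below by its tangent at `α` makes the step linear in the frozen probability.
Over a window, the linear term is controlled by the drop caused by `k` more pins, up to `k ^ 2 / W`;
hence the average of the values at `P` and `P + k` with weight `α ^ (k - 1)`. -/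
theorem le_window_insert {A : Finset (Fin m)} {a : Fin m} (ha : a ∉ A) {P W T : ℕ} (hW : 0 < W)
    (hT : 0 < T) (h : (X.used (insert a A)).card + (P + W + T) ≤ Fintype.card ι) {α : ℝ}
    (hα : 0 ≤ α) (hα1 : α ≤ 1) :
    (1 - α ^ ((X.block a).card - 1)) * X.window W A P +
      α ^ ((X.block a).card - 1) * X.window W A (P + (X.block a).card) + gain (X.block a).card α -
        (((X.block a).card : ℝ) ^ 2 / W + ((X.block a).card : ℝ) ^ 2 / T) ≤
      X.window W (insert a A) P := by
  set k := (X.block a).card with hk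
  set u := α ^ (k - 1) with hu
  have hu0 : 0 ≤ u := pow_nonneg hα _
  have hu1 : u ≤ 1 := pow_le_one₀ hα hα1
  have hcu := X.card_used_insert ha
  rw [← hk] at hcu
  have hW' : (0 : ℝ) < W := by exact_mod_cast hW
  set x := X.frozen A with hx
  set s := ∑ w ∈ range W, x (P + w) with hs
  have h1 : ∑ w ∈ range W, X.mean A (P + w) +
      (k * u * s - W * ((k - 1) * α ^ k + 1 + (k : ℝ) ^ 2 / T)) ≤
      ∑ w ∈ range W, X.mean (insert a A) (P + w) := by
    rw [hs, mul_sum]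
    have : (W : ℝ) * ((k - 1) * α ^ k + 1 + (k : ℝ) ^ 2 / T) =
      ∑ w ∈ range W, ((k - 1) * α ^ k + 1 + (k : ℝ) ^ 2 / T) := by
      rw [sum_const, card_range, nsmul_eq_mul]
    rw [this, ← sum_sub_distrib, ← sum_add_distrib]
    refine sum_le_sum fun w hw => ?_
    rw [mem_range] at hw
    have h2 := X.mean_sub_mean_insert_le ha (Q := P + w) hT (by omega)
    have h3 := tangent_le_pow (X.frozen_nonneg (A := A) (Q := P + w) (by omega)) hα k
    rw [← hk] at h2
    rw [← hu] at h3
    linarith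
  have h2 : W * (X.window W A P - X.window W A (P + k)) ≥ k * (W - s) - (k : ℝ) ^ 2 := by
    have e : W * (X.window W A P - X.window W A (P + k)) =
        ∑ w ∈ range W, (X.mean A (P + w) - X.mean A (P + w + k)) := by
      rw [window, window, sum_sub_distrib, mul_sub, mul_div_cancel₀ _ hW'.ne',
        mul_div_cancel₀ _ hW'.ne']
      congr 1
      exact sum_congr rfl fun w _ => by rw [show P + k + w = P + w + k by ring]
    rw [e]
    simp_rw [mean_sub_mean_add]
    rw [sum_comm]
    have h3 : ∀ i ∈ range k, (W - s) - (k : ℝ) ≤ ∑ w ∈ range W, (1 - X.frozen A (P + w + i)) := by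
      intro i hi
      rw [mem_range] at hi
      have h4 := sum_sub_shift_le x P W i (fun i hi => X.frozen_nonneg (by omega))
        (fun i hi => X.frozen_le_one (by omega))
      rw [sum_sub_distrib] at h4
      rw [sum_sub_distrib]
      have : (i : ℝ) ≤ k := by exact_mod_cast hi.le
      simp only [sum_const, card_range, nsmul_eq_mul, mul_one]
      linarith
    have h5 := sum_le_sum h3
    simp only [sum_const, card_range, nsmul_eq_mul] at h5
    linarith
  have e1 : W * X.window W A P = ∑ w ∈ range W, X.mean A (P + w) := by
    rw [window, mul_div_cancel₀ _ hW'.ne']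
  have e2 : W * X.window W (insert a A) P = ∑ w ∈ range W, X.mean (insert a A) (P + w) := by
    rw [window, mul_div_cancel₀ _ hW'.ne']
  rw [← e1, ← e2] at h1
  refine le_of_mul_le_mul_left ?_ hW'
  have h6 := mul_le_mul_of_nonneg_left h2 hu0
  have h7 : u * (k : ℝ) ^ 2 ≤ (k : ℝ) ^ 2 := by nlinarith [sq_nonneg (k : ℝ)]
  have e3 : (W : ℝ) * ((k : ℝ) ^ 2 / W) = (k : ℝ) ^ 2 := by field_simp
  rw [gain, ← hu]
  have e4 : W * ((1 - u) * X.window W A P + u * X.window W A (P + k) +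
      (-1 + k * u - (k - 1) * α ^ k) - ((k : ℝ) ^ 2 / W + (k : ℝ) ^ 2 / T)) =
      W * X.window W A P - u * (W * (X.window W A P - X.window W A (P + k))) +
      W * (k * u) - (k : ℝ) ^ 2 - W * ((k - 1) * α ^ k + 1 + (k : ℝ) ^ 2 / T) := by
    linear_combination -e3
  rw [e4]
  linarith

/-- The weights in `le_window_insert` shift `P` by `k * α ^ (k - 1)` on average, so an affine
minorant keeps its slope and only its constant changes. The bound is needed for all `P`, because the
induction step also uses it at `P + k`. -/
theorem affine_le_window {W T : ℕ} (hW : 0 < W) (hT : 0 < T) {α : ℝ} (hα : 0 ≤ α) (hα1 : α ≤ 1)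
    {B b : ℝ} (h0 : ∀ P : ℕ, P + W + T ≤ Fintype.card ι → B - b * P ≤ X.window W ∅ P)
    (A : Finset (Fin m)) : ∀ P : ℕ, (X.used A).card + (P + W + T) ≤ Fintype.card ι →
      B - b * P + ∑ a ∈ A, (gain (X.block a).card α -
        b * ((X.block a).card * α ^ ((X.block a).card - 1)) -
        (((X.block a).card : ℝ) ^ 2 / W + ((X.block a).card : ℝ) ^ 2 / T)) ≤ X.window W A P := by
  induction A using Finset.induction_on with
  | empty => intro P hP; simpa using h0 P (by simpa [used_empty] using hP)
  | insert a A ha ih =>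
    intro P hP
    refine le_trans ?_ (X.le_window_insert ha hW hT hP hα hα1)
    rw [sum_insert ha]
    have hcu := X.card_used_insert ha
    have i1 := ih P (by omega)
    have i2 := ih (P + (X.block a).card) (by omega)
    set k := (X.block a).card
    set u := α ^ (k - 1)
    have hu0 : 0 ≤ u := pow_nonneg hα _
    have hu1 : u ≤ 1 := pow_le_one₀ hα hα1
    have j1 := mul_le_mul_of_nonneg_left i1 (sub_nonneg.2 hu1)
    have j2 := mul_le_mul_of_nonneg_left i2 hu0
    push_cast at j2
    linarith

theorem gain_le {k : ℕ} (hk : 1 ≤ k) {y : ℝ} (hy : 0 ≤ y) (hy1 : y ≤ 1) : gain k y ≤ k := by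
  have h1 : y ^ (k - 1) ≤ 1 := pow_le_one₀ hy hy1
  have h2 : 0 ≤ y ^ k := pow_nonneg hy _
  have h3 : (1 : ℝ) ≤ k := by exact_mod_cast hk
  rw [gain]
  nlinarith

theorem sum_card_block_mul_pow_le {α : ℝ} (hα : 0 ≤ α) (hα1 : α ≤ 1) :
    ∑ a, ((X.block a).card : ℝ) * α ^ ((X.block a).card - 1) ≤ Fintype.card ι := by
  have h : (Fintype.card ι : ℝ) = ∑ a, ((X.block a).card : ℝ) := by
    exact_mod_cast X.sum_card_block.symm
  rw [h]
  exact sum_le_sum fun a _ => mul_le_of_le_one_right (Nat.cast_nonneg _) (pow_le_one₀ hα hα1)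

theorem sum_varDeg_mul_pow_le {z : ℝ} (hz : 0 ≤ z) (hz1 : z ≤ 1) :
    ∑ j, (X.varDeg j : ℝ) * z ^ (X.varDeg j - 1) ≤ Fintype.card ι := by
  have h : (Fintype.card ι : ℝ) = ∑ j, (X.varDeg j : ℝ) := by
    exact_mod_cast X.sum_varDeg.symm
  rw [h]
  exact sum_le_sum fun a _ => mul_le_of_le_one_right (Nat.cast_nonneg _) (pow_le_one₀ hz hz1)

/-- The initial value is convex in the number of pins; this is its tangent at `V`. It is used where
`V` is the total shift of the transport. -/
theorem tangent_le_sum_pow_varDeg [Nonempty ι] (hd : ∀ j, 1 ≤ X.varDeg j) {V P : ℝ}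
    (hV : V ≤ Fintype.card ι) (hP : P ≤ Fintype.card ι) :
    ∑ j, (1 - V / Fintype.card ι) ^ X.varDeg j +
      (∑ j, (X.varDeg j : ℝ) * (1 - V / Fintype.card ι) ^ (X.varDeg j - 1)) / Fintype.card ι *
        (V - P) ≤ ∑ j, (1 - P / Fintype.card ι) ^ X.varDeg j := by
  have hN : (0 : ℝ) < Fintype.card ι := by exact_mod_cast Fintype.card_pos
  set N : ℝ := (Fintype.card ι : ℝ)
  set z := 1 - V / N with hz
  have hz0 : 0 ≤ z := sub_nonneg.2 ((div_le_one hN).2 hV)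
  have hx0 : 0 ≤ 1 - P / N := sub_nonneg.2 ((div_le_one hN).2 hP)
  rw [div_mul_eq_mul_div, mul_div_assoc, sum_mul, ← sum_add_distrib]
  refine sum_le_sum fun j _ => le_trans (le_of_eq ?_) (tangent_le_pow hx0 hz0 (X.varDeg j))
  have e : z ^ X.varDeg j = z * z ^ (X.varDeg j - 1) := by
    rw [← pow_succ', Nat.sub_add_cancel (hd j)]
  rw [e, sub_div, show V / N = 1 - z by rw [hz]; ring]
  ring

theorem mean_add_le_window {A : Finset (Fin m)} {P W : ℕ} (hW : 0 < W)
    (h : (X.used A).card + (P + W) ≤ Fintype.card ι) : X.mean A (P + W) ≤ X.window W A P := by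
  have hW' : (0 : ℝ) < W := by exact_mod_cast hW
  rw [window, le_div_iff₀ hW', mul_comm, ← nsmul_eq_mul]
  nth_rewrite 1 [← card_range W]
  refine card_nsmul_le_sum (range W) _ _ fun w hw => ?_
  rw [mem_range] at hw
  have := X.mean_anti (A := A) (Q := P + w) (w := W - w) (by omega)
  rwa [show P + w + (W - w) = P + W by omega] at this

theorem window_le_mean {A : Finset (Fin m)} {P W : ℕ} (hW : 0 < W)
    (h : (X.used A).card + (P + W) ≤ Fintype.card ι) : X.window W A P ≤ X.mean A P := by
  have hW' : (0 : ℝ) < W := by exact_mod_cast hW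
  rw [window, div_le_iff₀ hW', mul_comm, ← nsmul_eq_mul]
  nth_rewrite 2 [← card_range W]
  refine sum_le_card_nsmul (range W) _ _ fun w hw => ?_
  rw [mem_range] at hw
  exact X.mean_anti (by omega)

/-- The transport starts from the tangent at the total shift `V`. Its term `b * V` pays for all
slope corrections, so the value of the potential remains at `P = 0`. Each check left out costs at
most `Δ` in gain and 1 in nullity. -/
theorem potential_le_mean [Nonempty ι] {Δ W T h : ℕ} (hW : 0 < W) (hT : 0 < T) (hWT : W + T ≤ h)
    (hm : h ≤ m) (hk : ∀ a, 1 ≤ (X.block a).card) (hkΔ : ∀ a, (X.block a).card ≤ Δ)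
    (hd : ∀ j, 1 ≤ X.varDeg j) (hdΔ : ∀ j, X.varDeg j ≤ Δ) {α : ℝ} (hα : 0 ≤ α) (hα1 : α ≤ 1) :
    X.potential α - (W + Δ + m * ((Δ : ℝ) ^ 2 / W + (Δ : ℝ) ^ 2 / T) + h * (Δ + 1)) ≤
      X.mean univ 0 := by
  have hN : (0 : ℝ) < Fintype.card ι := by exact_mod_cast Fintype.card_pos
  obtain ⟨A, hA, hAu⟩ := X.exists_card_add_card_used_le hm hk
  have hmA := (X.mean_univ_bounds hA).2
  have hVN := X.sum_card_block_mul_pow_le hα hα1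
  set V := ∑ a, ((X.block a).card : ℝ) * α ^ ((X.block a).card - 1) with hV
  have hV0 : 0 ≤ V := sum_nonneg fun a _ => mul_nonneg (Nat.cast_nonneg _) (pow_nonneg hα _)
  set z := 1 - V / Fintype.card ι with hz
  have hz0 : 0 ≤ z := sub_nonneg.2 ((div_le_one hN).2 hVN)
  have hz1 : z ≤ 1 := sub_le_self _ (div_nonneg hV0 hN.le)
  set b := (∑ j, (X.varDeg j : ℝ) * z ^ (X.varDeg j - 1)) / Fintype.card ι with hb
  have hb0 : 0 ≤ b := div_nonneg
    (sum_nonneg fun j _ => mul_nonneg (Nat.cast_nonneg _) (pow_nonneg hz0 _)) hN.le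
  have hb1 : b ≤ 1 := (div_le_one hN).2 (X.sum_varDeg_mul_pow_le hz0 hz1)
  have hW' : (0 : ℝ) < W := by exact_mod_cast hW
  have hbase : ∀ P : ℕ, P + W + T ≤ Fintype.card ι →
      (∑ j, z ^ X.varDeg j + b * V - W - Δ) - b * P ≤ X.window W ∅ P := by
    intro P hP
    have h1 := X.mean_add_le_window (A := ∅) (P := P) hW (by rw [used_empty]; simp; omega)
    have h2 := (abs_le.1 (X.abs_mean_empty_sub_le (Q := P + W) (by omega))).1
    have h3 := X.sum_varDeg_sq_div_le hdΔ
    have h4 := X.tangent_le_sum_pow_varDeg hd hVN (P := ((P + W : ℕ) : ℝ))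
      (by exact_mod_cast (by omega : P + W ≤ Fintype.card ι))
    rw [← hz, ← hb, Nat.cast_add] at h4
    rw [Nat.cast_add] at h2
    nlinarith
  have key := X.affine_le_window hW hT hα hα1 hbase A 0 (by omega)
  have hfin := X.window_le_mean (A := A) (P := 0) hW (by omega)
  have hT' : (0 : ℝ) < T := by exact_mod_cast hT
  have hgA : ∑ a, gain (X.block a).card α ≤ ∑ a ∈ A, gain (X.block a).card α + h * Δ := by
    rw [← sum_add_sum_compl A]
    gcongr
    have : ∑ a ∈ Aᶜ, gain (X.block a).card α ≤ ∑ a ∈ Aᶜ, (Δ : ℝ) :=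
      sum_le_sum fun a _ => (gain_le (hk a) hα hα1).trans (by exact_mod_cast hkΔ a)
    rw [sum_const, card_compl, Fintype.card_fin, nsmul_eq_mul, show m - A.card = h by omega] at this
    exact this
  have hVA : b * ∑ a ∈ A, ((X.block a).card : ℝ) * α ^ ((X.block a).card - 1) ≤ b * V :=
    mul_le_mul_of_nonneg_left (sum_le_sum_of_subset_of_nonneg (subset_univ _)
      fun a _ _ => mul_nonneg (Nat.cast_nonneg _) (pow_nonneg hα _)) hb0
  have hE : ∑ a ∈ A, (((X.block a).card : ℝ) ^ 2 / W + ((X.block a).card : ℝ) ^ 2 / T) ≤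
      m * ((Δ : ℝ) ^ 2 / W + (Δ : ℝ) ^ 2 / T) := by
    refine (sum_le_card_nsmul A _ ((Δ : ℝ) ^ 2 / W + (Δ : ℝ) ^ 2 / T) fun a _ => ?_).trans ?_
    · have : ((X.block a).card : ℝ) ≤ Δ := by exact_mod_cast hkΔ a
      gcongr
    · rw [nsmul_eq_mul]
      have : (A.card : ℝ) ≤ m := by exact_mod_cast (by omega : A.card ≤ m)
      gcongr
  rw [sum_sub_distrib, sum_sub_distrib, ← mul_sum] at key
  simp only [Nat.cast_zero, mul_zero, sub_zero] at key
  rw [potential]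
  change ∑ j, z ^ X.varDeg j + _ - _ ≤ _
  linarith

/-! ### The upper bound -/

/-- The sup-convolution of the expected nullity, as a function of the number of pins, with a
parabola. -/
noncomputable def supConv (c : ℝ) (A : Finset (Fin m)) (P : ℝ) : ℝ :=
  (range (Fintype.card ι - (X.used A).card + 1)).sup' nonempty_range_add_one
    fun Q => X.mean A Q - (P - Q) ^ 2 / c

theorem le_supConv (c : ℝ) {A : Finset (Fin m)} (P : ℝ) {Q : ℕ}
    (hQ : (X.used A).card + Q ≤ Fintype.card ι) :
    X.mean A Q - (P - Q) ^ 2 / c ≤ X.supConv c A P :=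
  le_sup' (fun Q : ℕ => X.mean A Q - (P - Q) ^ 2 / c) (by rw [mem_range]; omega)

theorem exists_supConv_eq (c : ℝ) (A : Finset (Fin m)) (P : ℝ) :
    ∃ Q : ℕ, (X.used A).card + Q ≤ Fintype.card ι ∧
      X.supConv c A P = X.mean A Q - (P - Q) ^ 2 / c := by
  obtain ⟨Q, hQ, h⟩ := exists_mem_eq_sup' nonempty_range_add_one
    (s := range (Fintype.card ι - (X.used A).card + 1))
    (fun Q : ℕ => X.mean A Q - (P - Q) ^ 2 / c)
  rw [mem_range] at hQ
  have := card_le_univ (X.used A)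
  exact ⟨Q, by omega, h⟩

/-- The maximizer in the sup-convolution is close to `P`. -/
theorem abs_sub_le_of_supConv_eq {c : ℝ} (hc : 0 < c) {A : Finset (Fin m)} {P : ℝ} (hP : 0 ≤ P)
    (hPA : (X.used A).card + P ≤ Fintype.card ι) {Q : ℕ}
    (h : X.supConv c A P = X.mean A Q - (P - Q) ^ 2 / c) : |P - Q| ≤ √(c * n + 1) := by
  refine Real.abs_le_sqrt ?_
  -- The competitor `⌊P⌋₊` has penalty at most `1 / c`, and `mean` takes values between 0 and `n`.
  have hfl := Nat.floor_le hP
  have h1 := X.le_supConv c (A := A) P (Q := ⌊P⌋₊) (by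
    have : ((X.used A).card : ℝ) + ⌊P⌋₊ ≤ Fintype.card ι := by linarith
    exact_mod_cast this)
  rw [h] at h1
  have h2 := X.mean_nonneg A ⌊P⌋₊
  have h3 := X.mean_le A Q
  have h4 : (P - ⌊P⌋₊) ^ 2 / c ≤ 1 / c := by
    gcongr
    have := Nat.lt_floor_add_one P
    nlinarith
  have h5 : (P - Q) ^ 2 / c ≤ n + 1 / c := by linarith
  rw [div_le_iff₀ hc] at h5
  have e : (n + 1 / c) * c = c * n + 1 := by field_simp
  linarith

/-- The error made when a check is added in the upper bound. -/
noncomputable def stepError (Δ N W T c ρ : ℝ) : ℝ :=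
  Δ ^ 2 / W + Δ ^ 2 / T + Δ * (2 * (conc * √N) / T) +
    Δ * ((W * (2 * ρ / c) + (W + T) ^ 2 / c + W + 1) / T) + Δ ^ 2 / c

/-- At the maximizer `Q` the parabola bounds the slope of `mean`, and hence the frozen probability,
essentially by `xs = 1 + 2 * (Q - P) / c`; `y` is `xs` clipped to [0, 1]. The same `Q` is then a
competitor for `A` at the shifted point, and the change of the parabola supplies what turns `-1 + y
^ k` into `gain k y`. -/
theorem supConv_insert_le {A : Finset (Fin m)} {a : Fin m} (ha : a ∉ A) {Δ W T : ℕ} (hW : 0 < W)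
    (hT : 0 < T) {c P : ℝ} (hc : 0 < c) (hP : 0 ≤ P) (hk : 2 ≤ (X.block a).card)
    (hkΔ : (X.block a).card ≤ Δ)
    (hroom : (X.used (insert a A)).card + P + (√(c * n + 1) + W + T) ≤ Fintype.card ι) :
    ∃ y : ℝ, 0 ≤ y ∧ y ≤ 1 ∧ X.supConv c (insert a A) P ≤
      X.supConv c A (P + (X.block a).card * y ^ ((X.block a).card - 1)) + gain (X.block a).card y +
        stepError Δ (Fintype.card ι) W T c (√(c * n + 1)) := by
  set k := (X.block a).card with hkdef
  set ρ := √(c * n + 1) with hρ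
  have hρ0 : 0 ≤ ρ := Real.sqrt_nonneg _
  have hW' : (0 : ℝ) < W := by exact_mod_cast hW
  have hT' : (0 : ℝ) < T := by exact_mod_cast hT
  have hkΔ' : (k : ℝ) ≤ Δ := by exact_mod_cast hkΔ
  have hcu := X.card_used_insert ha
  rw [← hkdef] at hcu
  obtain ⟨Q, hQ, hmax⟩ := X.exists_supConv_eq c (insert a A) P
  have hPQ := X.abs_sub_le_of_supConv_eq hc hP (by linarith) hmax
  rw [← hρ, abs_le] at hPQ
  have hroomQ : (X.used (insert a A)).card + (Q + W + T) ≤ Fintype.card ι := by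
    have : ((X.used (insert a A)).card : ℝ) + (Q + W + T) ≤ Fintype.card ι := by linarith
    exact_mod_cast this
  -- the slope at the maximizer
  set xs := 1 + 2 * (Q - P) / c with hxs
  have hslope : X.mean (insert a A) (Q + W + T) - X.mean (insert a A) Q ≤
      (W + T) * (xs - 1) + (W + T) ^ 2 / c := by
    have h1 := X.le_supConv c (A := insert a A) P (Q := Q + W + T) hroomQ
    rw [hmax] at h1
    push_cast at h1
    have e : (W + T) * (xs - 1) + (W + T : ℝ) ^ 2 / c =
        (P - (Q + W + T)) ^ 2 / c - (P - Q) ^ 2 / c := by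
      rw [hxs]; field_simp; ring
    linarith
  set ξ := 1 - (X.mean A (Q + W) - X.mean A (Q + W + T)) / T with hξ
  have hξ0 : 0 ≤ ξ := by
    have := X.mean_sub_mean_add_le (A := A) (Q := Q + W) (w := T) (by omega)
    rw [hξ, sub_nonneg, div_le_one hT']
    exact this
  have hξ1 : ξ ≤ 1 := by
    have := X.mean_anti (A := A) (Q := Q + W) (w := T) (by omega)
    have : 0 ≤ (X.mean A (Q + W) - X.mean A (Q + W + T)) / T := div_nonneg (by linarith) hT'.le
    linarith
  set e := (W * (2 * ρ / c) + (W + T) ^ 2 / c + W + 1) / T with he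
  have he0 : 0 ≤ e := by positivity
  -- The slope is controlled for `insert a A` but needed for `A` on the last `T` pins. The values
  -- differ by at most 1 and the first `W` pins cost at most `W`; dividing by `T` makes this small.
  have hξe : ξ ≤ xs + e := by
    have h1 := X.mean_sub_mean_add_le (A := A) (Q := Q) (w := W) (by omega)
    have h2 := (X.mean_insert_le (A := A) (a := a) (Q := Q) (by omega)).1
    have h3 := (X.mean_insert_le (A := A) (a := a) (Q := Q + W + T) (by omega)).2
    have h4 : W * (xs - 1) ≤ W * (2 * ρ / c) := by
      refine mul_le_mul_of_nonneg_left ?_ hW'.le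
      rw [hxs, add_sub_cancel_left]
      gcongr
      linarith
    have h5 : T * (ξ - xs) ≤ T * e := by
      have e1 : T * e = W * (2 * ρ / c) + (W + T) ^ 2 / c + W + 1 := by
        rw [he]; field_simp
      have e2 : T * ξ = T - (X.mean A (Q + W) - X.mean A (Q + W + T)) := by
        rw [hξ]; field_simp
      rw [e1, mul_sub, e2]
      linarith
    linarith [le_of_mul_le_mul_left h5 hT']
  set y := max 0 (min 1 xs) with hy
  have hy0 : 0 ≤ y := le_max_left _ _
  have hy1 : y ≤ 1 := max_le zero_le_one (min_le_left _ _)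
  refine ⟨y, hy0, hy1, ?_⟩
  have hξy : ξ ≤ y + e := by
    rcases le_total xs 1 with h1 | h1
    · have : xs ≤ y := by rw [hy, min_eq_right h1]; exact le_max_right _ _
      linarith
    · have : 1 ≤ y := by rw [hy, min_eq_left h1]; exact le_max_right _ _
      linarith
  have hpow := pow_le_pow_add_mul hξ0 hξ1 hy0 he0 hξy k
  have hstep := X.le_mean_sub_mean_insert ha hW hT hroomQ
  rw [← hkdef, ← hξ] at hstep
  set j := k * y ^ (k - 1) with hj
  have hj0 : 0 ≤ j := by positivity
  have hjk : j ≤ k := mul_le_of_le_one_right (Nat.cast_nonneg _) (pow_le_one₀ hy0 hy1)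
  -- Clipping does no harm: above 1 the left side is nonpositive and the right side zero, and below
  -- 0 the weight `j` vanishes because `k ≥ 2`.
  have hjx : j * (1 - xs) ≤ j * (1 - y) := by
    rcases le_total xs 1 with h1 | h1
    · rcases le_total 0 xs with h0 | h0
      · have : y = xs := by rw [hy, min_eq_right h1, max_eq_right h0]
        rw [this]
      · have : y = 0 := by rw [hy, min_eq_right h1, max_eq_left h0]
        have : j = 0 := by rw [hj, this, zero_pow (by omega), mul_zero]
        rw [this]; simp
    · have : y ≤ xs := hy1.trans h1
      nlinarith
  have hle := X.le_supConv c (A := A) (P + j) (Q := Q) (by omega)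
  have hsq : (P + j - Q) ^ 2 / c - (P - Q) ^ 2 / c = j * (1 - xs) + j ^ 2 / c := by
    rw [hxs]; field_simp; ring
  have hjc : j ^ 2 / c ≤ (Δ : ℝ) ^ 2 / c := by
    gcongr
    linarith
  have hyk : j * y = k * y ^ k := by
    rw [hj, mul_assoc, ← pow_succ, Nat.sub_add_cancel (by omega)]
  have hg : gain k y = -1 + j - j * y + y ^ k := by
    rw [gain, ← hj, hyk]; ring
  have hb1 : (k : ℝ) ^ 2 / W ≤ (Δ : ℝ) ^ 2 / W := by gcongr
  have hb2 : (k : ℝ) ^ 2 / T ≤ (Δ : ℝ) ^ 2 / T := by gcongr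
  have hconc : 0 ≤ conc := by rw [conc]; positivity
  have hb3 : (k : ℝ) * (2 * (conc * √(Fintype.card ι)) / T) ≤
      Δ * (2 * (conc * √(Fintype.card ι)) / T) := by gcongr
  have hb4 : k * e ≤ Δ * e := by gcongr
  rw [hmax, hg, stepError, ← he]
  linarith

/-- Iterating the step, the base point moves up by at most the number of sockets released by the
removed check, so the room persists. -/
theorem supConv_le {Δ W T : ℕ} (hW : 0 < W) (hT : 0 < T) {c : ℝ} (hc : 0 < c)
    (hk : ∀ a, 2 ≤ (X.block a).card) (hkΔ : ∀ a, (X.block a).card ≤ Δ) (A : Finset (Fin m)) :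
    ∀ P : ℝ, 0 ≤ P → (X.used A).card + P + (√(c * n + 1) + W + T) ≤ Fintype.card ι →
      ∃ y : Fin m → ℝ, (∀ a, 0 ≤ y a ∧ y a ≤ 1) ∧ (∀ a ∉ A, y a = 0) ∧ X.supConv c A P ≤
        X.supConv c ∅ (P + ∑ a ∈ A, (X.block a).card * y a ^ ((X.block a).card - 1)) +
          ∑ a ∈ A, gain (X.block a).card (y a) +
          A.card * stepError Δ (Fintype.card ι) W T c (√(c * n + 1)) := by
  induction A using Finset.induction_on with
  | empty => intro P _ _; exact ⟨0, by simp, by simp, by simp⟩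
  | insert a A ha ih =>
    intro P hP hroom
    obtain ⟨z, hz0, hz1, hz⟩ := X.supConv_insert_le ha hW hT hc hP (hk a) (hkΔ a) hroom
    have hcu : ((X.used (insert a A)).card : ℝ) = (X.block a).card + (X.used A).card := by
      exact_mod_cast X.card_used_insert ha
    have hj0 : 0 ≤ (X.block a).card * z ^ ((X.block a).card - 1) := by positivity
    have hj1 : (X.block a).card * z ^ ((X.block a).card - 1) ≤ (X.block a).card :=
      mul_le_of_le_one_right (Nat.cast_nonneg _) (pow_le_one₀ hz0 hz1)
    obtain ⟨y, hy, hyA, hle⟩ := ih (P + (X.block a).card * z ^ ((X.block a).card - 1))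
      (by linarith) (by linarith)
    have hne : ∀ b ∈ A, Function.update y a z b = y b := fun b hb =>
      Function.update_of_ne (by rintro rfl; exact ha hb) _ _
    refine ⟨Function.update y a z, fun b => ?_, fun b hb => ?_, ?_⟩
    · by_cases h : b = a
      · subst h; simp [hz0, hz1]
      · rw [Function.update_of_ne h]; exact hy b
    · rw [mem_insert, not_or] at hb
      rw [Function.update_of_ne hb.1]; exact hyA b hb.2
    · rw [sum_insert ha, sum_insert ha, card_insert_of_notMem ha, Function.update_self,
        sum_congr rfl fun b hb => by rw [hne b hb],
        sum_congr (f := fun b => gain _ (Function.update y a z b)) rfl fun b hb => by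
          rw [hne b hb]]
      rw [add_assoc P] at hle
      push_cast
      linarith

/-- The degrees sum to N, so the initial value is 1-Lipschitz in the number of pins; its
sup-convolution gains at most the maximum `c / 4` of t - t²/c. -/
theorem supConv_empty_le [Nonempty ι] {Δ : ℕ} (hdΔ : ∀ j, X.varDeg j ≤ Δ) {c P : ℝ} (hc : 0 < c)
    (hP : P ≤ Fintype.card ι) :
    X.supConv c ∅ P ≤ ∑ j, (1 - P / Fintype.card ι) ^ X.varDeg j + Δ + c / 4 := by
  obtain ⟨Q, hQ, h⟩ := X.exists_supConv_eq c ∅ P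
  rw [used_empty, card_empty, zero_add] at hQ
  rw [h]
  have hN : (0 : ℝ) < Fintype.card ι := by exact_mod_cast Fintype.card_pos
  have h1 := (abs_le.1 (X.abs_mean_empty_sub_le hQ)).2
  have h2 := X.sum_varDeg_sq_div_le hdΔ
  have h3 : ∑ j, (1 - (Q : ℝ) / Fintype.card ι) ^ X.varDeg j ≤
      ∑ j, (1 - P / Fintype.card ι) ^ X.varDeg j + |P - Q| := by
    have e : |P - Q| = ∑ j, (X.varDeg j : ℝ) * (|P - Q| / Fintype.card ι) := by
      rw [← sum_mul]
      have : ∑ j, (X.varDeg j : ℝ) = Fintype.card ι := by exact_mod_cast X.sum_varDeg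
      rw [this]
      field_simp
    rw [e, ← sum_add_distrib]
    refine sum_le_sum fun j _ => pow_le_pow_add_mul ?_ ?_ ?_ (by positivity) ?_ _
    · rw [sub_nonneg, div_le_one hN]
      exact_mod_cast hQ
    · have : 0 ≤ (Q : ℝ) / Fintype.card ι := by positivity
      linarith
    · rw [sub_nonneg, div_le_one hN]
      exact hP
    · have : P / Fintype.card ι - Q / Fintype.card ι ≤ |P - Q| / Fintype.card ι := by
        rw [← sub_div]
        gcongr
        exact le_abs_self _
      linarith
  have h4 : |P - Q| ≤ (P - Q) ^ 2 / c + c / 4 := by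
    rw [← sq_abs, ← sub_nonneg]
    have : |P - Q| ^ 2 / c + c / 4 - |P - Q| = (|P - Q| - c / 2) ^ 2 / c := by
      field_simp; ring
    rw [this]
    positivity
  linarith

/-- Among all choices of parameters for the checks, a constant one maximizes the potential. -/
theorem exists_le_potential [Nonempty ι] (hk : ∀ a, 2 ≤ (X.block a).card) (y : Fin m → ℝ)
    (hy : ∀ a, 0 ≤ y a ∧ y a ≤ 1) :
    ∃ α : ℝ, 0 ≤ α ∧ α ≤ 1 ∧
      ∑ j, (1 - (∑ a, (X.block a).card * y a ^ ((X.block a).card - 1)) / Fintype.card ι) ^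
        X.varDeg j + ∑ a, gain (X.block a).card (y a) ≤ X.potential α := by
  set V : ℝ := ∑ a, (X.block a).card * y a ^ ((X.block a).card - 1) with hV
  have hcont : ContinuousOn
      (fun α : ℝ => ∑ a, ((X.block a).card : ℝ) * α ^ ((X.block a).card - 1)) (Set.Icc 0 1) := by
    fun_prop
  have h0 : ∑ a, ((X.block a).card : ℝ) * (0 : ℝ) ^ ((X.block a).card - 1) = 0 :=
    sum_eq_zero fun a _ => by
      rw [zero_pow (by have := hk a; omega), mul_zero]
  -- `α` keeps the total shift `V`. At 0 the shift vanishes, as all check degrees are at least 2; at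
  -- 1 it is maximal.
  obtain ⟨α, hα, hαV⟩ := intermediate_value_Icc zero_le_one hcont (show V ∈ Set.Icc _ _ from by
    simp only [h0, one_pow, mul_one]
    refine ⟨sum_nonneg fun a _ => mul_nonneg (Nat.cast_nonneg _) (pow_nonneg (hy a).1 _), ?_⟩
    exact sum_le_sum fun a _ => mul_le_of_le_one_right (Nat.cast_nonneg _)
      (pow_le_one₀ (hy a).1 (hy a).2))
  refine ⟨α, hα.1, hα.2, ?_⟩
  simp only at hαV
  rw [potential, hαV]
  refine add_le_add_right ?_ _
  -- The tangent of the power at `y a`, evaluated at `α`. The correction is proportional to the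
  -- change of the shift, and these changes sum to zero.
  have h1 : ∀ a, gain (X.block a).card (y a) ≤ gain (X.block a).card α +
      (1 - α) * ((X.block a).card * y a ^ ((X.block a).card - 1) -
        (X.block a).card * α ^ ((X.block a).card - 1)) := by
    intro a
    have h2 := tangent_le_pow hα.1 (hy a).1 (X.block a).card
    have e : α ^ (X.block a).card = α * α ^ ((X.block a).card - 1) := by
      rw [← pow_succ', Nat.sub_add_cancel (by have := hk a; omega)]
    rw [gain, gain]
    rw [e] at h2 ⊢
    linarith
  refine (sum_le_sum fun a _ => h1 a).trans ?_
  rw [sum_add_distrib, ← mul_sum, sum_sub_distrib, hαV, ← hV]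
  simp

theorem mean_le_potential [Nonempty ι] {Δ W T h : ℕ} (hW : 0 < W) (hT : 0 < T) (hm : h ≤ m)
    {c : ℝ} (hc : 0 < c) (hroom : √(c * n + 1) + W + T ≤ h)
    (hk : ∀ a, 2 ≤ (X.block a).card) (hkΔ : ∀ a, (X.block a).card ≤ Δ)
    (hdΔ : ∀ j, X.varDeg j ≤ Δ) :
    ∃ α : ℝ, 0 ≤ α ∧ α ≤ 1 ∧ X.mean univ 0 ≤ X.potential α + (h + Δ + c / 4 +
      m * stepError Δ (Fintype.card ι) W T c (√(c * n + 1))) := by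
  obtain ⟨A, hA, hAu⟩ := X.exists_card_add_card_used_le hm fun a => one_le_two.trans (hk a)
  have hmA := (X.mean_univ_bounds hA).1
  have hAu' : ((X.used A).card : ℝ) + h ≤ Fintype.card ι := by exact_mod_cast hAu
  obtain ⟨y, hy, hyA, hle⟩ := X.supConv_le hW hT hc hk hkΔ A 0 le_rfl (by linarith)
  have h1 := X.le_supConv c (A := A) 0 (Q := 0) (by omega)
  have e1 : ∑ a ∈ A, ((X.block a).card : ℝ) * y a ^ ((X.block a).card - 1) =
      ∑ a, ((X.block a).card : ℝ) * y a ^ ((X.block a).card - 1) :=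
    sum_subset (subset_univ _) fun a _ ha => by
      rw [hyA a ha, zero_pow (by have := hk a; omega), mul_zero]
  -- The checks left out have parameter 0, hence no shift and gain -1 each; restoring them costs
  -- exactly `h`.
  have e2 : ∑ a ∈ A, gain (X.block a).card (y a) = ∑ a, gain (X.block a).card (y a) + h := by
    rw [← sum_add_sum_compl A]
    have : ∑ a ∈ Aᶜ, gain (X.block a).card (y a) = ∑ a ∈ Aᶜ, (-1 : ℝ) :=
      sum_congr rfl fun a ha => by
        have := hk a
        rw [hyA a (by simpa using ha), gain, zero_pow (by omega), zero_pow (by omega)]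
        ring
    rw [this, sum_const, card_compl, Fintype.card_fin, show m - A.card = h by omega]
    simp
  obtain ⟨α, hα0, hα1, hα⟩ := X.exists_le_potential hk y hy
  refine ⟨α, hα0, hα1, ?_⟩
  rw [zero_add, e1, e2] at hle
  have hV : ∑ a, ((X.block a).card : ℝ) * y a ^ ((X.block a).card - 1) ≤ Fintype.card ι := by
    have : (Fintype.card ι : ℝ) = ∑ a, ((X.block a).card : ℝ) := by
      exact_mod_cast X.sum_card_block.symm
    rw [this]
    exact sum_le_sum fun a _ => mul_le_of_le_one_right (Nat.cast_nonneg _)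
      (pow_le_one₀ (hy a).1 (hy a).2)
  have h2 := X.supConv_empty_le hdΔ hc hV
  have hconc : 0 ≤ conc := by rw [conc]; positivity
  have hE : 0 ≤ stepError Δ (Fintype.card ι) W T c (√(c * n + 1)) := by
    rw [stepError]; positivity
  have h3 : A.card * stepError Δ (Fintype.card ι) W T c (√(c * n + 1)) ≤
      m * stepError Δ (Fintype.card ι) W T c (√(c * n + 1)) := by
    gcongr
    exact_mod_cast (by omega : A.card ≤ m)
  simp only [Nat.cast_zero, sub_zero, ne_eq, OfNat.ofNat_ne_zero, not_false_eq_true, zero_pow,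
    zero_div] at h1
  linarith

/-! ### Simple configurations -/

/-- The pairs of sockets of a common check that are matched with a common variable. -/
def conflicts (σ : Perm ι) : Finset (ι × ι) :=
  univ.filter fun p => p.1 ≠ p.2 ∧ X.chk p.1 = X.chk p.2 ∧ X.var (σ p.1) = X.var (σ p.2)

theorem mem_conflicts {σ : Perm ι} {p : ι × ι} : p ∈ X.conflicts σ ↔
    p.1 ≠ p.2 ∧ X.chk p.1 = X.chk p.2 ∧ X.var (σ p.1) = X.var (σ p.2) := by
  simp [conflicts]

theorem card_var_fiber_le {Δ : ℕ} (hd : ∀ j, X.varDeg j ≤ Δ) (σ : Perm ι) (j : Fin n) :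
    (univ.filter fun l => X.var (σ l) = j).card ≤ Δ := by
  refine le_trans (le_of_eq ?_) (hd j)
  rw [varDeg]
  refine card_bij (fun l _ => σ l) (by simp) (fun _ _ _ _ h => σ.injective h) fun t ht => ?_
  exact ⟨σ⁻¹ t, by simpa using ht, by simp⟩

/-- In a large configuration a conflict can be removed by a transposition. -/
theorem exists_swap_card_conflicts_lt {Δ : ℕ} (hk : ∀ a, (X.block a).card ≤ Δ)
    (hd : ∀ j, X.varDeg j ≤ Δ) (hN : Δ + 2 * Δ ^ 2 < Fintype.card ι) {σ : Perm ι}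
    (hσ : (X.conflicts σ).Nonempty) :
    ∃ i l, (X.conflicts (σ * swap i l)).card < (X.conflicts σ).card := by
  obtain ⟨⟨i, i'⟩, hii⟩ := hσ
  have hii' := X.mem_conflicts.1 hii
  -- The partner `l` must avoid the check of `i`, the variables already occurring at this check, and
  -- the checks that meet the variable of `i`. Then after the swap neither `i` nor `l` is in a
  -- conflict.
  set bad : Finset ι := X.block (X.chk i) ∪
    ((X.block (X.chk i)).biUnion fun p => univ.filter fun l => X.var (σ l) = X.var (σ p)) ∪
    ((univ.filter fun p => X.var (σ p) = X.var (σ i)).biUnion fun p => X.block (X.chk p)) with hbad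
  have hcard : bad.card ≤ Δ + 2 * Δ ^ 2 := by
    refine (card_union_le _ _).trans ?_
    have h1 : (X.block (X.chk i) ∪ ((X.block (X.chk i)).biUnion fun p =>
        univ.filter fun l => X.var (σ l) = X.var (σ p))).card ≤ Δ + Δ * Δ := by
      refine (card_union_le _ _).trans (Nat.add_le_add (hk _) ?_)
      exact (card_biUnion_le_card_mul _ _ Δ fun p _ => X.card_var_fiber_le hd σ _).trans
        (Nat.mul_le_mul_right _ (hk _))
    have h2 : ((univ.filter fun p => X.var (σ p) = X.var (σ i)).biUnion fun p =>
        X.block (X.chk p)).card ≤ Δ * Δ :=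
      (card_biUnion_le_card_mul _ _ Δ fun p _ => hk _).trans
        (Nat.mul_le_mul_right _ (X.card_var_fiber_le hd σ _))
    nlinarith
  obtain ⟨l, hl⟩ : ∃ l, l ∉ bad := by
    by_contra! h
    have : bad = univ := eq_univ_of_forall h
    rw [this, card_univ] at hcard
    omega
  simp only [hbad, mem_union, mem_biUnion, mem_block, mem_filter, mem_univ, true_and, not_or,
    not_exists, not_and] at hl
  obtain ⟨⟨hl1, hl2⟩, hl3⟩ := hl
  have hil : i ≠ l := fun h => hl1 (h ▸ rfl)
  refine ⟨i, l, card_lt_card ⟨fun p hp => ?_, fun h => ?_⟩⟩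
  · have hp' := X.mem_conflicts.1 hp
    rw [mem_conflicts]
    obtain ⟨p, q⟩ := p
    obtain ⟨hpq, hc, hv⟩ := hp'
    simp only [Perm.mul_apply] at hpq hc hv
    refine ⟨hpq, hc, ?_⟩
    -- neither `i` nor `l` is involved in a conflict any more
    have key : ∀ p q : ι, p ≠ q → X.chk p = X.chk q →
        X.var (σ (swap i l p)) = X.var (σ (swap i l q)) → p ≠ i ∧ p ≠ l := by
      intro p q hpq hc hv
      constructor
      · rintro rfl
        rw [swap_apply_left] at hv
        have hql : q ≠ l := by rintro rfl; exact hl1 hc.symm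
        rw [swap_apply_of_ne_of_ne hpq.symm hql] at hv
        exact hl2 q hc.symm hv
      · rintro rfl
        rw [swap_apply_right] at hv
        have hqi : q ≠ i := by rintro rfl; exact hl1 hc
        rw [swap_apply_of_ne_of_ne hqi hpq.symm] at hv
        exact hl3 q hv.symm hc
    have h1 := key p q hpq hc hv
    have h2 := key q p hpq.symm hc.symm hv.symm
    rwa [swap_apply_of_ne_of_ne h1.1 h1.2, swap_apply_of_ne_of_ne h2.1 h2.2] at hv
  · have h1 := X.mem_conflicts.1 (h hii)
    simp only [Perm.mul_apply] at h1
    rw [swap_apply_left] at h1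
    have hi'l : i' ≠ l := by rintro rfl; exact hl1 h1.2.1.symm
    rw [swap_apply_of_ne_of_ne hii'.1.symm hi'l] at h1
    exact hl2 i' h1.2.1.symm h1.2.2

/-- The configurations with at most `b` conflicts. -/
def fewConflicts (b : ℕ) : Finset (Perm ι) := univ.filter fun σ => (X.conflicts σ).card ≤ b

/-- Undoing the conflicts one at a time, each by one of at most N² transpositions. -/
theorem card_fewConflicts_le [Nonempty ι] {Δ : ℕ} (hk : ∀ a, (X.block a).card ≤ Δ)
    (hd : ∀ j, X.varDeg j ≤ Δ) (hN : Δ + 2 * Δ ^ 2 < Fintype.card ι) (b : ℕ) :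
    (X.fewConflicts b).card ≤ Fintype.card ι ^ (2 * b) * (X.fewConflicts 0).card := by
  induction b with
  | zero => simp
  | succ b ih =>
    have h1 : X.fewConflicts (b + 1) ⊆ (X.fewConflicts b ×ˢ (univ : Finset (ι × ι))).image
        fun x => x.1 * swap x.2.1 x.2.2 := by
      intro σ hσ
      rw [fewConflicts, mem_filter] at hσ
      rw [mem_image]
      by_cases h : (X.conflicts σ).card ≤ b
      · have i := Classical.arbitrary ι
        exact ⟨(σ, i, i), by simp [fewConflicts, h], by simp only [swap_self]; exact mul_one σ⟩
      · obtain ⟨i, l, hil⟩ := X.exists_swap_card_conflicts_lt hk hd hN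
          (card_pos.1 (by omega : 0 < (X.conflicts σ).card))
        refine ⟨(σ * swap i l, i, l), ?_, by simp [mul_assoc]⟩
        simp only [fewConflicts, mem_product, mem_filter, mem_univ, true_and, and_true]
        omega
    refine (card_le_card h1).trans (card_image_le.trans ?_)
    rw [card_product, card_univ, Fintype.card_prod]
    calc _ ≤ Fintype.card ι ^ (2 * b) * (X.fewConflicts 0).card *
          (Fintype.card ι * Fintype.card ι) := Nat.mul_le_mul_right _ ih
      _ = _ := by ring

/-- By symmetry all N - 1 partners of `i` are equally likely to share its variable, which has at
most `Δ` sockets. -/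
theorem expect_ind_var_eq_le {Δ : ℕ} (hd : ∀ j, X.varDeg j ≤ Δ) {i i' : ι} (h : i ≠ i') :
    ((Fintype.card ι : ℝ) - 1) * 𝔼 σ : Perm ι, ind (X.var (σ i) = X.var (σ i')) ≤ Δ := by
  have h1 : ∀ l ∈ univ.erase i, 𝔼 σ : Perm ι, ind (X.var (σ i) = X.var (σ i')) =
      𝔼 σ : Perm ι, ind (X.var (σ i) = X.var (σ l)) := by
    intro l hl
    have hl' := ne_of_mem_erase hl
    rw [← expect_mul_right _ (swap i' l)]
    refine expect_congr rfl fun σ _ => ?_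
    rw [Perm.mul_apply, Perm.mul_apply, swap_apply_left, swap_apply_of_ne_of_ne h hl'.symm]
  have h2 := sum_congr (s₁ := univ.erase i) rfl h1
  rw [sum_const, card_erase_of_mem (mem_univ i), card_univ, nsmul_eq_mul,
    Nat.cast_sub (Fintype.card_pos_iff.2 ⟨i⟩), Nat.cast_one, ← expect_sum_comm] at h2
  rw [h2]
  refine expect_le univ_nonempty fun σ _ => ?_
  have h3 : ∑ l ∈ univ.erase i, ind (X.var (σ i) = X.var (σ l)) ≤
      ∑ l, ind (X.var (σ i) = X.var (σ l)) :=
    sum_le_sum_of_subset_of_nonneg (subset_univ _) fun _ _ _ => ind_nonneg _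
  refine h3.trans ?_
  have h4 : ∑ l, ind (X.var (σ i) = X.var (σ l)) =
      (univ.filter fun l => X.var (σ l) = X.var (σ i)).card := by
    rw [← sum_boole]
    refine sum_congr rfl fun l _ => ?_
    split_ifs with h
    · exact ind_of h.symm
    · exact ind_of_not fun h' => h h'.symm
  rw [h4]
  exact_mod_cast X.card_var_fiber_le hd σ _

theorem expect_card_conflicts_le {Δ : ℕ} (hk : ∀ a, (X.block a).card ≤ Δ)
    (hd : ∀ j, X.varDeg j ≤ Δ) (hN : 2 ≤ Fintype.card ι) :
    𝔼 σ, ((X.conflicts σ).card : ℝ) ≤ 2 * (Δ : ℝ) ^ 2 := by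
  have hN' : (2 : ℝ) ≤ Fintype.card ι := by exact_mod_cast hN
  set P : Finset (ι × ι) := univ.filter fun p => p.1 ≠ p.2 ∧ X.chk p.1 = X.chk p.2 with hP
  have hPc : P.card ≤ Fintype.card ι * Δ := by
    have : P ⊆ (univ : Finset ι).biUnion fun i => (X.block (X.chk i)).image fun l => (i, l) := by
      intro p hp
      simp only [hP, mem_filter, mem_univ, true_and] at hp
      simp only [mem_biUnion, mem_univ, true_and, mem_image, mem_block]
      exact ⟨p.1, p.2, hp.2.symm, rfl⟩
    refine (card_le_card this).trans ((card_biUnion_le_card_mul _ _ Δ fun i _ =>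
      card_image_le.trans (hk _)).trans ?_)
    rw [card_univ]
  have h1 : ∀ σ, ((X.conflicts σ).card : ℝ) = ∑ p ∈ P, ind (X.var (σ p.1) = X.var (σ p.2)) := by
    intro σ
    have e : X.conflicts σ = P.filter fun p => X.var (σ p.1) = X.var (σ p.2) := by
      ext p; simp [conflicts, hP, and_assoc]
    rw [e, ← sum_boole]
    refine sum_congr rfl fun p _ => ?_
    split_ifs with h
    · exact (ind_of h).symm
    · exact (ind_of_not h).symm
  simp_rw [h1]
  rw [expect_sum_comm]
  have h2 : ∀ p ∈ P, 𝔼 σ : Perm ι, ind (X.var (σ p.1) = X.var (σ p.2)) ≤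
      Δ / (Fintype.card ι - 1) := by
    intro p hp
    simp only [hP, mem_filter, mem_univ, true_and] at hp
    rw [le_div_iff₀ (by linarith), mul_comm]
    exact X.expect_ind_var_eq_le hd hp.1
  refine (sum_le_card_nsmul P _ _ h2).trans ?_
  rw [nsmul_eq_mul]
  have hPc' : (P.card : ℝ) ≤ Fintype.card ι * Δ := by exact_mod_cast hPc
  have hpos : (0 : ℝ) < Fintype.card ι - 1 := by linarith
  calc _ ≤ (Fintype.card ι * Δ : ℝ) * (Δ / (Fintype.card ι - 1)) := by gcongr
    _ = (Fintype.card ι / (Fintype.card ι - 1)) * (Δ : ℝ) ^ 2 := by ring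
    _ ≤ _ := by
      gcongr
      rw [div_le_iff₀ hpos]
      linarith

/-- A random configuration is simple with at least polynomially small probability. -/
theorem card_simple_ge [Nonempty ι] {Δ : ℕ} (hΔ : 1 ≤ Δ) (hk : ∀ a, (X.block a).card ≤ Δ)
    (hd : ∀ j, X.varDeg j ≤ Δ) (hN : Δ + 2 * Δ ^ 2 < Fintype.card ι) :
    (2 * (Fintype.card ι : ℝ) ^ (8 * Δ ^ 2))⁻¹ * Fintype.card (Perm ι) ≤
      ((X.fewConflicts 0).card : ℝ) := by
  have hΔ2 : 1 ≤ Δ ^ 2 := Nat.one_le_pow _ _ hΔ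
  have h1 := X.expect_card_conflicts_le hk hd (by omega)
  have hG : (0 : ℝ) < Fintype.card (Perm ι) := by exact_mod_cast Fintype.card_pos
  have hNpos : (0 : ℝ) < Fintype.card ι := by exact_mod_cast Fintype.card_pos
  -- Markov's inequality at twice the bound on the mean number of conflicts.
  have h2 : (Fintype.card (Perm ι) : ℝ) / 2 ≤ (X.fewConflicts (4 * Δ ^ 2)).card := by
    rw [Fintype.expect_eq_sum_div_card, div_le_iff₀ hG] at h1
    have h3 : ((X.fewConflicts (4 * Δ ^ 2))ᶜ.card : ℝ) * (4 * Δ ^ 2) ≤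
        ∑ σ, ((X.conflicts σ).card : ℝ) := by
      rw [← nsmul_eq_mul]
      refine (card_nsmul_le_sum _ (fun σ => ((X.conflicts σ).card : ℝ)) _ fun σ hσ => ?_).trans
        (sum_le_sum_of_subset_of_nonneg (subset_univ _) fun _ _ _ => Nat.cast_nonneg _)
      simp only [fewConflicts, mem_compl, mem_filter, mem_univ, true_and, not_le] at hσ
      exact_mod_cast hσ.le
    have h4 : ((X.fewConflicts (4 * Δ ^ 2))ᶜ.card : ℝ) =
        Fintype.card (Perm ι) - (X.fewConflicts (4 * Δ ^ 2)).card := by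
      rw [card_compl, Nat.cast_sub (card_le_univ _)]
    rw [h4] at h3
    have h5 : (1 : ℝ) ≤ (Δ : ℝ) ^ 2 := by exact_mod_cast hΔ2
    have h6 := h3.trans h1
    nlinarith
  have h3 := X.card_fewConflicts_le hk hd hN (4 * Δ ^ 2)
  have h4 : ((X.fewConflicts (4 * Δ ^ 2)).card : ℝ) ≤
      (Fintype.card ι : ℝ) ^ (8 * Δ ^ 2) * (X.fewConflicts 0).card := by
    rw [show 8 * Δ ^ 2 = 2 * (4 * Δ ^ 2) by ring]
    exact_mod_cast h3
  rw [inv_mul_le_iff₀ (by positivity)]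
  linarith

/-- The density of the simple configurations enters only through its logarithm, so a polynomially
small one costs a factor of order log N. The bound is applied to the nullity and to its negative. -/
theorem abs_expect_simple_sub_mean_le [Nonempty ι] {Δ : ℕ} (hΔ : 1 ≤ Δ)
    (hk : ∀ a, (X.block a).card ≤ Δ) (hd : ∀ j, X.varDeg j ≤ Δ)
    (hN : Δ + 2 * Δ ^ 2 < Fintype.card ι) :
    |𝔼 σ ∈ X.fewConflicts 0, X.nullity σ univ ∅ - X.mean univ 0| ≤
      (32 + Real.log (2 * (Fintype.card ι : ℝ) ^ (8 * Δ ^ 2))) * √(Fintype.card ι) := by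
  have hNpos : (0 : ℝ) < Fintype.card ι := by exact_mod_cast Fintype.card_pos
  have hm : X.mean univ 0 = 𝔼 σ, X.nullity σ univ ∅ :=
    (X.expect_nullity (A := univ) (I := ∅) (disjoint_empty_left _)).symm
  have hs := X.card_simple_ge hΔ hk hd hN
  have h1 := expect_mem_sub_expect_perm_le (b := 4) (fun σ => X.nullity σ univ ∅)
    (X.abs_nullity_swap_mul_sub_le univ ∅) (X.fewConflicts 0) (by positivity) hs
  have h2 := expect_mem_sub_expect_perm_le (b := 4) (fun σ => -X.nullity σ univ ∅)
    (fun σ i j => by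
      rw [neg_sub_neg, abs_sub_comm]; exact X.abs_nullity_swap_mul_sub_le univ ∅ σ i j)
    (X.fewConflicts 0) (by positivity) hs
  rw [expect_neg_distrib, expect_neg_distrib] at h2
  rw [Real.log_inv] at h1 h2
  rw [hm, abs_le]
  norm_num at h1 h2 ⊢
  constructor <;> linarith

end Ensemble

/-- Two maps with fibres of the same sizes are related by a bijection. -/
theorem exists_equiv_of_card_fiber {α β γ : Type*} [Fintype α] [Fintype β] [DecidableEq γ]
    (f : α → γ) (g : β → γ)
    (h : ∀ c, (univ.filter fun x => f x = c).card = (univ.filter fun y => g y = c).card) :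
    ∃ e : α ≃ β, ∀ x, g (e x) = f x := by
  have e : ∀ c, Nonempty ({x // f x = c} ≃ {y // g y = c}) := fun c =>
    Fintype.card_eq.1 (by rw [Fintype.card_subtype, Fintype.card_subtype, h c])
  exact ⟨(sigmaFiberEquiv f).symm.trans
    ((Equiv.sigmaCongrRight fun c => (e c).some).trans (sigmaFiberEquiv g)),
    fun x => ((e (f x)).some ⟨x, rfl⟩).2⟩

namespace Ensemble

variable {ι F : Type*} [Fintype ι] [DecidableEq ι] [Field F] {m n : ℕ} (X : Ensemble ι F m n)

/-! ### Tanner graphs and simple configurations -/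

theorem mem_simple {σ : Perm ι} : σ ∈ X.fewConflicts 0 ↔
    ∀ i i', X.chk i = X.chk i' → X.var (σ i) = X.var (σ i') → i = i' := by
  simp only [fewConflicts, nonpos_iff_eq_zero, card_eq_zero, mem_filter, mem_univ, true_and]
  constructor
  · intro h i i' hc hv
    by_contra hne
    have : (i, i') ∈ X.conflicts σ := X.mem_conflicts.2 ⟨hne, hc, hv⟩
    simp [h] at this
  · intro h
    rw [eq_empty_iff_forall_notMem]
    intro p hp
    rw [mem_conflicts] at hp
    exact hp.1 (h _ _ hp.2.1 hp.2.2)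

/-- The Tanner graph of a configuration. -/
def edges (σ : Perm ι) : Finset (Fin m × Fin n) := univ.image fun i => (X.chk i, X.var (σ i))

theorem mem_edges {σ : Perm ι} {e : Fin m × Fin n} :
    e ∈ X.edges σ ↔ ∃ i, X.chk i = e.1 ∧ X.var (σ i) = e.2 := by
  simp [edges, Prod.ext_iff]

theorem edges_mem_tannerGraphs {σ : Perm ι} (hσ : σ ∈ X.fewConflicts 0) :
    X.edges σ ∈ tannerGraphs X.varDeg fun a => (X.block a).card := by
  rw [mem_simple] at hσ
  have hinj : Function.Injective fun i => (X.chk i, X.var (σ i)) := fun i i' h =>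
    hσ i i' (congrArg Prod.fst h) (congrArg Prod.snd h)
  simp only [tannerGraphs, mem_filter, mem_univ, true_and]
  constructor
  · intro a
    rw [edges, filter_image, card_image_of_injective _ hinj]
    rfl
  · intro j
    rw [edges, filter_image, card_image_of_injective _ hinj, varDeg]
    refine card_bij (fun l _ => σ l) (by simp) (fun _ _ _ _ h => σ.injective h) fun t ht => ?_
    exact ⟨σ⁻¹ t, by simpa using ht, by simp⟩

/-- Label the edges at each check by its sockets, and likewise at each variable; composing the two
labellings through the edge set gives the permutation. -/
theorem exists_simple_of_mem_tannerGraphs {E : Finset (Fin m × Fin n)}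
    (hE : E ∈ tannerGraphs X.varDeg fun a => (X.block a).card) :
    ∃ σ ∈ X.fewConflicts 0, X.edges σ = E := by
  simp only [tannerGraphs, mem_filter, mem_univ, true_and] at hE
  obtain ⟨φ, hφ⟩ := exists_equiv_of_card_fiber X.chk (fun e : E => e.1.1) (by
    intro a
    refine (hE.1 a).symm.trans ?_
    rw [← card_map (Function.Embedding.subtype fun e => e ∈ E)]
    congr 1
    ext e
    simp only [mem_filter, Finset.mem_map, mem_univ, true_and, Function.Embedding.subtype_apply,
      Subtype.exists, exists_and_left, exists_prop, exists_eq_right_right]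
    exact and_comm)
  obtain ⟨ψ, hψ⟩ := exists_equiv_of_card_fiber X.var (fun e : E => e.1.2) (by
    intro a
    refine (hE.2 a).symm.trans ?_
    rw [← card_map (Function.Embedding.subtype fun e => e ∈ E)]
    congr 1
    ext e
    simp only [mem_filter, Finset.mem_map, mem_univ, true_and, Function.Embedding.subtype_apply,
      Subtype.exists, exists_and_left, exists_prop, exists_eq_right_right]
    exact and_comm)
  have hv : ∀ i, X.var ((φ.trans ψ.symm) i) = (φ i).1.2 := fun i => by
    rw [← hψ]; simp
  refine ⟨φ.trans ψ.symm, ?_, ?_⟩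
  · rw [mem_simple]
    intro i i' hc h
    rw [hv, hv] at h
    rw [← hφ, ← hφ] at hc
    exact φ.injective (Subtype.ext (Prod.ext hc h))
  · ext e
    rw [mem_edges]
    constructor
    · rintro ⟨i, h1, h2⟩
      rw [hv] at h2
      rw [← hφ] at h1
      have : (φ i).1 = e := Prod.ext h1 h2
      rw [← this]
      exact (φ i).2
    · intro he
      refine ⟨φ.symm ⟨e, he⟩, ?_, ?_⟩
      · rw [← hφ]; simp
      · rw [hv]; simp

/-- All Tanner graphs arise from the same number of simple configurations. -/
theorem card_fiber_edges {σ₀ : Perm ι} (h₀ : σ₀ ∈ X.fewConflicts 0) :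
    ((X.fewConflicts 0).filter fun σ => X.edges σ = X.edges σ₀).card =
      (univ.filter fun ρ : Perm ι => ∀ i, X.chk (ρ i) = X.chk i).card *
        (univ.filter fun τ : Perm ι => ∀ t, X.var (τ t) = X.var t).card := by
  rw [← card_product]
  rw [mem_simple] at h₀
  symm
  -- Permuting sockets within checks and within variables keeps the graph; for a simple `σ₀` this
  -- action is free and transitive on the fibre.
  refine card_nbij (fun x => x.2 * σ₀ * x.1) ?_ ?_ ?_
  · rintro ⟨ρ, τ⟩ h
    simp only [coe_product, Set.mem_prod, mem_coe, mem_filter, mem_univ, true_and] at h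
    obtain ⟨hρ, hτ⟩ := h
    rw [mem_coe, mem_filter, mem_simple]
    have hv : ∀ i, X.var ((τ * σ₀ * ρ) i) = X.var (σ₀ (ρ i)) := fun i => by
      simp [Perm.mul_apply, hτ]
    constructor
    · intro i i' hc h
      simp only [hv] at h
      rw [← hρ i, ← hρ i'] at hc
      exact ρ.injective (h₀ _ _ hc h)
    · ext e
      simp only [mem_edges, hv]
      constructor
      · rintro ⟨i, h1, h2⟩
        exact ⟨ρ i, by rw [hρ, h1], h2⟩
      · rintro ⟨i, h1, h2⟩
        refine ⟨ρ⁻¹ i, ?_, ?_⟩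
        · rw [← hρ]; simpa using h1
        · simpa using h2
  · rintro ⟨ρ, τ⟩ h ⟨ρ', τ'⟩ h' heq
    simp only [coe_product, Set.mem_prod, coe_filter, mem_univ, true_and, Set.mem_ofPred_eq] at h h'
    simp only at heq
    have hρ : ρ = ρ' := by
      ext i
      refine h₀ _ _ ?_ ?_
      · rw [h.1, h'.1]
      · have h1 := congrArg (fun σ : Perm ι => X.var (σ i)) heq
        simpa [Perm.mul_apply, h.2, h'.2] using h1
    subst hρ
    have := mul_right_cancel (mul_right_cancel heq)
    rw [this]
  · intro σ hσ
    rw [mem_coe, mem_filter, mem_simple] at hσ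
    obtain ⟨hs, he⟩ := hσ
    -- `ρ i` will be the socket at which `σ₀` realizes the edge that `σ` realizes at `i`.
    have hex : ∀ i, ∃ l, X.chk l = X.chk i ∧ X.var (σ₀ l) = X.var (σ i) := by
      intro i
      have : (X.chk i, X.var (σ i)) ∈ X.edges σ₀ := by
        rw [← he, mem_edges]; exact ⟨i, rfl, rfl⟩
      exact X.mem_edges.1 this
    choose ρ hρ1 hρ2 using hex
    have hinj : Function.Injective ρ := fun i i' h => hs i i'
      (by rw [← hρ1, ← hρ1 i', h]) (by rw [← hρ2, ← hρ2 i', h])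
    set r := Equiv.ofBijective ρ (Finite.injective_iff_bijective.1 hinj) with hr
    have hrr : ∀ i, r i = ρ i := fun i => rfl
    refine ⟨(r, σ * r⁻¹ * σ₀⁻¹), ?_, by simp [mul_assoc]⟩
    simp only [coe_product, Set.mem_prod, coe_filter, mem_univ, true_and, Set.mem_ofPred_eq]
    refine ⟨hρ1, fun t => ?_⟩
    have h1 := hρ2 (r⁻¹ (σ₀⁻¹ t))
    rw [← hrr] at h1
    simp only [Perm.mul_apply]
    rw [← h1]
    simp

/-- The map from simple configurations to Tanner graphs is onto with fibres of constant size `K`, so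
it carries the uniform distribution to the uniform one. -/
theorem expect_tannerGraphs_eq (g : Finset (Fin m × Fin n) → ℝ) :
    𝔼 E ∈ tannerGraphs X.varDeg (fun a => (X.block a).card), g E =
      𝔼 σ ∈ X.fewConflicts 0, g (X.edges σ) := by
  set K := (univ.filter fun ρ : Perm ι => ∀ i, X.chk (ρ i) = X.chk i).card *
        (univ.filter fun τ : Perm ι => ∀ t, X.var (τ t) = X.var t).card with hK
  have hK0 : K ≠ 0 := by
    refine mul_ne_zero (card_pos.2 ⟨1, by simp⟩).ne' (card_pos.2 ⟨1, by simp⟩).ne'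
  set T := tannerGraphs X.varDeg fun a => (X.block a).card with hT
  have hfib : ∀ E ∈ T, ((X.fewConflicts 0).filter fun σ => X.edges σ = E).card = K := by
    intro E hE
    obtain ⟨σ₀, h₀, rfl⟩ := X.exists_simple_of_mem_tannerGraphs hE
    exact X.card_fiber_edges h₀
  have hmaps : ∀ σ ∈ X.fewConflicts 0, X.edges σ ∈ T := fun σ hσ => X.edges_mem_tannerGraphs hσ
  have hsum : ∀ g : Finset (Fin m × Fin n) → ℝ,
      ∑ σ ∈ X.fewConflicts 0, g (X.edges σ) = K * ∑ E ∈ T, g E := by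
    intro g
    rw [← sum_fiberwise_of_maps_to hmaps, mul_sum]
    refine sum_congr rfl fun E hE => ?_
    rw [← hfib E hE, ← nsmul_eq_mul, ← sum_const]
    exact sum_congr rfl fun σ hσ => by rw [(mem_filter.1 hσ).2]
  have hcard := hsum fun _ => 1
  simp only [sum_const, nsmul_eq_mul, mul_one] at hcard
  have hK0' : (K : ℝ) ≠ 0 := by exact_mod_cast hK0
  rw [expect_eq_sum_div_card, expect_eq_sum_div_card, hsum, hcard, mul_div_mul_left _ _ hK0']

theorem row_apply {σ : Perm ι} (hσ : σ ∈ X.fewConflicts 0) (a : Fin m) (j : Fin n) :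
    X.row σ a j = if (a, j) ∈ X.edges σ then (X.coef (a, j) : F) else 0 := by
  rw [mem_simple] at hσ
  simp only [row, unit, Finset.sum_apply, Pi.smul_apply, smul_eq_mul, Pi.single_apply]
  split_ifs with h
  · obtain ⟨i, h1, h2⟩ := X.mem_edges.1 h
    simp only at h1 h2
    rw [sum_eq_single_of_mem i (X.mem_block.2 h1)]
    · simp [h2]
    · intro i' hi' hne
      rw [if_neg, mul_zero]
      intro h3
      exact hne (hσ i' i (by rw [X.mem_block.1 hi', h1]) (by rw [h2, h3]))
  · refine sum_eq_zero fun i hi => ?_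
    rw [if_neg, mul_zero]
    intro h3
    exact h (X.mem_edges.2 ⟨i, X.mem_block.1 hi, h3.symm⟩)

theorem nul_eq_nullity {σ : Perm ι} (hσ : σ ∈ X.fewConflicts 0) (δ : Fin n → ℕ) (κ : Fin m → ℕ) :
    ((Sample.mk m δ κ X.coef (X.edges σ)).nul : ℝ) = X.nullity σ univ ∅ := by
  set ω : Sample F n := Sample.mk m δ κ X.coef (X.edges σ)
  have h1 := LinearMap.finrank_range_add_finrank_ker ω.matrix.mulVecLin
  rw [Module.finrank_fin_fun] at h1
  have h2 : Module.finrank F (LinearMap.range ω.matrix.mulVecLin) =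
      Module.finrank F (X.space σ univ ∅) := by
    have h3 := ω.matrix.rank_eq_finrank_span_row
    rw [Matrix.rank] at h3
    have h4 : ∀ a, ω.matrix a = X.row σ a := by
      intro a
      ext j
      rw [X.row_apply hσ]
      simp [Sample.matrix, ω]
    have h5 : Set.range ω.matrix.row =
        X.row σ '' (univ : Finset (Fin m)) ∪ X.unit σ '' (∅ : Finset ι) := by
      ext x
      simp only [coe_univ, Set.image_univ, coe_empty, Set.image_empty, Set.union_empty]
      constructor
      · rintro ⟨a, rfl⟩; exact ⟨a, (h4 a).symm⟩
      · rintro ⟨a, rfl⟩; exact ⟨a, h4 a⟩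
    rw [h3, space, h5]
  have h6 : (Module.finrank F (LinearMap.range ω.matrix.mulVecLin) : ℝ) +
      Module.finrank F (LinearMap.ker ω.matrix.mulVecLin) = n := by exact_mod_cast h1
  rw [Sample.nul, nullity, ← h2]
  linarith

end Ensemble

namespace Ensemble

/-! ### Asymptotics -/

theorem conc_nonneg : 0 ≤ conc := by rw [conc]; positivity

theorem sqrt_mul_add_one_le {g n : ℝ} (hg : 0 ≤ g) (hn : 0 ≤ n) :
    √(g ^ 2 * n * n + 1) ≤ g * n + 1 := by
  rw [Real.sqrt_le_left (by positivity)]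
  nlinarith [mul_nonneg hg hn]

theorem sqrt_card_le {Δ N s : ℝ} (hΔ : 1 ≤ Δ) (hN : N ≤ Δ * (16 * s ^ 4)) :
    √N ≤ 4 * Δ * s ^ 2 := by
  rw [Real.sqrt_le_left (by positivity)]
  have : 0 ≤ Δ * (16 * s ^ 4) * (Δ - 1) := by
    have : 0 ≤ Δ - 1 := by linarith
    positivity
  nlinarith

/-- Here s is of order n^(1/4), with W = s, T = s³ and c = g² n. Then √N/T, W/T and T/c are all
O(1/s): T dominates the fluctuations of order s² but is small against c. -/
theorem stepError_le {Δ N n s g : ℝ} (hΔ : 1 ≤ Δ) (hs : 1 ≤ s) (hg : 0 < g) (hn : s ^ 4 ≤ n)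
    (hN : N ≤ Δ * (16 * s ^ 4)) :
    stepError Δ N s (s ^ 3) (g ^ 2 * n) (√(g ^ 2 * n * n + 1)) ≤
      (2 * Δ ^ 2 + 8 * Δ ^ 2 * conc + Δ * (2 * (1 / g + 1 / g ^ 2) + 4 / g ^ 2 + 2) +
        Δ ^ 2 / g ^ 2) / s := by
  have hs0 : 0 < s := by linarith
  have hn1 : 1 ≤ n := (one_le_pow₀ hs).trans hn
  have hn0 : 0 < n := by linarith
  have hc := conc_nonneg
  have hs12 : s ≤ s ^ 2 := le_self_pow₀ hs (by norm_num)
  have hs13 : s ≤ s ^ 3 := le_self_pow₀ hs (by norm_num)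
  have hs14 : s ≤ s ^ 4 := le_self_pow₀ hs (by norm_num)
  have h1 : Δ ^ 2 / s ^ 3 ≤ Δ ^ 2 / s := by gcongr
  have h2 : 2 * (conc * √N) / s ^ 3 ≤ 8 * Δ * conc / s := by
    have := sqrt_card_le hΔ hN
    calc _ ≤ 2 * (conc * (4 * Δ * s ^ 2)) / s ^ 3 := by gcongr
      _ = _ := by field_simp; ring
  have hρ : 2 * √(g ^ 2 * n * n + 1) / (g ^ 2 * n) ≤ 2 * (1 / g + 1 / g ^ 2) := by
    have h3 := sqrt_mul_add_one_le hg.le hn0.le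
    calc _ ≤ 2 * (g * n + 1) / (g ^ 2 * n) := by gcongr
      _ = 2 * (1 / g + 1 / (g ^ 2 * n)) := by field_simp
      _ ≤ _ := by
        gcongr
        nlinarith [sq_nonneg g]
  have h4 : (s * (2 * √(g ^ 2 * n * n + 1) / (g ^ 2 * n)) + (s + s ^ 3) ^ 2 / (g ^ 2 * n) + s + 1) /
      s ^ 3 ≤ (2 * (1 / g + 1 / g ^ 2) + 4 / g ^ 2 + 2) / s := by
    have a1 : s * (2 * √(g ^ 2 * n * n + 1) / (g ^ 2 * n)) / s ^ 3 ≤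
        2 * (1 / g + 1 / g ^ 2) / s := by
      calc _ ≤ s * (2 * (1 / g + 1 / g ^ 2)) / s ^ 3 := by gcongr
        _ = 2 * (1 / g + 1 / g ^ 2) / s ^ 2 := by field_simp
        _ ≤ _ := by gcongr
    have a2 : (s + s ^ 3) ^ 2 / (g ^ 2 * n) / s ^ 3 ≤ 4 / g ^ 2 / s := by
      calc _ ≤ (s ^ 3 + s ^ 3) ^ 2 / (g ^ 2 * s ^ 4) / s ^ 3 := by gcongr
        _ = _ := by field_simp; ring
    have a3 : (s + 1) / s ^ 3 ≤ 2 / s := by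
      calc _ ≤ (s + s) / s ^ 3 := by gcongr
        _ = 2 / s ^ 2 := by field_simp; ring
        _ ≤ _ := by gcongr
    calc _ = s * (2 * √(g ^ 2 * n * n + 1) / (g ^ 2 * n)) / s ^ 3 +
          (s + s ^ 3) ^ 2 / (g ^ 2 * n) / s ^ 3 + (s + 1) / s ^ 3 := by ring
      _ ≤ 2 * (1 / g + 1 / g ^ 2) / s + 4 / g ^ 2 / s + 2 / s := by linarith
      _ = _ := by ring
  have h5 : Δ ^ 2 / (g ^ 2 * n) ≤ Δ ^ 2 / g ^ 2 / s := by
    rw [div_div]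
    have : s ≤ n := hs14.trans hn
    gcongr
  rw [stepError]
  calc _ ≤ Δ ^ 2 / s + Δ ^ 2 / s + Δ * (8 * Δ * conc / s) +
        Δ * ((2 * (1 / g + 1 / g ^ 2) + 4 / g ^ 2 + 2) / s) + Δ ^ 2 / g ^ 2 / s := by gcongr
    _ = _ := by ring

/-- Since log N = O(s) and √N = O(s²), the error is O(s³), hence O(n/s). -/
theorem transferError_le {Δ N n s : ℝ} {K : ℕ} (hΔ : 1 ≤ Δ) (hs : 1 ≤ s) (hn : s ^ 4 ≤ n)
    (hN1 : 1 ≤ N) (hN : N ≤ Δ * (16 * s ^ 4)) :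
    (32 + Real.log (2 * N ^ K)) * √N ≤ (33 + K * (16 * Δ + 4)) * (4 * Δ) / s * n := by
  have hs0 : 0 < s := by linarith
  have h1 : Real.log N ≤ 16 * Δ + 4 * s := by
    have h2 : Real.log N ≤ Real.log (Δ * (16 * s ^ 4)) := Real.log_le_log (by linarith) hN
    have h3 : Real.log (Δ * (16 * s ^ 4)) = Real.log (16 * Δ) + 4 * Real.log s := by
      rw [show Δ * (16 * s ^ 4) = 16 * Δ * s ^ 4 by ring, Real.log_mul (by positivity)
        (by positivity), Real.log_pow]
      norm_num
    have h4 := Real.log_le_sub_one_of_pos (by positivity : 0 < 16 * Δ)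
    have h5 := Real.log_le_sub_one_of_pos hs0
    linarith
  have h6 : 32 + Real.log (2 * N ^ K) ≤ (33 + K * (16 * Δ + 4)) * s := by
    rw [Real.log_mul (by norm_num) (by positivity), Real.log_pow]
    have h7 := Real.log_two_lt_d9
    have h8 : (K : ℝ) * Real.log N ≤ K * ((16 * Δ + 4) * s) := by
      gcongr
      nlinarith
    nlinarith
  have h9 := sqrt_card_le hΔ hN
  calc _ ≤ (33 + K * (16 * Δ + 4)) * s * (4 * Δ * s ^ 2) := by gcongr
    _ = (33 + K * (16 * Δ + 4)) * (4 * Δ) / s * s ^ 4 := by field_simp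
    _ ≤ _ := by gcongr

set_option maxHeartbeats 1600000 in
/-- For large `n`, the average nullity over the simple configurations is close to the maximum of the
potential. -/
theorem exists_bounds (F : Type*) [Field F] {Δ : ℕ} (hΔ : 1 ≤ Δ) {ε : ℝ} (hε : 0 < ε) :
    ∃ n₀ : ℕ, ∀ n ≥ n₀, ∀ (m : ℕ) (ι : Type) [Fintype ι] [DecidableEq ι] (X : Ensemble ι F m n),
      (∀ a, 2 ≤ (X.block a).card) → (∀ a, (X.block a).card ≤ Δ) →
      (∀ j, 1 ≤ X.varDeg j) → (∀ j, X.varDeg j ≤ Δ) →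
      (X.fewConflicts 0).Nonempty ∧
      (∀ α : ℝ, 0 ≤ α → α ≤ 1 →
        X.potential α - ε * n ≤ 𝔼 σ ∈ X.fewConflicts 0, X.nullity σ univ ∅) ∧
      ∃ α : ℝ, 0 ≤ α ∧ α ≤ 1 ∧
        𝔼 σ ∈ X.fewConflicts 0, X.nullity σ univ ∅ ≤ X.potential α + ε * n := by
  have hΔ' : (1 : ℝ) ≤ Δ := by exact_mod_cast hΔ
  set ε' := min ε 1 with hε'
  have hε'0 : 0 < ε' := lt_min hε one_pos
  -- Leaving out about `η * n` checks costs at most `ε' / 4 * n`. The choice `g = η / 4` lets the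
  -- localization radius, at most `g * n + 1`, fit into the freed room and keeps the regularization
  -- cost `c / 4` below `ε' / 4 * n`. Everything else is O(n/s).
  set η := ε' / (4 * (Δ + 1)) with hη
  have hη0 : 0 < η := by positivity
  have hηε : η * (Δ + 1) = ε' / 4 := by rw [hη]; field_simp
  have hε'1 : ε' ≤ 1 := min_le_right _ _
  have hηle : η ≤ ε' / 4 := by rw [← hηε]; exact le_mul_of_one_le_right hη0.le (by linarith)
  have hηΔ : η * Δ ≤ 1 := by linarith
  set g := η / 4 with hg
  have hgle : g ^ 2 / 4 ≤ ε' / 4 := by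
    have : g ^ 2 ≤ g := by
      rw [sq]
      exact mul_le_of_le_one_left (by positivity) (by linarith)
    linarith
  have hg0 : 0 < g := by positivity
  set C₁ : ℝ := (2 * (Δ : ℝ) ^ 2 + 8 * (Δ : ℝ) ^ 2 * conc +
    Δ * (2 * (1 / g + 1 / g ^ 2) + 4 / g ^ 2 + 2) + (Δ : ℝ) ^ 2 / g ^ 2) with hC₁
  set C₂ : ℝ := (33 + (8 * Δ ^ 2 : ℕ) * (16 * Δ + 4)) * (4 * Δ) with hC₂
  have hC₁0 : 0 ≤ C₁ := by have := conc_nonneg; positivity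
  have hC₂0 : 0 ≤ C₂ := by positivity
  set C : ℝ := C₁ * Δ + C₂ + Δ + 2 * Δ ^ 3 + 1 with hC
  have hC0 : 0 < C := by positivity
  obtain ⟨S, hS⟩ := exists_nat_ge (max (max (8 / η) (4 * C / ε')) (Δ + 2 * Δ ^ 2 + 1 : ℕ))
  have hS1 : 8 / η ≤ S := ((le_max_left _ _).trans (le_max_left _ _)).trans hS
  have hS2 : 4 * C / ε' ≤ S := ((le_max_right _ _).trans (le_max_left _ _)).trans hS
  have hS3 : Δ + 2 * Δ ^ 2 + 1 ≤ S := by exact_mod_cast (le_max_right _ _).trans hS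
  refine ⟨S ^ 4, fun n hn m ι _ _ X hk hkΔ hd hdΔ => ?_⟩
  set s := Nat.sqrt (Nat.sqrt n) with hs
  have hsS : S ≤ s := by
    rw [hs, Nat.le_sqrt, Nat.le_sqrt]
    calc _ = S ^ 4 := by ring
      _ ≤ n := hn
  have hs4 : s ^ 4 ≤ n := by
    calc s ^ 4 = (s * s) * (s * s) := by ring
      _ ≤ Nat.sqrt n * Nat.sqrt n := Nat.mul_le_mul (Nat.sqrt_le _) (Nat.sqrt_le _)
      _ ≤ n := Nat.sqrt_le _
  have hs1 : 1 ≤ s := by omega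
  -- Rounding down the fourth root costs at most a factor (1 + 1/s)^4 ≤ 16.
  have hs16 : n ≤ 16 * s ^ 4 := by
    have h1 : Nat.sqrt n + 1 ≤ (s + 1) * (s + 1) := Nat.lt_succ_sqrt _
    have h2 : n < (Nat.sqrt n + 1) * (Nat.sqrt n + 1) := Nat.lt_succ_sqrt n
    calc n ≤ ((s + 1) * (s + 1)) * ((s + 1) * (s + 1)) := h2.le.trans (Nat.mul_le_mul h1 h1)
      _ ≤ ((s + s) * (s + s)) * ((s + s) * (s + s)) := by gcongr
      _ = _ := by ring
  have hs1' : (1 : ℝ) ≤ s := by exact_mod_cast hs1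
  have hs0' : (0 : ℝ) < s := by linarith
  have hs4' : (s : ℝ) ^ 4 ≤ n := by exact_mod_cast hs4
  have hs16' : (n : ℝ) ≤ 16 * s ^ 4 := by exact_mod_cast hs16
  have hsS' : (S : ℝ) ≤ s := by exact_mod_cast hsS
  have hsn : (s : ℝ) ≤ n := (le_self_pow₀ hs1' (by norm_num)).trans hs4'
  have hn0 : (0 : ℝ) < n := by linarith
  -- the number of sockets and of checks
  have hNn : n ≤ Fintype.card ι := by
    rw [← X.sum_varDeg]
    simpa using sum_le_sum fun j (_ : j ∈ (univ : Finset (Fin n))) => hd j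
  have hNΔ : Fintype.card ι ≤ Δ * n := by
    rw [← X.sum_varDeg]
    simpa [mul_comm] using sum_le_sum fun j (_ : j ∈ (univ : Finset (Fin n))) => hdΔ j
  have hmN : m ≤ Fintype.card ι := by
    rw [← X.sum_card_block]
    simpa using sum_le_sum fun a (_ : a ∈ (univ : Finset (Fin m))) => one_le_two.trans (hk a)
  have hNm : Fintype.card ι ≤ m * Δ := by
    rw [← X.sum_card_block]
    simpa using sum_le_sum fun a (_ : a ∈ (univ : Finset (Fin m))) => hkΔ a
  have hmΔ : (m : ℝ) ≤ Δ * n := by exact_mod_cast hmN.trans hNΔ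
  have hnm : (n : ℝ) ≤ m * Δ := by exact_mod_cast hNn.trans hNm
  have hN1 : (1 : ℝ) ≤ Fintype.card ι := by
    have : (n : ℝ) ≤ Fintype.card ι := by exact_mod_cast hNn
    linarith
  have hN16 : (Fintype.card ι : ℝ) ≤ Δ * (16 * s ^ 4) := by
    have : (Fintype.card ι : ℝ) ≤ Δ * n := by exact_mod_cast hNΔ
    exact this.trans (by gcongr)
  have : Nonempty ι := Fintype.card_pos_iff.1 (by
    have : 0 < Fintype.card ι := by exact_mod_cast (by linarith : (0 : ℝ) < Fintype.card ι)
    exact this)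
  have hNbig : Δ + 2 * Δ ^ 2 < Fintype.card ι := by
    have : s ≤ n := by exact_mod_cast hsn
    omega
  -- the number of checks left out
  set h := ⌊η * n⌋₊ with hh
  have hhle : (h : ℝ) ≤ η * n := Nat.floor_le (by positivity)
  have hhge : η * n - 1 ≤ h := (Nat.sub_one_lt_floor _).le
  have hηs : 8 ≤ η * s := by
    have := hS1.trans hsS'
    rw [div_le_iff₀ hη0] at this
    linarith
  have hhm : h ≤ m := by
    have : (h : ℝ) ≤ m := by
      calc (h : ℝ) ≤ η * n := hhle
        _ ≤ η * (m * Δ) := by gcongr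
        _ = η * Δ * m := by ring
        _ ≤ 1 * m := by gcongr
        _ = m := one_mul _
    exact_mod_cast this
  have hroom : √(g ^ 2 * n * n + 1) + s + (s ^ 3 : ℕ) ≤ h := by
    have h1 := sqrt_mul_add_one_le hg0.le hn0.le
    have h2 : (s : ℝ) ≤ s ^ 3 := le_self_pow₀ hs1' (by norm_num)
    have h3 : 8 * (s : ℝ) ^ 3 ≤ η * n := by
      calc 8 * (s : ℝ) ^ 3 ≤ η * s * s ^ 3 := by gcongr
        _ = η * s ^ 4 := by ring
        _ ≤ _ := by gcongr
    have h4 : 8 ≤ η * n := hηs.trans (by gcongr)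
    push_cast
    rw [hg] at h1 ⊢
    linarith
  have hs3 : 0 < s ^ 3 := by positivity
  have hεs : C / s ≤ ε' / 4 := by
    rw [div_le_iff₀ hs0']
    have := hS2.trans hsS'
    rw [div_le_iff₀ hε'0] at this
    linarith
  have hCn : C / s * n ≤ ε' / 4 * n := by gcongr
  have hCsplit : C / s * n = C₁ * Δ / s * n + C₂ / s * n + Δ * (n / s) + 2 * Δ ^ 3 / s * n +
      n / s := by rw [hC]; ring
  have hns : (1 : ℝ) ≤ n / s := by rw [le_div_iff₀ hs0']; linarith
  have hsns : (s : ℝ) ≤ n / s := by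
    rw [le_div_iff₀ hs0']
    calc (s : ℝ) * s = s ^ 2 := by ring
      _ ≤ s ^ 4 := pow_le_pow_right₀ hs1' (by norm_num)
      _ ≤ n := hs4'
  have hp1 : 0 ≤ C₁ * Δ / s * n := by positivity
  have hp2 : 0 ≤ C₂ / s * n := by positivity
  have hp3 : (Δ : ℝ) ≤ Δ * (n / s) := le_mul_of_one_le_right (by positivity) hns
  have hp4 : 0 ≤ 2 * (Δ : ℝ) ^ 3 / s * n := by positivity
  have hεε : ε' * n ≤ ε * n := by
    have : ε' ≤ ε := min_le_left _ _
    gcongr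
  have htr := X.abs_expect_simple_sub_mean_le hΔ hkΔ hdΔ hNbig
  have htr' := htr.trans (transferError_le hΔ' hs1' hs4' hN1 hN16)
  rw [← hC₂, abs_le] at htr'
  refine ⟨?_, fun α hα hα1 => ?_, ?_⟩
  · have h1 := X.card_simple_ge hΔ hkΔ hdΔ hNbig
    have hG : (0 : ℝ) < Fintype.card (Perm ι) := by exact_mod_cast Fintype.card_pos
    have h2 : (0 : ℝ) < (X.fewConflicts 0).card := lt_of_lt_of_le (by positivity) h1
    exact card_pos.1 (by exact_mod_cast h2)
  · have hWT : s + s ^ 3 ≤ h := by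
      have : (s : ℝ) + (s ^ 3 : ℕ) ≤ h := by linarith [Real.sqrt_nonneg (g ^ 2 * n * n + 1)]
      exact_mod_cast this
    have h1 := X.potential_le_mean hs1 hs3 hWT hhm (fun a => one_le_two.trans (hk a)) hkΔ hd hdΔ
      hα hα1
    have h2 : m * ((Δ : ℝ) ^ 2 / s + (Δ : ℝ) ^ 2 / (s ^ 3 : ℕ)) ≤ 2 * (Δ : ℝ) ^ 3 / s * n := by
      have h3 : (Δ : ℝ) ^ 2 / (s ^ 3 : ℕ) ≤ (Δ : ℝ) ^ 2 / s := by
        push_cast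
        gcongr
        exact le_self_pow₀ hs1' (by norm_num)
      calc _ ≤ (Δ * n : ℝ) * ((Δ : ℝ) ^ 2 / s + (Δ : ℝ) ^ 2 / s) := by gcongr
        _ = _ := by ring
    have h4 : (h : ℝ) * (Δ + 1) ≤ ε' / 4 * n := by
      calc (h : ℝ) * (Δ + 1) ≤ η * n * (Δ + 1) := by gcongr
        _ = η * (Δ + 1) * n := by ring
        _ = _ := by rw [hηε]
    linarith [htr'.1]
  · obtain ⟨α, hα0, hα1, h1⟩ := X.mean_le_potential (Δ := Δ) hs1 hs3 hhm
      (c := g ^ 2 * n) (by positivity) hroom hk hkΔ hdΔ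
    refine ⟨α, hα0, hα1, ?_⟩
    have h2 := stepError_le (N := Fintype.card ι) hΔ' hs1' hg0 hs4' hN16
    rw [← hC₁] at h2
    have h3 : m * stepError Δ (Fintype.card ι) s (s ^ 3 : ℕ) (g ^ 2 * n)
        (√(g ^ 2 * n * n + 1)) ≤ C₁ * Δ / s * n := by
      push_cast
      calc _ ≤ (m : ℝ) * (C₁ / s) := by gcongr
        _ ≤ Δ * n * (C₁ / s) := by gcongr
        _ = _ := by ring
    have h4 : (h : ℝ) ≤ ε' / 4 * n := by
      refine hhle.trans ?_
      gcongr
    have h5 : g ^ 2 * n / 4 ≤ ε' / 4 * n := by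
      calc g ^ 2 * n / 4 = g ^ 2 / 4 * n := by ring
        _ ≤ _ := by gcongr
    linarith [htr'.2]

end Ensemble

/-! ### Ensembles with given degrees -/

theorem card_filter_sigma_fst {n : ℕ} (δ : Fin n → ℕ) (j : Fin n) :
    (univ.filter fun t : Σ j, Fin (δ j) => t.1 = j).card = δ j := by
  rw [← Fintype.card_subtype, Fintype.card_congr (Equiv.sigmaSubtype j), Fintype.card_fin]

/-- There is an ensemble with prescribed degrees and coefficients. -/
theorem exists_ensemble {F : Type*} [Field F] {m n : ℕ} (δ : Fin n → ℕ) (κ : Fin m → ℕ)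
    (χ : Fin m × Fin n → Fˣ) (h : ∑ j, δ j = ∑ a, κ a) :
    ∃ X : Ensemble (Σ j, Fin (δ j)) F m n, X.coef = χ ∧ X.varDeg = δ ∧
      (fun a => (X.block a).card) = κ := by
  have e : (Σ a, Fin (κ a)) ≃ Σ j, Fin (δ j) := Fintype.equivOfCardEq (by simp [h])
  refine ⟨⟨Sigma.fst, fun t => (e.symm t).1, χ⟩, rfl, ?_, ?_⟩
  · funext j
    exact card_filter_sigma_fst δ j
  · funext a
    rw [← card_filter_sigma_fst κ a]
    exact card_bij (fun t _ => e.symm t) (by simp [Ensemble.block])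
      (fun _ _ _ _ h => e.symm.injective h) fun t ht => ⟨e t, by simpa [Ensemble.block] using ht,
        by simp⟩

/-- The potential in terms of the degree sequences. -/
noncomputable def degPotential {m n : ℕ} (δ : Fin n → ℕ) (κ : Fin m → ℕ) (α : ℝ) : ℝ :=
  ∑ j, (1 - (∑ a, (κ a : ℝ) * α ^ (κ a - 1)) / (∑ j, δ j : ℕ)) ^ δ j + ∑ a, gain (κ a) α

/-- For large `n`, uniformly over the degree sequences and the coefficients, the average nullity
over the Tanner graphs is close to the maximum of the potential. -/
theorem exists_tannerGraphs_bounds (F : Type*) [Field F] {Δ : ℕ} (hΔ : 1 ≤ Δ) {ε : ℝ} (hε : 0 < ε) :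
    ∃ n₀ : ℕ, ∀ n ≥ n₀, ∀ (m : ℕ) (δ : Fin n → ℕ) (κ : Fin m → ℕ),
      ∑ j, δ j = ∑ a, κ a → (∀ a, 2 ≤ κ a) → (∀ a, κ a ≤ Δ) → (∀ j, 1 ≤ δ j) → (∀ j, δ j ≤ Δ) →
      (tannerGraphs δ κ).Nonempty ∧ ∀ χ : Fin m × Fin n → Fˣ,
      (∀ α : ℝ, 0 ≤ α → α ≤ 1 → degPotential δ κ α - ε * n ≤
        𝔼 E ∈ tannerGraphs δ κ, ((Sample.mk m δ κ χ E).nul : ℝ)) ∧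
      ∃ α : ℝ, 0 ≤ α ∧ α ≤ 1 ∧
        𝔼 E ∈ tannerGraphs δ κ, ((Sample.mk m δ κ χ E).nul : ℝ) ≤ degPotential δ κ α + ε * n := by
  obtain ⟨n₀, h₀⟩ := Ensemble.exists_bounds F hΔ hε
  refine ⟨n₀, fun n hn m δ κ hsum hk hkΔ hd hdΔ => ?_⟩
  have key : ∀ χ : Fin m × Fin n → Fˣ, (tannerGraphs δ κ).Nonempty ∧
      (∀ α : ℝ, 0 ≤ α → α ≤ 1 → degPotential δ κ α - ε * n ≤
        𝔼 E ∈ tannerGraphs δ κ, ((Sample.mk m δ κ χ E).nul : ℝ)) ∧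
      ∃ α : ℝ, 0 ≤ α ∧ α ≤ 1 ∧
        𝔼 E ∈ tannerGraphs δ κ, ((Sample.mk m δ κ χ E).nul : ℝ) ≤
          degPotential δ κ α + ε * n := by
    intro χ
    obtain ⟨X, hχ, hδ, hκ⟩ := exists_ensemble δ κ χ hsum
    have hκ' : ∀ a, (X.block a).card = κ a := fun a => congrFun hκ a
    have hδ' : ∀ j, X.varDeg j = δ j := fun j => congrFun hδ j
    have hpot : ∀ α, X.potential α = degPotential δ κ α := by
      intro α
      rw [Ensemble.potential, degPotential]
      simp only [hκ', hδ', Fintype.card_sigma, Fintype.card_fin]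
    have hexp : 𝔼 E ∈ tannerGraphs δ κ, ((Sample.mk m δ κ χ E).nul : ℝ) =
        𝔼 σ ∈ X.fewConflicts 0, X.nullity σ univ ∅ := by
      have := X.expect_tannerGraphs_eq fun E => ((Sample.mk m δ κ χ E).nul : ℝ)
      rw [hκ, hδ] at this
      rw [this]
      refine expect_congr rfl fun σ hσ => ?_
      rw [← hχ]
      exact X.nul_eq_nullity hσ δ κ
    obtain ⟨⟨σ, hσ⟩, h1, h2⟩ := h₀ n hn m _ X (by simpa only [hκ']) (by simpa only [hκ'])
      (by simpa only [hδ']) (by simpa only [hδ'])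
    rw [hexp]
    simp only [← hpot]
    refine ⟨⟨X.edges σ, ?_⟩, h1, h2⟩
    have := X.edges_mem_tannerGraphs hσ
    rwa [hκ, hδ] at this
  exact ⟨(key fun _ => 1).1, fun χ => (key χ).2⟩

/-! ### The potential of exact degree sequences -/

theorem tsum_pmf_mul {p : PMF ℕ} (hp : p.support.Finite) (g : ℕ → ℝ) :
    ∑' l, (p l).toReal * g l = ∑ l ∈ hp.toFinset, (p l).toReal * g l := by
  refine tsum_eq_sum fun l hl => ?_
  rw [Set.Finite.mem_toFinset, PMF.mem_support_iff, not_not] at hl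
  simp [hl]

theorem sum_toReal_pmf {p : PMF ℕ} (hp : p.support.Finite) :
    ∑ l ∈ hp.toFinset, (p l).toReal = 1 := by
  rw [← ENNReal.toReal_sum fun l _ => p.apply_ne_top l, ← ENNReal.toReal_one, ← p.tsum_coe]
  congr 1
  refine (tsum_eq_sum fun l hl => ?_).symm
  rwa [Set.Finite.mem_toFinset, PMF.mem_support_iff, not_not] at hl

/-- `f` takes every value `l` exactly `s P[l]` times, where `P` has law `p`. -/
def ExactCounts {s : ℕ} (p : PMF ℕ) (f : Fin s → ℕ) : Prop :=
  ∀ l : ℕ, ((univ.filter fun i => f i = l).card : ℝ) = s * (p l).toReal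

theorem ExactCounts.mem_support {s : ℕ} {p : PMF ℕ} {f : Fin s → ℕ} (h : ExactCounts p f)
    (i : Fin s) : f i ∈ p.support := by
  rw [PMF.mem_support_iff]
  intro h0
  have h1 := h (f i)
  rw [h0, ENNReal.toReal_zero, mul_zero, Nat.cast_eq_zero, card_eq_zero] at h1
  have : i ∈ univ.filter fun i' => f i' = f i := by simp
  simp [h1] at this

theorem ExactCounts.sum_eq {s : ℕ} {p : PMF ℕ} {f : Fin s → ℕ} (h : ExactCounts p f)
    (hp : p.support.Finite) (g : ℕ → ℝ) :
    ∑ i, g (f i) = s * ∑ l ∈ hp.toFinset, (p l).toReal * g l := by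
  rw [← sum_fiberwise_of_maps_to (t := hp.toFinset) (g := f)
    fun i _ => by rw [Set.Finite.mem_toFinset]; exact h.mem_support i, mul_sum]
  refine sum_congr rfl fun l _ => ?_
  rw [← mul_assoc, ← h l, ← nsmul_eq_mul, ← sum_const]
  exact sum_congr rfl fun i hi => by rw [(mem_filter.1 hi).2]

/-- The prescribed counts add up to `s` because the probabilities add up to 1. -/
theorem exists_exactCounts {s : ℕ} {p : PMF ℕ} (hp : p.support.Finite)
    (h : ∀ l : ℕ, ∃ a : ℕ, (s : ℝ) * (p l).toReal = a) : ∃ f : Fin s → ℕ, ExactCounts p f := by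
  choose a ha using h
  have hcard : Fintype.card (Σ l : hp.toFinset, Fin (a l)) = s := by
    rw [Fintype.card_sigma]
    simp only [Fintype.card_fin]
    rw [sum_coe_sort hp.toFinset a]
    have : ((∑ l ∈ hp.toFinset, a l : ℕ) : ℝ) = s := by
      push_cast
      simp only [← ha]
      rw [← mul_sum, sum_toReal_pmf hp, mul_one]
    exact_mod_cast this
  have e : Fin s ≃ Σ l : hp.toFinset, Fin (a l) := Fintype.equivOfCardEq (by rw [hcard]; simp)
  refine ⟨fun i => (e i).1, fun l => ?_⟩
  rw [ha, Nat.cast_inj]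
  by_cases hl : l ∈ hp.toFinset
  · calc _ = (univ.filter fun t : Σ l : hp.toFinset, Fin (a l) => t.1 = ⟨l, hl⟩).card :=
          card_bij (fun i _ => e i) (by simp [Subtype.ext_iff]) (fun _ _ _ _ h => e.injective h)
            fun t ht => ⟨e.symm t, by simpa [Subtype.ext_iff] using ht, by simp⟩
      _ = a l := by
        rw [← Fintype.card_subtype,
          Fintype.card_congr (Equiv.sigmaSubtype (⟨l, hl⟩ : hp.toFinset)), Fintype.card_fin]
  · have h0 := ha l
    rw [Set.Finite.mem_toFinset, PMF.mem_support_iff, not_not] at hl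
    rw [hl, ENNReal.toReal_zero, mul_zero] at h0
    have h1 : a l = 0 := by exact_mod_cast h0.symm
    rw [h1, card_eq_zero, filter_eq_empty_iff]
    intro i _ hi
    have := (e i).1.2
    rw [Set.Finite.mem_toFinset, PMF.mem_support_iff] at this
    exact this ((congrArg p hi).trans hl)

theorem mean_eq_sum {p : PMF ℕ} (hp : p.support.Finite) :
    mean p = ∑ l ∈ hp.toFinset, (p l).toReal * l := tsum_pmf_mul hp _

theorem pgf_eq_sum {p : PMF ℕ} (hp : p.support.Finite) (x : ℝ) :
    pgf p x = ∑ l ∈ hp.toFinset, (p l).toReal * x ^ l := tsum_pmf_mul hp _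

theorem deriv_pgf_eq_sum {p : PMF ℕ} (hp : p.support.Finite) (x : ℝ) :
    deriv (pgf p) x = ∑ l ∈ hp.toFinset, (p l).toReal * (l * x ^ (l - 1)) := by
  rw [show pgf p = fun x => ∑ l ∈ hp.toFinset, (p l).toReal * x ^ l from
    funext fun x => pgf_eq_sum hp x]
  exact (HasDerivAt.fun_sum fun l _ => (hasDerivAt_pow l x).const_mul _).deriv

theorem one_le_mean {p : PMF ℕ} (hp : p.support.Finite) (h : ∀ j ∈ p.support, 1 ≤ j) :
    1 ≤ mean p := by
  rw [mean_eq_sum hp, ← sum_toReal_pmf hp]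
  refine sum_le_sum fun l hl => le_mul_of_one_le_right ENNReal.toReal_nonneg ?_
  exact_mod_cast h l (hp.mem_toFinset.1 hl)

theorem continuous_Phi {pd pk : PMF ℕ} (hdb : pd.support.Finite) (hkb : pk.support.Finite) :
    Continuous (Phi pd pk) := by
  have : Phi pd pk = fun α => pgf pd (1 - deriv (pgf pk) α / mean pk) +
    mean pd / mean pk * (pgf pk α + (1 - α) * deriv (pgf pk) α - 1) := rfl
  rw [this]
  simp only [pgf_eq_sum hdb, pgf_eq_sum hkb, deriv_pgf_eq_sum hkb]
  fun_prop

theorem ExactCounts.sum_gain {s : ℕ} {p : PMF ℕ} {f : Fin s → ℕ} (h : ExactCounts p f)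
    (hp : p.support.Finite) (α : ℝ) :
    ∑ i, gain (f i) α = s * (pgf p α + (1 - α) * deriv (pgf p) α - 1) := by
  rw [h.sum_eq hp fun l => gain l α, pgf_eq_sum hp, deriv_pgf_eq_sum hp]
  congr 1
  nth_rw 2 [← sum_toReal_pmf hp]
  rw [mul_sum, ← sum_add_distrib, ← sum_sub_distrib]
  refine sum_congr rfl fun l _ => ?_
  rw [gain]
  rcases l with _ | l
  · simp
  · simp only [Nat.add_sub_cancel, pow_succ]
    ring

theorem ExactCounts.sum_cast {s : ℕ} {p : PMF ℕ} {f : Fin s → ℕ} (h : ExactCounts p f)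
    (hp : p.support.Finite) : ((∑ i, f i : ℕ) : ℝ) = s * mean p := by
  push_cast
  rw [h.sum_eq hp fun l => (l : ℝ), mean_eq_sum hp]

/-- With m = dn/k the total shift divided by the number of sockets is K'(α)/k, and the gains sum to
the second term of `Phi` times `n`. -/
theorem degPotential_eq {pd pk : PMF ℕ} (hdb : pd.support.Finite) (hkb : pk.support.Finite)
    (hd : ∀ j ∈ pd.support, 1 ≤ j) (hk : ∀ j ∈ pk.support, 1 ≤ j) {m n : ℕ} (hn : 0 < n)
    {δ : Fin n → ℕ} {κ : Fin m → ℕ} (hδ : ExactCounts pd δ) (hκ : ExactCounts pk κ)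
    (hm : (m : ℝ) = mean pd * n / mean pk) (α : ℝ) :
    degPotential δ κ α = n * Phi pd pk α := by
  have h1 := one_le_mean hdb hd
  have h2 := one_le_mean hkb hk
  have hn' : (0 : ℝ) < n := by exact_mod_cast hn
  rw [degPotential, Phi, hκ.sum_gain hkb, hδ.sum_cast hdb,
    hκ.sum_eq hkb fun l => (l : ℝ) * α ^ (l - 1), ← deriv_pgf_eq_sum hkb]
  have h3 : (m : ℝ) * deriv (pgf pk) α / (n * mean pd) = deriv (pgf pk) α / mean pk := by
    rw [hm]
    field_simp
  rw [h3, hδ.sum_eq hdb fun l => (1 - deriv (pgf pk) α / mean pk) ^ l, ← pgf_eq_sum hdb, hm]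
  ring

/-- For large `n`, uniformly over the exact degree sequences and the coefficients, the average
nullity over the Tanner graphs is close to `n` times the maximum of `Phi`. -/
theorem exists_exactCounts_bounds (F : Type*) [Field F] {pd pk : PMF ℕ} (hdb : pd.support.Finite)
    (hkb : pk.support.Finite) (hd : ∀ j ∈ pd.support, 1 ≤ j) (hk : ∀ j ∈ pk.support, 2 ≤ j)
    {M : ℝ} (hM : IsGreatest (Phi pd pk '' Set.Icc 0 1) M) {ε : ℝ} (hε : 0 < ε) :
    ∃ n₀ : ℕ, ∀ n ≥ n₀, 0 < n → ∀ (m : ℕ) (δ : Fin n → ℕ) (κ : Fin m → ℕ),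
      ExactCounts pd δ → ExactCounts pk κ → (m : ℝ) = mean pd * n / mean pk →
      ∑ j, δ j = ∑ a, κ a ∧ (tannerGraphs δ κ).Nonempty ∧ ∀ χ : Fin m × Fin n → Fˣ,
      (M - ε) * n ≤ 𝔼 E ∈ tannerGraphs δ κ, ((Sample.mk m δ κ χ E).nul : ℝ) ∧
      𝔼 E ∈ tannerGraphs δ κ, ((Sample.mk m δ κ χ E).nul : ℝ) ≤ (M + ε) * n := by
  obtain ⟨Δ, hΔ⟩ := (hdb.union hkb).bddAbove
  obtain ⟨n₀, h₀⟩ := exists_tannerGraphs_bounds F (le_max_left 1 Δ) hε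
  refine ⟨n₀, fun n hn hn0 m δ κ hδ hκ hm => ?_⟩
  have hk1 : ∀ j ∈ pk.support, 1 ≤ j := fun j hj => one_le_two.trans (hk j hj)
  have hsum : ∑ j, δ j = ∑ a, κ a := by
    have h2 := one_le_mean hkb hk1
    have : ((∑ j, δ j : ℕ) : ℝ) = (∑ a, κ a : ℕ) := by
      rw [hδ.sum_cast hdb, hκ.sum_cast hkb, hm]
      field_simp
    exact_mod_cast this
  obtain ⟨hne, hb⟩ := h₀ n hn m δ κ hsum (fun a => hk _ (hκ.mem_support a))
    (fun a => (hΔ (Or.inr (hκ.mem_support a))).trans (le_max_right _ _))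
    (fun j => hd _ (hδ.mem_support j))
    (fun j => (hΔ (Or.inl (hδ.mem_support j))).trans (le_max_right _ _))
  refine ⟨hsum, hne, fun χ => ?_⟩
  obtain ⟨hl, α, hα0, hα1, hu⟩ := hb χ
  have hpot := degPotential_eq hdb hkb hd hk1 hn0 hδ hκ hm
  constructor
  · obtain ⟨β, ⟨hβ0, hβ1⟩, hβ⟩ := hM.1
    have := hl β hβ0 hβ1
    rw [hpot, hβ] at this
    linarith
  · rw [hpot] at hu
    have : Phi pd pk α ≤ M := hM.2 ⟨α, ⟨hα0, hα1⟩, rfl⟩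
    have : n * Phi pd pk α ≤ n * M := by gcongr
    linarith

end LDPC

end

section

open Finset
open scoped BigOperators

namespace LDPC

/-! ### Averages over the random matrix model -/

theorem tsum_bind_mul {α β : Type*} (p : PMF α) (f : α → PMF β) (g : β → ℝ≥0∞) :
    ∑' b, p.bind f b * g b = ∑' a, p a * ∑' b, f a b * g b := by
  simp only [PMF.bind_apply, ← ENNReal.tsum_mul_right, ← ENNReal.tsum_mul_left]
  rw [ENNReal.tsum_comm]
  simp only [mul_assoc]

theorem tsum_pure_mul {β : Type*} (b : β) (g : β → ℝ≥0∞) :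
    ∑' x, PMF.pure b x * g x = g b := by
  rw [tsum_eq_single b fun x hx => by simp [PMF.pure_apply, hx]]
  simp

theorem tsum_map_mul {α β : Type*} (p : PMF α) (f : α → β) (g : β → ℝ≥0∞) :
    ∑' b, p.map f b * g b = ∑' a, p a * g (f a) := by
  rw [PMF.map, tsum_bind_mul]
  simp only [Function.comp_apply, tsum_pure_mul]

theorem tsum_bind_mul_mono {α β : Type*} (p : PMF α) (f : α → PMF β) {g g' : β → ℝ≥0∞}
    (h : ∀ a, ∑' b, f a b * g b ≤ ∑' b, f a b * g' b) :
    ∑' b, p.bind f b * g b ≤ ∑' b, p.bind f b * g' b := by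
  rw [tsum_bind_mul, tsum_bind_mul]
  exact ENNReal.tsum_le_tsum fun a => mul_le_mul_right (h a) _

theorem tsum_graphPMF_mul {m n : ℕ} {δ : Fin n → ℕ} {κ : Fin m → ℕ}
    (h : (tannerGraphs δ κ).Nonempty) {f : Finset (Fin m × Fin n) → ℝ} (hf : ∀ E, 0 ≤ f E) :
    ∑' E, graphPMF δ κ E * ENNReal.ofReal (f E) =
      ENNReal.ofReal (𝔼 E ∈ tannerGraphs δ κ, f E) := by
  have hc : (0 : ℝ) < (tannerGraphs δ κ).card := by exact_mod_cast card_pos.2 h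
  rw [graphPMF, dif_pos h, tsum_eq_sum (s := tannerGraphs δ κ) fun E hE => by
    rw [PMF.uniformOfFinset_apply_of_notMem h hE, zero_mul]]
  rw [expect_eq_sum_div_card, div_eq_inv_mul, ENNReal.ofReal_mul (by positivity),
    ENNReal.ofReal_sum_of_nonneg fun E _ => hf E, mul_sum, ENNReal.ofReal_inv_of_pos hc,
    ENNReal.ofReal_natCast]
  exact sum_congr rfl fun E hE => by rw [PMF.uniformOfFinset_apply_of_mem h hE]

variable {F : Type*} [Field F]

theorem countable_sample [Finite F] (n : ℕ) : Countable (Sample F n) := by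
  let φ : Sample F n → Σ m : ℕ, (Fin n → ℕ) × (Fin m → ℕ) × (Fin m × Fin n → Fˣ) ×
      Finset (Fin m × Fin n) := fun ω => ⟨ω.m, ω.varDeg, ω.chkDeg, ω.chi, ω.edges⟩
  have hφ : Function.Injective φ := by
    rintro ⟨m, δ, κ, χ, E⟩ ⟨m', δ', κ', χ', E'⟩ h
    obtain ⟨rfl, h⟩ := Sigma.mk.inj_iff.1 h
    simp only [heq_eq_eq, Prod.mk.injEq] at h
    obtain ⟨rfl, rfl, rfl, rfl⟩ := h
    rfl
  exact hφ.countable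

theorem measurableSet_sample {n : ℕ} (s : Set (Sample F n)) : MeasurableSet s := trivial

theorem setLIntegral_sampleLaw [Finite F] (pd pk : PMF ℕ) (pχ : PMF Fˣ) {n : ℕ}
    (s : Set (Sample F n)) (g : Sample F n → ℝ≥0∞) :
    ∫⁻ ω in s, g ω ∂(sampleLaw pd pk pχ n).toMeasure =
      ∑' ω, sampleLaw pd pk pχ n ω * s.indicator g ω := by
  have := countable_sample (F := F) n
  have : MeasurableSingletonClass (Sample F n) := ⟨fun _ => trivial⟩
  rw [← lintegral_indicator (measurableSet_sample s), lintegral_countable']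
  refine tsum_congr fun ω => ?_
  rw [PMF.toMeasure_apply_singleton _ _ (measurableSet_sample _), mul_comm]

/-- The graph is drawn last, so averages may be compared for fixed degrees and coefficients. -/
theorem tsum_sampleLaw_mul_mono [Finite F] (pd pk : PMF ℕ) (pχ : PMF Fˣ) {n : ℕ}
    {g g' : Sample F n → ℝ≥0∞}
    (h : ∀ m (δ : Fin n → ℕ) (κ : Fin m → ℕ) χ,
      ∑' E, graphPMF δ κ E * g ⟨m, δ, κ, χ, E⟩ ≤ ∑' E, graphPMF δ κ E * g' ⟨m, δ, κ, χ, E⟩) :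
    ∑' ω, sampleLaw pd pk pχ n ω * g ω ≤ ∑' ω, sampleLaw pd pk pχ n ω * g' ω := by
  refine tsum_bind_mul_mono _ _ fun m => tsum_bind_mul_mono _ _ fun δ =>
    tsum_bind_mul_mono _ _ fun κ => tsum_bind_mul_mono _ _ fun χ => ?_
  rw [tsum_map_mul, tsum_map_mul]
  exact h m δ κ χ

theorem mem_exactDegrees {pd pk : PMF ℕ} {m n : ℕ} {δ : Fin n → ℕ} {κ : Fin m → ℕ}
    {χ : Fin m × Fin n → Fˣ} {E : Finset (Fin m × Fin n)} :
    (⟨m, δ, κ, χ, E⟩ : Sample F n) ∈ exactDegrees F pd pk n ↔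
      (m : ℝ) = mean pd * n / mean pk ∧ ExactCounts pd δ ∧ ExactCounts pk κ := Iff.rfl

theorem iidPMF_apply_ne_zero {ι α : Type*} [Fintype ι] [Countable α] {p : PMF α} {x : ι → α}
    (h : ∀ i, x i ∈ p.support) : iidPMF ι p x ≠ 0 :=
  prod_ne_zero_iff.2 fun i _ => (p.mem_support_iff _).1 (h i)

/-- Exact degree sequences with a Tanner graph have positive probability. -/
theorem sampleLaw_exactDegrees_ne_zero [Finite F] {pd pk : PMF ℕ} (pχ : PMF Fˣ)
    {m n : ℕ} (hpos : 0 < mean pd * n / mean pk) {δ : Fin n → ℕ} {κ : Fin m → ℕ}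
    (hδ : ExactCounts pd δ) (hκ : ExactCounts pk κ) (hm : (m : ℝ) = mean pd * n / mean pk)
    (hG : (tannerGraphs δ κ).Nonempty) :
    (sampleLaw pd pk pχ n).toMeasure (exactDegrees F pd pk n) ≠ 0 := by
  obtain ⟨c, hc⟩ := pχ.support_nonempty
  obtain ⟨E, hE⟩ := id hG
  rw [Ne, PMF.toMeasure_apply_eq_zero_iff _ (measurableSet_sample _), Set.not_disjoint_iff]
  refine ⟨⟨m, δ, κ, fun _ => c, E⟩, ?_, mem_exactDegrees.2 ⟨hm, hδ, hκ⟩⟩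
  rw [sampleLaw, PMF.mem_support_bind_iff]
  refine ⟨m, ?_, ?_⟩
  · rw [PMF.mem_support_iff]
    change poissonMeasure _ {m} ≠ 0
    rw [poissonMeasure_singleton]
    have : 0 < Real.toNNReal (mean pd * n / mean pk) := Real.toNNReal_pos.2 hpos
    exact (ENNReal.ofReal_pos.2 (by positivity)).ne'
  rw [PMF.mem_support_bind_iff]
  refine ⟨δ, iidPMF_apply_ne_zero hδ.mem_support, ?_⟩
  rw [PMF.mem_support_bind_iff]
  refine ⟨κ, iidPMF_apply_ne_zero hκ.mem_support, ?_⟩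
  rw [PMF.mem_support_bind_iff]
  refine ⟨fun _ => c, iidPMF_apply_ne_zero fun _ => hc, ?_⟩
  rw [PMF.support_map]
  refine ⟨E, ?_, rfl⟩
  rw [graphPMF, dif_pos hG]
  exact (PMF.mem_support_uniformOfFinset_iff hG E).2 hE

theorem Sample.nul_le {n : ℕ} (ω : Sample F n) : ω.nul ≤ n := by
  have := Submodule.finrank_le (LinearMap.ker ω.matrix.mulVecLin)
  rwa [Module.finrank_fin_fun] at this

/-- A uniform bound on the average nullity given the degrees and the coefficients bounds the
conditional expectation of the nullity given exact degrees. -/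
theorem integral_nul_cond_bounds [Finite F] {pd pk : PMF ℕ} {pχ : PMF Fˣ} {n : ℕ} {lo hi : ℝ}
    (hhi : 0 ≤ hi)
    (hne : (sampleLaw pd pk pχ n).toMeasure (exactDegrees F pd pk n) ≠ 0)
    (h : ∀ (m : ℕ) (δ : Fin n → ℕ) (κ : Fin m → ℕ),
      ExactCounts pd δ → ExactCounts pk κ → (m : ℝ) = mean pd * n / mean pk →
      (tannerGraphs δ κ).Nonempty ∧ ∀ χ : Fin m × Fin n → Fˣ,
      lo ≤ 𝔼 E ∈ tannerGraphs δ κ, ((Sample.mk m δ κ χ E).nul : ℝ) ∧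
      𝔼 E ∈ tannerGraphs δ κ, ((Sample.mk m δ κ χ E).nul : ℝ) ≤ hi) :
    lo ≤ ∫ ω, (ω.nul : ℝ) ∂((sampleLaw pd pk pχ n).toMeasure[|exactDegrees F pd pk n]) ∧
      ∫ ω, (ω.nul : ℝ) ∂((sampleLaw pd pk pχ n).toMeasure[|exactDegrees F pd pk n]) ≤ hi := by
  set μ := (sampleLaw pd pk pχ n).toMeasure with hμ
  set D := exactDegrees F pd pk n with hD
  have hgraph : ∀ (m : ℕ) (δ : Fin n → ℕ) (κ : Fin m → ℕ) (χ : Fin m × Fin n → Fˣ),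
      ExactCounts pd δ → ExactCounts pk κ → (m : ℝ) = mean pd * n / mean pk →
      ENNReal.ofReal lo ≤ ∑' E, graphPMF δ κ E * ENNReal.ofReal (Sample.mk m δ κ χ E).nul ∧
      ∑' E, graphPMF δ κ E * ENNReal.ofReal (Sample.mk m δ κ χ E).nul ≤ ENNReal.ofReal hi := by
    intro m δ κ χ hδ hκ hm
    obtain ⟨hG, hχ⟩ := h m δ κ hδ hκ hm
    rw [tsum_graphPMF_mul hG fun E => Nat.cast_nonneg _]
    exact ⟨ENNReal.ofReal_le_ofReal (hχ χ).1, ENNReal.ofReal_le_ofReal (hχ χ).2⟩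
  have hconst : ∀ (m : ℕ) (δ : Fin n → ℕ) (κ : Fin m → ℕ) (c : ℝ≥0∞),
      ∑' E, graphPMF δ κ E * c = c := fun m δ κ c => by
    rw [ENNReal.tsum_mul_right, PMF.tsum_coe, one_mul]
  have hlo : ENNReal.ofReal lo * μ D ≤ ∫⁻ ω in D, ENNReal.ofReal ω.nul ∂μ := by
    rw [← setLIntegral_const, setLIntegral_sampleLaw, setLIntegral_sampleLaw]
    refine tsum_sampleLaw_mul_mono _ _ _ fun m δ κ χ => ?_
    -- Membership in `D` does not depend on the graph, so the indicator is constant in the inner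
    -- sum.
    by_cases hmem : (m : ℝ) = mean pd * n / mean pk ∧ ExactCounts pd δ ∧ ExactCounts pk κ
    · have hmem' : ∀ E, (⟨m, δ, κ, χ, E⟩ : Sample F n) ∈ D := fun E => mem_exactDegrees.2 hmem
      simp only [Set.indicator_of_mem (hmem' _), hconst]
      exact (hgraph m δ κ χ hmem.2.1 hmem.2.2 hmem.1).1
    · have hmem' : ∀ E, (⟨m, δ, κ, χ, E⟩ : Sample F n) ∉ D := fun E => hmem
      simp only [Set.indicator_of_notMem (hmem' _), le_refl]
  have hup : ∫⁻ ω in D, ENNReal.ofReal ω.nul ∂μ ≤ ENNReal.ofReal hi * μ D := by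
    rw [← setLIntegral_const, setLIntegral_sampleLaw, setLIntegral_sampleLaw]
    refine tsum_sampleLaw_mul_mono _ _ _ fun m δ κ χ => ?_
    by_cases hmem : (m : ℝ) = mean pd * n / mean pk ∧ ExactCounts pd δ ∧ ExactCounts pk κ
    · have hmem' : ∀ E, (⟨m, δ, κ, χ, E⟩ : Sample F n) ∈ D := fun E => mem_exactDegrees.2 hmem
      simp only [Set.indicator_of_mem (hmem' _), hconst]
      exact (hgraph m δ κ χ hmem.2.1 hmem.2.2 hmem.1).2
    · have hmem' : ∀ E, (⟨m, δ, κ, χ, E⟩ : Sample F n) ∉ D := fun E => hmem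
      simp only [Set.indicator_of_notMem (hmem' _), le_refl]
  have hprob : IsProbabilityMeasure μ[|D] := cond_isProbabilityMeasure hne
  have hint : Integrable (fun ω : Sample F n => (ω.nul : ℝ)) μ[|D] := by
    refine Integrable.of_bound (C := n) (Measurable.aestronglyMeasurable measurable_from_top)
      (ae_of_all _ fun ω => ?_)
    rw [Real.norm_natCast]
    exact_mod_cast ω.nul_le
  have hnn : 0 ≤ ∫ ω, (ω.nul : ℝ) ∂μ[|D] := integral_nonneg fun ω => Nat.cast_nonneg _
  have heq : ENNReal.ofReal (∫ ω, (ω.nul : ℝ) ∂μ[|D]) =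
      (μ D)⁻¹ * ∫⁻ ω in D, ENNReal.ofReal ω.nul ∂μ := by
    rw [ofReal_integral_eq_lintegral_ofReal hint (ae_of_all _ fun ω => Nat.cast_nonneg _),
      ProbabilityTheory.cond, lintegral_smul_measure, smul_eq_mul]
  have hcancel : ∀ c : ℝ≥0∞, (μ D)⁻¹ * (c * μ D) = c := fun c => by
    rw [mul_comm c, ← mul_assoc, ENNReal.inv_mul_cancel hne (measure_ne_top _ _), one_mul]
  constructor
  · rw [← ENNReal.ofReal_le_ofReal_iff hnn, heq, ← hcancel (ENNReal.ofReal lo)]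
    gcongr
  · rw [← ENNReal.ofReal_le_ofReal_iff hhi, heq, ← hcancel (ENNReal.ofReal hi)]
    gcongr

/-- For large admissible `n`, exact degrees have positive probability in the random matrix model
and the rate is close to the maximum of `Phi`. -/
theorem exists_rate_bounds [Finite F] {pd pk : PMF ℕ} (pχ : PMF Fˣ) (hdb : pd.support.Finite)
    (hkb : pk.support.Finite) (hd : ∀ j ∈ pd.support, 1 ≤ j) (hk : ∀ j ∈ pk.support, 2 ≤ j)
    {M : ℝ} (hM : IsGreatest (Phi pd pk '' Set.Icc 0 1) M) {ε : ℝ} (hε : 0 < ε) :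
    ∃ n₀ : ℕ, ∀ n ≥ n₀, n ∈ admissible pd pk →
      modelLaw pd pk pχ n (exactDegrees F pd pk n) ≠ 0 ∧
      M - ε ≤ rate pd pk pχ n ∧ rate pd pk pχ n ≤ M + ε := by
  obtain ⟨n₀, h₀⟩ := exists_exactCounts_bounds F hdb hkb hd hk hM hε
  refine ⟨n₀, fun n hn hadm => ?_⟩
  obtain ⟨hn0, hda, m, hm, hka⟩ := hadm
  have hn0' : (0 : ℝ) < n := by exact_mod_cast hn0
  have hb := h₀ n hn hn0
  obtain ⟨δ, hδ⟩ := exists_exactCounts hdb hda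
  obtain ⟨κ, hκ⟩ := exists_exactCounts hkb hka
  obtain ⟨-, hG, hχ⟩ := hb m δ κ hδ hκ hm
  have hd1 := one_le_mean hdb hd
  have hk1 := one_le_mean hkb fun j hj => one_le_two.trans (hk j hj)
  have hpos : 0 < mean pd * n / mean pk := by positivity
  have hne := sampleLaw_exactDegrees_ne_zero pχ hpos hδ hκ hm hG
  -- For large `n` exact degrees already guarantee a Tanner graph, so the two successive
  -- conditionings reduce to one.
  have hsub : exactDegrees F pd pk n ⊆ wellDefined F n := by
    rintro ⟨m, δ, κ, χ, E⟩ h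
    obtain ⟨hm, hδ, hκ⟩ := mem_exactDegrees.1 h
    exact ⟨(hb m δ κ hδ hκ hm).1, (hb m δ κ hδ hκ hm).2.1⟩
  have hhi : 0 ≤ (M + ε) * n :=
    (expect_nonneg fun E _ => Nat.cast_nonneg _).trans (hχ fun _ => 1).2
  have hint := integral_nul_cond_bounds (pχ := pχ) hhi hne fun m δ κ hδ hκ hm =>
    (hb m δ κ hδ hκ hm).2
  have hcond : (modelLaw pd pk pχ n)[|exactDegrees F pd pk n] =
      (sampleLaw pd pk pχ n).toMeasure[|exactDegrees F pd pk n] := by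
    rw [modelLaw, cond_cond_eq_cond_inter (measurableSet_sample _) (measurableSet_sample _),
      Set.inter_eq_self_of_subset_right hsub]
  refine ⟨?_, ?_, ?_⟩
  · rw [modelLaw, cond_apply (measurableSet_sample _), Set.inter_eq_self_of_subset_right hsub]
    exact mul_ne_zero (ENNReal.inv_ne_zero.2 (measure_ne_top _ _)) hne
  · rw [rate, hcond, le_inv_mul_iff₀ hn0', mul_comm]
    exact hint.1
  · rw [rate, hcond, inv_mul_le_iff₀ hn0', mul_comm (n : ℝ)]
    exact hint.2

end LDPC

end

/-! ### The limit of the rate -/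

theorem theorem1p2 {F : Type*} [Field F] [Finite F] (pχ : PMF Fˣ) (pd pk : PMF ℕ)
    (hd : ∀ j ∈ pd.support, 1 ≤ j) (hk : ∀ j ∈ pk.support, 3 ≤ j)
    (hdb : pd.support.Finite) (hkb : pk.support.Finite) :
    (∀ᶠ n in atTop ⊓ 𝓟 (LDPC.admissible pd pk),
      LDPC.modelLaw pd pk pχ n (LDPC.exactDegrees F pd pk n) ≠ 0) ∧
    ∃ M : ℝ, IsGreatest (LDPC.Phi pd pk '' Set.Icc 0 1) M ∧
      Tendsto (LDPC.rate pd pk pχ) (atTop ⊓ 𝓟 (LDPC.admissible pd pk)) (𝓝 M) := by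
  obtain ⟨M, hM⟩ := (isCompact_Icc.image (LDPC.continuous_Phi hdb hkb)).exists_isGreatest
    ((Set.nonempty_Icc.2 zero_le_one).image (LDPC.Phi pd pk))
  have key : ∀ ε : ℝ, 0 < ε → ∀ᶠ n in atTop ⊓ 𝓟 (LDPC.admissible pd pk),
      LDPC.modelLaw pd pk pχ n (LDPC.exactDegrees F pd pk n) ≠ 0 ∧
      M - ε ≤ LDPC.rate pd pk pχ n ∧ LDPC.rate pd pk pχ n ≤ M + ε := by
    intro ε hε
    obtain ⟨n₀, h₀⟩ := LDPC.exists_rate_bounds pχ hdb hkb hd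
      (fun j hj => (Nat.le_succ 2).trans (hk j hj)) hM hε
    rw [eventually_inf_principal]
    filter_upwards [eventually_ge_atTop n₀] with n hn hadm using h₀ n hn hadm
  refine ⟨(key 1 one_pos).mono fun n h => h.1, M, hM, ?_⟩
  rw [Metric.tendsto_nhds]
  intro ε hε
  filter_upwards [key (ε / 2) (half_pos hε)] with n hn
  rw [Real.dist_eq, abs_lt]
  constructor <;> linarith [hn.2.1, hn.2.2]
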